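/- Let $R$ be a commutative ring. All modules are $(\mathbb Z,\mathbb Z)$-bigraded $R$-modules, an element of bidegree $(k,l)$ having horizontal degree $k$ and vertical degree $l$; for homogeneous $x,y$ of bidegrees $(x_1,x_2)$, $(y_1,y_2)$ put $\langle x,y\rangle=x_1y_1+x_2y_2$, and use the Koszul sign $(-1)^{\langle x,y\rangle}$ whenever $x$ and $y$ are interchanged. Operads are nonsymmetric operads in bigraded $R$-modules, with arities $n\ge 0$ and partial compositions $\circ_1,\dots,\circ_n$. $\mathrm{End}_A$ denotes the endomorphism operad of $A$, whose elements of arity $n$ and bidegree $p$ are the maps $A^{\otimes n}\to A$ of bidegree $p$. **Derived $A_\infty$-algebras.** $d\mathcal A_\infty$ is the operad generated by elements $m_{ij}$ ($i\ge 0$, $j\ge 1$) of arity $j$ and bidegree $(i,2-i-j)$ subject to the relations, for $u\ge 0$, $v\ge 1$, $$\sum_{\substack{u=i+p,\ v=j+q-1\\ j=r+1+t}}(-1)^{rq+t+pj}\,m_{ij}\circ_{r+1}m_{pq}=0 .$$ A derived $A_\infty$-multiplication on an operad $\mathcal O$ is a morphism of operads $d\mathcal A_\infty\to\mathcal O$;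 write $m_{ij}$ also for the images of the generators. A derived $A_\infty$-algebra is a bigraded module $A$ with maps $m_{ij}:A^{\otimes j}\to A$ ($i\ge0$, $j\ge1$) of bidegree $(i,2-i-j)$ satisfying these relations in $\mathrm{End}_A$. A morphism $f:A\to B$ of derived $A_\infty$-algebras is here a map of bigraded modules (of bidegree $(0,0)$) between derived $A_\infty$-algebras with $f\circ m^A_{ij}=m^B_{ij}\circ f^{\otimes j}$ for all $i\ge 0$, $j\ge 1$. **Suspension and shift.** For an operad $\mathcal P$, the vertical operadic suspension $\mathfrak s\mathcal P$ has the same underlying modules, where an element of $\mathcal P(n)$ of bidegree $(k,l)$ has bidegree $(k,l+n-1)$ in $\mathfrak s\mathcal P(n)$ (its natural bidegree), and insertions $$x\mathbin{\tilde\circ}_{i}y=(-1)^{(n-1)\,l+(n-i)(m-1)}\,x\circ_{i}y,\qquad x\in\mathcal P(n),\ y\in\mathcal P(m),\ l \text{ the vertical degree of } y \text{ in } \mathcal P .$$ The bigraded module underlying $\mathfrak s\mathcal P$, again denoted $\mathfrak s\mathcal P$, is the product $\prod_{n\ge 0}\mathfrak s\mathcal P(n)$ in each bidegree. $S$ denotes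 the vertical shift, $(SA)_k^l=A_k^{l-1}$, and also the canonical map $A\to SA$ of bidegree $(0,1)$. For $F\in\mathrm{End}_A(n)$ put $\overline\sigma(F)=S\circ F\circ(S^{\otimes n})^{-1}\in\mathfrak s\mathrm{End}_{SA}(n)$, where $S^{\otimes n}(y_1\otimes\cdots\otimes y_n)=(-1)^{\sum_v (n-v)\,\mathrm{vdeg}(y_v)}Sy_1\otimes\cdots\otimes Sy_n$. **Braces.** For $x,y_1,\dots,y_j\in\mathfrak s\mathcal P$, the brace $b_j(x;y_1,\dots,y_j)$ is the sum of all order-preserving insertions $\gamma(x;1,\dots,1,y_1,1,\dots,1,y_j,1,\dots,1)$ in the operad $\mathfrak s\mathcal P$ of (the arity components of) $y_1,\dots,y_j$ into (those of) $x$; in particular $b_0(x)=x$. **The structures.** Let $\mathcal O$ be an operad with a derived $A_\infty$-multiplication, and let $m_{i\bullet}=\sum_{j\ge1}m_{ij}\in\mathfrak s\mathcal O$, which has bidegree $(i,1-i)$. Define $M'_{ij}:(\mathfrak s\mathcal O)^{\otimes j}\to\mathfrak s\mathcal O$ by $$M'_{ij}(y_1,\dots,y_j)=b_j(m_{i\bullet};y_1,\dots,y_j)\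 (j\ge 2),\qquad M'_{i1}(y)=b_1(m_{i\bullet};y)-(-1)^{\langle y,m_{i\bullet}\rangle}b_1(y;m_{i\bullet}),$$ and put $M_{ij}=\overline\sigma(M'_{ij}):(S\mathfrak s\mathcal O)^{\otimes j}\to S\mathfrak s\mathcal O$. Let $M_{i\bullet}=\sum_{j\ge 1}M_{ij}\in\mathfrak s\mathrm{End}_{S\mathfrak s\mathcal O}$, of bidegree $(i,1-i)$; define $\overline M'_{ij}:(\mathfrak s\mathrm{End}_{S\mathfrak s\mathcal O})^{\otimes j}\to\mathfrak s\mathrm{End}_{S\mathfrak s\mathcal O}$ by the same two formulas with $M_{i\bullet}$ in place of $m_{i\bullet}$ and the braces of $\mathfrak s\mathrm{End}_{S\mathfrak s\mathcal O}$, and put $\overline M_{ij}=\overline\sigma(\overline M'_{ij}):(S\mathfrak s\mathrm{End}_{S\mathfrak s\mathcal O})^{\otimes j}\to S\mathfrak s\mathrm{End}_{S\mathfrak s\mathcal O}$. Finally let $$\Phi:S\mathfrak s\mathcal O\to S\mathfrak s\mathrm{End}_{S\mathfrak s\mathcal O},\qquad \Phi(Sy)=S\Bigl(\sum_{n\ge0}\overline\sigma\bigl(b_n(y;-)\bigr)\Bigr).$$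 **Theorem.** $(S\mathfrak s\mathcal O,\{M_{ij}\})$ and $(S\mathfrak s\mathrm{End}_{S\mathfrak s\mathcal O},\{\overline M_{ij}\})$ are derived $A_\infty$-algebras, and $\Phi$ is a morphism of derived $A_\infty$-algebras between them: it is $R$-linear of bidegree $(0,0)$ and, for all $i\ge 0$ and $j\ge 1$, $$\Phi(M_{ij}(x_1,\dots,x_j))=\overline M_{ij}(\Phi(x_1),\dots,\Phi(x_j))\qquad\text{for all }x_1,\dots,x_j\in S\mathfrak s\mathcal O .$$ -/

import Mathlib

open scoped DirectSum

universe u v w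

noncomputable section

namespace DerivedAInf

/-- Bidegrees `(horizontal, vertical)`. -/
abbrev Bideg : Type := ℤ × ℤ

/-- The pairing `⟨x, y⟩ = x₁ y₁ + x₂ y₂` of bidegrees. -/
def pair (x y : Bideg) : ℤ := x.1 * y.1 + x.2 * y.2

/-- The sign `(-1) ^ k`, as an element of the ground ring. -/
def sgn (R : Type u) [CommRing R] (k : ℤ) : R := ((k.negOnePow : ℤ) : R)

lemma sgn_add (R : Type u) [CommRing R] (k l : ℤ) : sgn R (k + l) = sgn R k * sgn R l := by
  simp [sgn, Int.negOnePow_add]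

lemma sgn_zero (R : Type u) [CommRing R] : sgn R 0 = 1 := by simp [sgn]

lemma sgn_even (R : Type u) [CommRing R] {k : ℤ} (h : Even k) : sgn R k = 1 := by
  simp [sgn, Int.negOnePow_even k h]

lemma sgn_congr (R : Type u) [CommRing R] {k l : ℤ} (h : Even (k - l)) : sgn R k = sgn R l := by
  have : k = (k - l) + l := by ring
  rw [this, sgn_add, sgn_even R h, one_mul]

/-- A `(ℤ, ℤ)`-bigraded `R`-module. -/
structure BiMod (R : Type u) [CommRing R] where
  obj : Bideg → Type v
  [grp : ∀ d, AddCommGroup (obj d)]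
  [mod : ∀ d, Module R (obj d)]

attribute [instance] BiMod.grp BiMod.mod

/-- A nonsymmetric operad in bigraded `R`-modules, presented through its unit and its partial
compositions (insertions). Input slots are numbered from `0`, so `comp _ _ i x y` is `x ∘_{i+1} y`.
The arity `k` and the bidegree `r` of a composite are free variables constrained by `k + 1 = n + m`
and `r = p + q`. -/
structure Operad (R : Type u) [CommRing R] where
  obj : ℕ → Bideg → Type v
  [grp : ∀ n d, AddCommGroup (obj n d)]
  [mod : ∀ n d, Module R (obj n d)]
  one : ∀ {d : Bideg}, d = 0 → obj 1 d
  comp : ∀ {n m k : ℕ} {p q r : Bideg}, k + 1 = n + m → r = p + q → Fin n →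
    (obj n p →ₗ[R] obj m q →ₗ[R] obj k r)
  one_comp : ∀ {m : ℕ} {d q : Bideg} (hd : d = 0) (hk : m + 1 = 1 + m) (hr : q = d + q)
    (x : obj m q), comp hk hr 0 (one hd) x = x
  comp_one : ∀ {n : ℕ} {d p : Bideg} (hd : d = 0) (hk : n + 1 = n + 1) (hr : p = p + d)
    (i : Fin n) (x : obj n p), comp hk hr i x (one hd) = x
  assoc : ∀ {n m l k k₁ k₂ : ℕ} {p q s r r₁ r₂ : Bideg}
    (h₁ : k₁ + 1 = n + m) (g₁ : r₁ = p + q) (h : k + 1 = k₁ + l) (g : r = r₁ + s)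
    (h₂ : k₂ + 1 = m + l) (g₂ : r₂ = q + s) (h' : k + 1 = n + k₂) (g' : r = p + r₂)
    (i : Fin n) (j : Fin m) (a : Fin k₁) (_ : (a : ℕ) = i + j)
    (x : obj n p) (y : obj m q) (z : obj l s),
      comp h g a (comp h₁ g₁ i x y) z = comp h' g' i x (comp h₂ g₂ j y z)
  parallel : ∀ {n m l k k₁ k₂ : ℕ} {p q s r r₁ r₂ : Bideg}
    (h₁ : k₁ + 1 = n + m) (g₁ : r₁ = p + q) (h : k + 1 = k₁ + l) (g : r = r₁ + s)
    (h₂ : k₂ + 1 = n + l) (g₂ : r₂ = p + s) (h' : k + 1 = k₂ + m) (g' : r = r₂ + q)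
    (i j : Fin n) (_ : i < j) (a : Fin k₁) (_ : (a : ℕ) + 1 = j + m) (b : Fin k₂)
    (_ : (b : ℕ) = i) (x : obj n p) (y : obj m q) (z : obj l s),
      comp h g a (comp h₁ g₁ i x y) z =
        sgn R (pair q s) • comp h' g' b (comp h₂ g₂ j x z) y

attribute [instance] Operad.grp Operad.mod

variable {R : Type u} [CommRing R]


lemma susp_deg {n m k : ℕ} {p q r : Bideg} (hk : k + 1 = n + m) (hr : r = p + q) :
    ((r.1, r.2 - ((k : ℤ) - 1)) : Bideg) =
      (p.1, p.2 - ((n : ℤ) - 1)) + (q.1, q.2 - ((m : ℤ) - 1)) := by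
  subst hr
  refine Prod.ext rfl ?_
  have : (k : ℤ) + 1 = n + m := by exact_mod_cast hk
  simp only [Prod.snd_add]
  linarith

/-- The vertical operadic suspension `𝔰P`, `𝔰P(n) = P(n) ⊗ Λ(n)`, where `Λ(n)` is free on one
generator `eⁿ` of bidegree `(0, n - 1)`: an element `x ⊗ eⁿ` of (natural) bidegree `d` is an element
`x ∈ P(n)` of (internal) bidegree `d - (0, n - 1)`. The sign of an insertion is the Koszul sign
`(n - 1) * vdeg y` of moving `eⁿ` past `y`, together with the sign of
`eⁿ ∘_{i+1} eᵐ = (-1) ^ ((n - 1 - i) * (m - 1)) eⁿ⁺ᵐ⁻¹`. -/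
@[reducible] def susp (P : Operad.{u, v} R) : Operad.{u, v} R where
  obj n d := P.obj n (d.1, d.2 - ((n : ℤ) - 1))
  one hd := P.one (by rw [hd]; simp)
  comp {n m k p q r} hk hr i :=
    sgn R (((n : ℤ) - 1) * (q.2 - ((m : ℤ) - 1)) + ((n : ℤ) - 1 - i) * ((m : ℤ) - 1)) •
      P.comp hk (susp_deg hk hr) i
  one_comp hd hk hr x := by
    simp only [LinearMap.smul_apply]
    rw [P.one_comp, sgn_even, one_smul]
    simp
  comp_one hd hk hr i x := by
    simp only [LinearMap.smul_apply]
    rw [P.comp_one, sgn_even, one_smul]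
    simp [hd]
  assoc {n m l k k₁ k₂ p q s r r₁ r₂} h₁ g₁ h g h₂ g₂ h' g' i j a ha x y z := by
    simp only [LinearMap.smul_apply, map_smul, smul_smul, ← sgn_add]
    rw [P.assoc _ _ _ _ h₂ (susp_deg h₂ g₂) h' (susp_deg h' g') i j a ha]
    congr 1
    apply sgn_congr
    have e₁ : (k₁ : ℤ) = n + m - 1 := by omega
    have e₂ : (k₂ : ℤ) = m + l - 1 := by omega
    have e₃ : (a : ℤ) = i + j := by exact_mod_cast ha
    rw [e₁, e₂, e₃, g₂]
    simp only [Prod.snd_add]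
    exact ⟨0, by ring⟩
  parallel {n m l k k₁ k₂ p q s r r₁ r₂} h₁ g₁ h g h₂ g₂ h' g' i j hij a ha b hb x y z := by
    simp only [LinearMap.smul_apply, map_smul, smul_smul, ← sgn_add]
    rw [P.parallel _ _ _ _ h₂ (susp_deg h₂ g₂) h' (susp_deg h' g') i j hij a ha b hb]
    rw [smul_smul, ← sgn_add]
    congr 1
    apply sgn_congr
    have e₁ : (k₁ : ℤ) = n + m - 1 := by omega
    have e₂ : (k₂ : ℤ) = n + l - 1 := by omega
    have e₃ : (a : ℤ) = j + m - 1 := by omega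
    have e₄ : (b : ℤ) = i := by exact_mod_cast hb
    rw [e₁, e₂, e₃, e₄]
    simp only [pair]
    exact ⟨-(l - 1) * (q.2 - (m - 1)) - (l - 1) * (m - 1), by ring⟩


/-- The underlying module `⨁ d, X d` of a bigraded module. -/
abbrev BiMod.sum (X : BiMod.{u, v} R) : Type v := ⨁ d, X.obj d

/-- The inclusion of the homogeneous elements of bidegree `d`. -/
abbrev BiMod.of (X : BiMod.{u, v} R) (d : Bideg) : X.obj d →ₗ[R] X.sum :=
  DirectSum.lof R Bideg X.obj d

/-- The Koszul sign operator `x ↦ (-1) ^ ⟨q, x⟩ x` (`x` homogeneous), which records that something of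
bidegree `q` moves past `x`. -/
def BiMod.koszul (X : BiMod.{u, v} R) (q : Bideg) : X.sum →ₗ[R] X.sum :=
  DirectSum.lmap fun d => sgn R (pair q d) • LinearMap.id

/-- Multilinear maps `X^{⊗n} → X`. -/
abbrev BiMod.Multi (X : BiMod.{u, v} R) (n : ℕ) : Type v :=
  MultilinearMap R (fun _ : Fin n => X.sum) X.sum

/-- The maps `X^{⊗n} → X` of bidegree `p`. -/
def BiMod.hom (X : BiMod.{u, v} R) (n : ℕ) (p : Bideg) : Submodule R (X.Multi n) where
  carrier := {f | ∀ (d : Fin n → Bideg) (x : ∀ v, X.obj (d v)),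
    f (fun v => X.of (d v) (x v)) ∈ LinearMap.range (X.of (∑ v, d v + p))}
  add_mem' hf hg d x := add_mem (hf d x) (hg d x)
  zero_mem' _ _ := zero_mem _
  smul_mem' c _ hf d x := Submodule.smul_mem _ c (hf d x)

/-- The arguments fed to `f` in `f(1^{⊗i} ⊗ g ⊗ 1^{⊗(n-1-i)})`, for `g` of bidegree `q`. -/
def BiMod.args (X : BiMod.{u, v} R) {n m k : ℕ} (hk : k + 1 = n + m) (q : Bideg) (i : Fin n)
    (g : X.Multi m) (x : Fin k → X.sum) (v : Fin n) : X.sum :=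
  if h : (v : ℕ) < i then X.koszul q (x ⟨v, by omega⟩)
  else if h' : (v : ℕ) = i then g (fun w => x ⟨i + w, by omega⟩)
  else x ⟨v + m - 1, by omega⟩

section args
variable (X : BiMod.{u, v} R) {n m k : ℕ} (hk : k + 1 = n + m) (q : Bideg) (i : Fin n)
  (g : X.Multi m) (x : Fin k → X.sum)

lemma BiMod.args_lt (v : Fin n) (h : (v : ℕ) < i) :
    X.args hk q i g x v = X.koszul q (x ⟨v, by omega⟩) := by
  simp [args, h]

lemma BiMod.args_eq (v : Fin n) (h : (v : ℕ) = i) :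
    X.args hk q i g x v = g (fun w => x ⟨i + w, by omega⟩) := by
  simp [args, h]

lemma BiMod.args_gt (v : Fin n) (h : (i : ℕ) < v) :
    X.args hk q i g x v = x ⟨v + m - 1, by omega⟩ := by
  simp [args, h.not_gt, h.ne']

lemma BiMod.args_update [DecidableEq (Fin k)] (s : Fin k) :
    ∃ (v : Fin n) (L : X.sum →ₗ[R] X.sum),
      ∀ y, X.args hk q i g (Function.update x s y) =
        Function.update (X.args hk q i g x) v (L y) := by
  rcases lt_or_ge (s : ℕ) i with h | h
  · refine ⟨⟨s, by omega⟩, X.koszul q, fun y => ?_⟩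
    funext v
    rcases lt_trichotomy (v : ℕ) i with hv | hv | hv
    · simp only [X.args_lt hk q i g _ v hv, Function.update_apply, Fin.ext_iff]
      split_ifs <;> rfl
    · simp only [X.args_eq hk q i g _ v hv, Function.update_apply, Fin.ext_iff]
      rw [if_neg (by omega)]
      congr 1; funext w
      rw [if_neg (by omega)]
    · simp only [X.args_gt hk q i g _ v hv, Function.update_apply, Fin.ext_iff]
      rw [if_neg (by omega), if_neg (by omega)]
  rcases lt_or_ge (s : ℕ) (i + m) with h' | h'
  · refine ⟨i, g.toLinearMap (fun w => x ⟨i + w, by omega⟩) ⟨s - i, by omega⟩, fun y => ?_⟩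
    funext v
    rcases lt_trichotomy (v : ℕ) i with hv | hv | hv
    · simp only [X.args_lt hk q i g _ v hv, Function.update_apply, Fin.ext_iff]
      rw [if_neg (by omega), if_neg (by omega)]
    · simp only [X.args_eq hk q i g _ v hv, Function.update_apply, Fin.ext_iff]
      rw [if_pos hv, MultilinearMap.toLinearMap_apply]
      congr 1; funext w
      simp only [Function.update_apply, Fin.ext_iff]
      congr 1
      simp only [eq_iff_iff]
      omega
    · simp only [X.args_gt hk q i g _ v hv, Function.update_apply, Fin.ext_iff]
      rw [if_neg (by omega), if_neg (by omega)]
  · refine ⟨⟨s + 1 - m, by omega⟩, LinearMap.id, fun y => ?_⟩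
    funext v
    rcases lt_trichotomy (v : ℕ) i with hv | hv | hv
    · simp only [X.args_lt hk q i g _ v hv, Function.update_apply, Fin.ext_iff]
      rw [if_neg (by omega), if_neg (by omega)]
    · simp only [X.args_eq hk q i g _ v hv, Function.update_apply, Fin.ext_iff]
      rw [if_neg (by omega)]
      congr 1; funext w
      rw [if_neg (by omega)]
    · simp only [X.args_gt hk q i g _ v hv, Function.update_apply, Fin.ext_iff]
      simp only [LinearMap.id_apply]
      congr 1
      simp only [eq_iff_iff]
      omega

/-- As a function of `g`, the argument family is an update of a family not depending on `g`. -/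
lemma BiMod.args_eq_update :
    X.args hk q i g x =
      Function.update (X.args hk q i 0 x) i (g (fun w => x ⟨i + w, by omega⟩)) := by
  funext v
  rcases lt_trichotomy (v : ℕ) i with hv | hv | hv
  · rw [X.args_lt _ _ _ _ _ _ hv, Function.update_of_ne (by omega), X.args_lt _ _ _ _ _ _ hv]
  · obtain rfl : v = i := Fin.ext hv
    rw [X.args_eq _ _ _ _ _ _ rfl, Function.update_self]
  · rw [X.args_gt _ _ _ _ _ _ hv, Function.update_of_ne (by omega), X.args_gt _ _ _ _ _ _ hv]

end args

/-- `f(1^{⊗i} ⊗ g ⊗ 1^{⊗(n-1-i)})`, where `q` is the bidegree of `g`. -/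
def BiMod.insert (X : BiMod.{u, v} R) {n m k : ℕ} (hk : k + 1 = n + m) (q : Bideg) (i : Fin n) :
    X.Multi n →ₗ[R] X.Multi m →ₗ[R] X.Multi k :=
  LinearMap.mk₂ R
    (fun f g =>
      { toFun := fun x => f (X.args hk q i g x)
        map_update_add' := by
          intro _ x s y z
          obtain ⟨v, L, h⟩ := X.args_update hk q i g x s
          rw [h, h, h, map_add, f.map_update_add]
        map_update_smul' := by
          intro _ x s c y
          obtain ⟨v, L, h⟩ := X.args_update hk q i g x s
          rw [h, h, map_smul, f.map_update_smul] })
    (fun f f' g => by ext; simp)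
    (fun c f g => by ext; simp)
    (fun f g g' => by
      refine MultilinearMap.ext fun x => ?_
      change f (X.args hk q i (g + g') x) = f (X.args hk q i g x) + f (X.args hk q i g' x)
      rw [X.args_eq_update, X.args_eq_update (g := g), X.args_eq_update (g := g'),
        add_apply, f.map_update_add])
    (fun c f g => by
      refine MultilinearMap.ext fun x => ?_
      change f (X.args hk q i (c • g) x) = c • f (X.args hk q i g x)
      rw [X.args_eq_update, X.args_eq_update (g := g), smul_apply,
        f.map_update_smul])


lemma BiMod.insert_apply (X : BiMod.{u, v} R) {n m k : ℕ} (hk : k + 1 = n + m) (q : Bideg)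
    (i : Fin n) (f : X.Multi n) (g : X.Multi m) (x : Fin k → X.sum) :
    X.insert hk q i f g x = f (X.args hk q i g x) := rfl

lemma sum_block {M : Type*} [AddCommMonoid M] {n m k : ℕ} (hk : k + 1 = n + m) (i : Fin n)
    (d : Fin k → M) (c : M) :
    (∑ v : Fin n, if h : (v : ℕ) < i then d ⟨v, by omega⟩
      else if h' : (v : ℕ) = i then (∑ w : Fin m, d ⟨i + w, by omega⟩) + c
      else d ⟨v + m - 1, by omega⟩) = ∑ s, d s + c := by
  obtain ⟨i, hi⟩ := i
  obtain ⟨t, rfl⟩ : ∃ t, n = i + 1 + t := ⟨n - (i + 1), by omega⟩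
  obtain rfl : k = i + m + t := by omega
  rw [Fin.sum_univ_add, Fin.sum_univ_add (a := i + m), Fin.sum_univ_add (a := i) (b := m),
    Fin.sum_univ_castSucc]
  have e : ∀ v : Fin t, ¬ (i + 1 + (v : ℕ) < i) ∧ ¬ (i + 1 + (v : ℕ) = i) ∧
      i + 1 + (v : ℕ) + m - 1 = i + m + v := fun v => by omega
  simp only [Fin.val_natAdd, Fin.val_castAdd, Fin.val_castSucc, Fin.val_last, Fin.is_lt, dif_pos,
    lt_irrefl, dif_neg, not_false_eq_true, e]
  have e' : ∀ A B C : M, A + (B + c) + C = A + B + C + c := fun A B C => by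
    rw [← add_assoc, add_right_comm]
  exact e' _ _ _

lemma BiMod.hom_apply (X : BiMod.{u, v} R) {n : ℕ} {p : Bideg} {f : X.Multi n}
    (hf : f ∈ X.hom n p) {d : Fin n → Bideg} {x : Fin n → X.sum}
    (hx : ∀ v, x v ∈ LinearMap.range (X.of (d v))) :
    f x ∈ LinearMap.range (X.of (∑ v, d v + p)) := by
  choose y hy using hx
  have := hf d y
  simpa only [hy] using this

lemma BiMod.koszul_of (X : BiMod.{u, v} R) (q d : Bideg) (x : X.obj d) :
    X.koszul q (X.of d x) = sgn R (pair q d) • X.of d x := by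
  simp [koszul, BiMod.of, DirectSum.lmap_lof]

lemma BiMod.koszul_of_mem (X : BiMod.{u, v} R) {q d : Bideg} {x : X.sum}
    (hx : x ∈ LinearMap.range (X.of d)) :
    X.koszul q x = sgn R (pair q d) • x := by
  obtain ⟨x, rfl⟩ := hx
  exact X.koszul_of q d x

lemma BiMod.koszul_add (X : BiMod.{u, v} R) (q s : Bideg) (x : X.sum) :
    X.koszul (q + s) x = X.koszul q (X.koszul s x) := by
  suffices h : X.koszul (q + s) = X.koszul q ∘ₗ X.koszul s from LinearMap.congr_fun h x
  refine DirectSum.linearMap_ext R fun d => LinearMap.ext fun x => ?_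
  simp only [LinearMap.comp_apply]
  erw [X.koszul_of, X.koszul_of, map_smul, X.koszul_of]
  rw [smul_smul, ← sgn_add]
  congr 2
  simp [pair]; ring

lemma BiMod.koszul_zero (X : BiMod.{u, v} R) (x : X.sum) : X.koszul 0 x = x := by
  suffices h : X.koszul 0 = LinearMap.id from LinearMap.congr_fun h x
  refine DirectSum.linearMap_ext R fun d => LinearMap.ext fun x => ?_
  simp only [LinearMap.comp_apply]
  erw [X.koszul_of]
  simp [pair, sgn_zero]

lemma BiMod.koszul_hom (X : BiMod.{u, v} R) {n : ℕ} {p : Bideg} {f : X.Multi n}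
    (hf : f ∈ X.hom n p) (q : Bideg) (x : Fin n → X.sum) :
    f (fun v => X.koszul q (x v)) = sgn R (pair p q) • X.koszul q (f x) := by
  suffices h : f.compLinearMap (fun _ => X.koszul q) =
      sgn R (pair p q) • (X.koszul q).compMultilinearMap f from DFunLike.congr_fun h x
  refine MultilinearMap.directSum_ext fun d => MultilinearMap.ext fun x => ?_
  change f (fun v => X.koszul q (X.of (d v) (x v))) =
    sgn R (pair p q) • X.koszul q (f fun v => X.of (d v) (x v))
  simp only [X.koszul_of]
  rw [f.map_smul_univ, X.koszul_of_mem (hf d x), smul_smul, ← sgn_add]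
  congr 1
  have : ∀ s : Finset (Fin n), ∏ v ∈ s, sgn R (pair q (d v)) = sgn R (∑ v ∈ s, pair q (d v)) := by
    intro s
    induction s using Finset.induction_on with
    | empty => simp [sgn_zero]
    | insert a s ha ih => rw [Finset.prod_insert ha, Finset.sum_insert ha, ih, sgn_add]
  rw [this]
  apply sgn_congr
  simp only [pair, Finset.sum_add_distrib, Prod.fst_add, Prod.snd_add, Prod.fst_sum, Prod.snd_sum,
    ← Finset.mul_sum]
  exact ⟨-(p.1 * q.1 + p.2 * q.2), by ring⟩

lemma BiMod.insert_mem (X : BiMod.{u, v} R) {n m k : ℕ} {p q r : Bideg} (hk : k + 1 = n + m)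
    (hr : r = p + q) (i : Fin n) {f : X.Multi n} {g : X.Multi m} (hf : f ∈ X.hom n p)
    (hg : g ∈ X.hom m q) : X.insert hk q i f g ∈ X.hom k r := by
  intro d x
  rw [X.insert_apply]
  have := X.hom_apply (f := f) hf (x := X.args hk q i g fun s => X.of (d s) (x s))
    (d := fun v => if h : (v : ℕ) < i then d ⟨v, by omega⟩
      else if h' : (v : ℕ) = i then (∑ w : Fin m, d ⟨i + w, by omega⟩) + q
      else d ⟨v + m - 1, by omega⟩) (fun v => ?_)
  · rw [sum_block hk, add_assoc, add_comm q p, ← hr] at this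
    exact this
  · rcases lt_trichotomy (v : ℕ) i with hv | hv | hv
    · rw [X.args_lt _ _ _ _ _ _ hv, X.koszul_of, dif_pos hv]
      exact Submodule.smul_mem _ _ ⟨_, rfl⟩
    · rw [X.args_eq _ _ _ _ _ _ hv, dif_neg (by omega), dif_pos hv]
      exact hg (fun w => d ⟨i + w, by omega⟩) fun w => x _
    · rw [X.args_gt _ _ _ _ _ _ hv, dif_neg (by omega), dif_neg (by omega)]
      exact ⟨_, rfl⟩

/-- The endomorphism operad of a bigraded module, `End_X(n) = Hom(X^{⊗n}, X)` for all `n ≥ 0`. -/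
@[reducible] def endOp (X : BiMod.{u, v} R) : Operad.{u, v} R where
  obj n p := X.hom n p
  one hd := ⟨MultilinearMap.ofSubsingleton R X.sum X.sum 0 LinearMap.id, by
    intro d x
    have : d 0 = ∑ v, d v + 0 := by simp
    subst hd
    rw [← this]
    exact ⟨_, rfl⟩⟩
  comp {n m k p q r} hk hr i :=
    LinearMap.mk₂ R (fun f g => ⟨X.insert hk q i f g, X.insert_mem hk hr i f.2 g.2⟩)
      (fun f f' g => by ext1; simp) (fun c f g => by ext1; simp)
      (fun f g g' => by ext1; simp) (fun c f g => by ext1; simp)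
  one_comp {m d q} hd hk hr f := by
    refine Subtype.ext (MultilinearMap.ext fun x => ?_)
    change X.args hk q 0 f x 0 = f.1 x
    rw [X.args_eq _ _ _ _ _ _ rfl]
    congr 1; funext w; congr 1; ext; simp
  comp_one {n d p} hd hk hr i f := by
    refine Subtype.ext (MultilinearMap.ext fun x => ?_)
    subst hd
    change f.1 (X.args hk 0 i _ x) = f.1 x
    congr 1; funext v
    rcases lt_trichotomy (v : ℕ) i with hv | hv | hv
    · rw [X.args_lt _ _ _ _ _ _ hv, X.koszul_zero]
    · rw [X.args_eq _ _ _ _ _ _ hv]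
      change x _ = x _
      congr 1; ext; simp [hv]
    · rw [X.args_gt _ _ _ _ _ _ hv]
      congr 1
  assoc {n m l k k₁ k₂ p q s r r₁ r₂} h₁ g₁ h g h₂ g₂ h' g' i j a ha x y z := by
    refine Subtype.ext (MultilinearMap.ext fun u => ?_)
    change x.1 (X.args h₁ q i y.1 (X.args h s a z.1 u)) =
      x.1 (X.args h' r₂ i (X.insert h₂ s j y.1 z.1) u)
    congr 1; funext v
    rcases lt_trichotomy (v : ℕ) i with hv | hv | hv
    · rw [X.args_lt _ _ _ _ _ _ hv, X.args_lt _ _ _ _ _ _ hv, X.args_lt _ _ _ _ _ _ (by simp; omega),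
        g₂, X.koszul_add]
    · rw [X.args_eq _ _ _ _ _ _ hv, X.args_eq _ _ _ _ _ _ hv, X.insert_apply]
      congr 1; funext w
      rcases lt_trichotomy (w : ℕ) j with hw | hw | hw
      · rw [X.args_lt _ _ _ _ _ _ hw, X.args_lt _ _ _ _ _ _ (by simp; omega)]
      · rw [X.args_eq _ _ _ _ _ _ hw, X.args_eq _ _ _ _ _ _ (by simp; omega)]
        congr 1; funext t; congr 1; ext; simp; omega
      · rw [X.args_gt _ _ _ _ _ _ hw, X.args_gt _ _ _ _ _ _ (by simp; omega)]
        congr 1; ext; simp; omega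
    · rw [X.args_gt _ _ _ _ _ _ hv, X.args_gt _ _ _ _ _ _ hv, X.args_gt _ _ _ _ _ _ (by simp; omega)]
      congr 1; ext; simp; omega
  parallel {n m l k k₁ k₂ p q s r r₁ r₂} h₁ g₁ h g h₂ g₂ h' g' i j hij a ha b hb x y z := by
    refine Subtype.ext (MultilinearMap.ext fun u => ?_)
    change x.1 (X.args h₁ q i y.1 (X.args h s a z.1 u)) =
      sgn R (pair q s) • x.1 (X.args h₂ s j z.1 (X.args h' q b y.1 u))
    have hij' : (i : ℕ) < j := hij
    have key : ∀ (c : R) (A : Fin n → X.sum), c • x.1 A = x.1 (Function.update A i (c • A i)) :=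
      fun c A => by rw [x.1.map_update_smul, Function.update_eq_self]
    rw [key]
    congr 1; funext v
    rcases lt_trichotomy (v : ℕ) i with hv | hv | hv
    · rw [Function.update_of_ne (by omega), X.args_lt _ _ _ _ _ _ hv,
        X.args_lt _ _ _ _ _ _ (by simp; omega), X.args_lt _ _ _ _ _ _ (by simp; omega),
        X.args_lt _ _ _ _ _ _ (by simp; omega), ← X.koszul_add, ← X.koszul_add, add_comm]
    · obtain rfl : v = i := Fin.ext hv
      rw [Function.update_self, X.args_eq _ _ _ _ _ _ rfl, X.args_lt _ _ _ _ _ _ hij',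
        X.args_eq _ _ _ _ _ _ (by simp [hb]), ← X.koszul_hom y.2]
      congr 1; funext w
      rw [X.args_lt _ _ _ _ _ _ (by simp; omega)]
      congr 2; ext; simp [hb]
    · rw [Function.update_of_ne (by omega), X.args_gt _ _ _ _ _ _ hv]
      rcases lt_trichotomy (v : ℕ) j with hw | hw | hw
      · rw [X.args_lt _ _ _ _ _ _ hw, X.args_lt _ _ _ _ _ _ (by simp; omega),
          X.args_gt _ _ _ _ _ _ (by simp; omega)]
      · rw [X.args_eq _ _ _ _ _ _ hw, X.args_eq _ _ _ _ _ _ (by simp; omega)]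
        congr 1; funext t
        rw [X.args_gt _ _ _ _ _ _ (by simp; omega)]
        congr 1; ext; simp; omega
      · rw [X.args_gt _ _ _ _ _ _ hw, X.args_gt _ _ _ _ _ _ (by simp; omega),
          X.args_gt _ _ _ _ _ _ (by simp; omega)]
        congr 1; ext; simp; omega

/-- The vertical shift `SX`, `(SX)_i^j = X_i^{j-1}`. -/
@[reducible] def BiMod.shift (X : BiMod.{u, v} R) : BiMod.{u, v} R where
  obj d := X.obj (d.1, d.2 - 1)

/-- Raising the vertical degree by one. -/
def raise : Bideg ≃ Bideg where
  toFun d := (d.1, d.2 + 1)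
  invFun d := (d.1, d.2 - 1)
  left_inv d := by simp
  right_inv d := by simp

/-- The shift map `S : X → SX`, of bidegree `(0, 1)`. -/
def BiMod.S (X : BiMod.{u, v} R) : X.sum ≃ₗ[R] X.shift.sum :=
  DirectSum.lequivCongrLeft R raise

lemma BiMod.S_of (X : BiMod.{u, v} R) (d : Bideg) (x : X.obj (d.1, d.2 - 1)) :
    X.S (X.of (d.1, d.2 - 1) x) = X.shift.of d x := by
  refine DFinsupp.ext fun e => ?_
  rw [show X.S (X.of (d.1, d.2 - 1) x) e = X.of (d.1, d.2 - 1) x (raise.symm e) from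
    DirectSum.lequivCongrLeft_apply ..]
  by_cases h : e = d
  · subst h
    exact (DFinsupp.single_eq_same (i := raise.symm e) (b := x)).trans
      (DFinsupp.single_eq_same (β := X.shift.obj) (i := e) (b := x)).symm
  · have h' : raise.symm e ≠ raise.symm d := fun h' => h (raise.symm.injective h')
    exact (DFinsupp.single_eq_of_ne h').trans
      (DFinsupp.single_eq_of_ne (β := X.shift.obj) (b := x) h).symm

lemma BiMod.S_mem (X : BiMod.{u, v} R) {d e : Bideg} (h : e = (d.1, d.2 - 1)) {x : X.sum}
    (hx : x ∈ LinearMap.range (X.of e)) : X.S x ∈ LinearMap.range (X.shift.of d) := by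
  subst h
  obtain ⟨x, rfl⟩ := hx
  exact ⟨x, (X.S_of d x).symm⟩

lemma BiMod.S_symm_of (X : BiMod.{u, v} R) (d : Bideg) (x : X.obj (d.1, d.2 - 1)) :
    X.S.symm (X.shift.of d x) = X.of (d.1, d.2 - 1) x := by
  rw [LinearEquiv.symm_apply_eq, X.S_of]

/-- `σ̄(F) = S ∘ F ∘ (S^{⊗n})⁻¹`. By the Koszul rule,
`S^{⊗n}(x₀, …, x_{n-1}) = ∏ᵥ (-1) ^ ((n - 1 - v) * vdeg xᵥ) (S x₀, …, S x_{n-1})`. -/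
def sigmaBarMap (X : BiMod.{u, v} R) (n : ℕ) : X.Multi n →ₗ[R] X.shift.Multi n :=
  (X.S : X.sum →ₗ[R] X.shift.sum).compMultilinearMapₗ R ∘ₗ
    MultilinearMap.compLinearMapₗ fun v : Fin n =>
      X.koszul (0, (n : ℤ) - 1 - v) ∘ₗ (X.S.symm : X.shift.sum →ₗ[R] X.sum)

lemma sigmaBarMap_mem (X : BiMod.{u, v} R) (n : ℕ) (p : Bideg) (f : X.Multi n)
    (hf : f ∈ X.hom n p) :
    sigmaBarMap X n f ∈ X.shift.hom n (p.1, p.2 - ((n : ℤ) - 1)) := by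
  intro d x
  change X.S (f fun v => X.koszul (0, (n : ℤ) - 1 - v) (X.S.symm (X.shift.of (d v) (x v)))) ∈ _
  have := X.hom_apply hf (d := fun v => ((d v).1, (d v).2 - 1))
    (x := fun v => X.koszul (0, (n : ℤ) - 1 - v) (X.S.symm (X.shift.of (d v) (x v))))
    fun v => by
      rw [X.S_symm_of, X.koszul_of]
      exact Submodule.smul_mem _ _ ⟨_, rfl⟩
  refine X.S_mem ?_ this
  ext
  · simp [Prod.fst_sum]
  · simp [Prod.snd_sum, Finset.sum_sub_distrib]
    ring

/-- `σ̄ : End_X(n) → (𝔰 End_{SX})(n)`. -/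
def sigmaBar (X : BiMod.{u, v} R) (n : ℕ) (p : Bideg) :
    (endOp X).obj n p →ₗ[R] (susp (endOp X.shift)).obj n p :=
  ((sigmaBarMap X n).domRestrict (X.hom n p)).codRestrict _ fun f =>
    sigmaBarMap_mem X n p f f.2

/-- The bigraded module underlying an operad: `P_i^j = ∏ₙ P(n)_i^j`. -/
@[reducible] def Operad.tot (P : Operad.{u, v} R) : BiMod.{u, v} R where
  obj d := ∀ n, P.obj n d

/-- Order-preserving insertions. For `x ∈ P(N)` and `yᵥ ∈ P(aᵥ)`, this is the sum of all
`γ(x; 1, …, 1, y₀, 1, …, 1, y_{j-1}, 1, …, 1)` in which `y₀` occupies one of the input slots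
`k, k + 1, …, N - 1` of `x`. The compositions are performed by successive insertions from left to
right: once `y₀` has been inserted in slot `i`, its own inputs are the slots
`i, …, i + a₀ - 1` of the result, and the remaining elements have to be inserted to the right of
these. Only `L + j = N + ∑ aᵥ` and `D = d₀ + ∑ dᵥ` are possible arities and bidegrees. -/
def Operad.insertions (P : Operad.{u, v} R) : ∀ (j : ℕ) (a : Fin j → ℕ) (d : Fin j → Bideg)
    (N : ℕ) (d₀ : Bideg) (_k L : ℕ) (D : Bideg), L + j = N + ∑ v, a v → D = d₀ + ∑ v, d v →
    (P.obj N d₀ →ₗ[R] MultilinearMap R (fun v => P.obj (a v) (d v)) (P.obj L D))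
  | 0, _, _, N, d₀, _, L, D, hL, hD =>
    { toFun := fun x => MultilinearMap.constOfIsEmpty R _
        (cast (by rw [show N = L by simpa using hL.symm, show d₀ = D by simpa using hD.symm]) x)
      map_add' := by
        intro x y
        obtain rfl : N = L := by simpa using hL.symm
        obtain rfl : d₀ = D := by simpa using hD.symm
        ext; simp
      map_smul' := by
        intro c x
        obtain rfl : N = L := by simpa using hL.symm
        obtain rfl : d₀ = D := by simpa using hD.symm
        ext; simp }
  | j + 1, a, d, N, d₀, k, L, D, hL, hD =>
    (multilinearCurryLeftEquiv R (fun v => P.obj (a v) (d v)) (P.obj L D)).symm.toLinearMap ∘ₗ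
      ∑ i : Fin N, if k ≤ (i : ℕ) then
        LinearMap.compRight R (P.insertions j (fun v => a v.succ) (fun v => d v.succ)
            (N + a 0 - 1) (d₀ + d 0) (i + a 0) L D
            (by rw [Fin.sum_univ_succ] at hL; have := i.isLt; omega)
            (by rw [Fin.sum_univ_succ] at hD; rw [hD, add_assoc])) ∘ₗ
          P.comp (by have := i.isLt; omega) rfl i
      else 0

/-- The braces `b_j(x; y₀, …, y_{j-1})` on the bigraded module underlying `P`: the component of
arity `L` is the sum, over all arities `c₀, c₁, …, c_j` with `c₀ + c₁ + … + c_j = L + j`, of the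
order-preserving insertions of the components `yᵥ ∈ P(c_{v+1})` in the component `x ∈ P(c₀)`. -/
def Operad.brace (P : Operad.{u, v} R) (j : ℕ) (d₀ : Bideg) (d : Fin j → Bideg) (D : Bideg)
    (hD : D = d₀ + ∑ v, d v) :
    P.tot.obj d₀ →ₗ[R] MultilinearMap R (fun v => P.tot.obj (d v)) (P.tot.obj D) where
  toFun x := MultilinearMap.pi fun L =>
    ∑ c ∈ (Finset.Nat.antidiagonalTuple (j + 1) (L + j)).attach,
      (P.insertions j (fun v => c.1 v.succ) d (c.1 0) d₀ 0 L D
        (by rw [← Fin.sum_univ_succ (f := c.1), Finset.Nat.mem_antidiagonalTuple.1 c.2]) hD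
        (x (c.1 0))).compLinearMap fun v => LinearMap.proj (c.1 v.succ)
  map_add' x y := by
    refine MultilinearMap.ext fun z => funext fun L => ?_
    simp [Finset.sum_add_distrib]
  map_smul' r x := by
    refine MultilinearMap.ext fun z => funext fun L => ?_
    simp [Finset.smul_sum]

/-- `b_j(x; -)` as a multilinear map on the bigraded module underlying `P`. Its bidegree is that
of `x`. -/
def Operad.braceMap (P : Operad.{u, v} R) (j : ℕ) (d₀ : Bideg) :
    P.tot.obj d₀ →ₗ[R] (endOp P.tot).obj j d₀ where
  toFun x := ⟨MultilinearMap.fromDirectSumEquiv fun d : Fin j → Bideg =>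
      (P.tot.of (∑ v, d v + d₀)).compMultilinearMap
        (P.brace j d₀ d (∑ v, d v + d₀) (add_comm _ _) x), by
    intro d y
    rw [MultilinearMap.fromDirectSumEquiv_lof]
    exact ⟨_, rfl⟩⟩
  map_add' x y := by
    refine Subtype.ext ?_
    change MultilinearMap.fromDirectSumEquiv _ = MultilinearMap.fromDirectSumEquiv _ +
      MultilinearMap.fromDirectSumEquiv _
    rw [← map_add]
    congr 1
    funext d
    simp only [map_add, LinearMap.compMultilinearMap_add]
    rfl
  map_smul' c x := by
    refine Subtype.ext ?_
    change MultilinearMap.fromDirectSumEquiv _ = c • MultilinearMap.fromDirectSumEquiv _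
    rw [← map_smul]
    congr 1
    funext d
    simp only [map_smul, LinearMap.compMultilinearMap_smul]
    rfl

/-- The map `z ↦ (-1) ^ ⟨z, μ⟩ b₁(z; μ)`, for `μ` of bidegree `e`. -/
def Operad.rightLin (P : Operad.{u, v} R) (e : Bideg) (μ : P.tot.obj e) :
    P.tot.sum →ₗ[R] P.tot.sum :=
  DirectSum.toModule R Bideg P.tot.sum fun d =>
    { toFun := fun z => sgn R (pair d e) • P.tot.of (d + e)
        (P.brace 1 d (fun _ => e) (d + e) (by simp) z fun _ => μ)
      map_add' := by intro z z'; simp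
      map_smul' := by intro c z; simp [smul_comm c] }

lemma Operad.rightLin_of (P : Operad.{u, v} R) (e : Bideg) (μ : P.tot.obj e) (d : Bideg)
    (z : P.tot.obj d) :
    P.rightLin e μ (P.tot.of d z) = sgn R (pair d e) • P.tot.of (d + e)
      (P.brace 1 d (fun _ => e) (d + e) (by simp) z fun _ => μ) := by
  unfold rightLin
  exact DirectSum.toModule_lof R d z

/-- The same map as an element of `End_P(1)`. -/
def Operad.rightMap (P : Operad.{u, v} R) (e : Bideg) (μ : P.tot.obj e) :
    (endOp P.tot).obj 1 e :=
  ⟨MultilinearMap.ofSubsingleton R P.tot.sum P.tot.sum 0 (P.rightLin e μ), by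
    intro d x
    rw [show ∑ v, d v = d 0 by simp]
    change P.rightLin e μ (P.tot.of (d 0) (x 0)) ∈ LinearMap.range (P.tot.of (d 0 + e))
    rw [P.rightLin_of]
    exact Submodule.smul_mem _ _ ⟨_, rfl⟩⟩

/-- The maps `M'_{n+1}` induced by the braces and an element `μ` of bidegree `e`:
`M'₁(z) = b₁(μ; z) - (-1) ^ ⟨z, μ⟩ b₁(z; μ)` and `M'_j(z₁, …, z_j) = b_j(μ; z₁, …, z_j)` for
`j ≥ 2`. -/
def Operad.primedMaps (P : Operad.{u, v} R) (e : Bideg) (μ : P.tot.obj e) :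
    ∀ n : ℕ, (endOp P.tot).obj (n + 1) e
  | 0 => P.braceMap 1 e μ - P.rightMap e μ
  | n + 1 => P.braceMap (n + 2) e μ

/-- The element `∑_{j ≥ 1} f_j` of the module underlying `P`, where `f n` is `f_{n+1} ∈ P(n + 1)`. -/
def Operad.collect (P : Operad.{u, v} R) (e : Bideg) (f : ∀ n, P.obj (n + 1) e) : P.tot.obj e
  | 0 => 0
  | n + 1 => f n

/-- The bigraded module `S𝔰O`. For `O = End_X` this is the module of Hochschild cochains of `X`. -/
abbrev Operad.SS (O : Operad.{u, v} R) : BiMod.{u, v} R := (susp O).tot.shift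

/-- The maps `M_{i,n+1} = σ̄(M'_{i,n+1}) : (S𝔰O)^{⊗(n+1)} → S𝔰O` determined by elements `μ i` of
bidegree `(i, 1 - i)` of `𝔰O`, regarded as elements of `𝔰 End_{S𝔰O}`. -/
def Operad.maps (O : Operad.{u, v} R) (μ : ∀ i : ℕ, (susp O).tot.obj ((i : ℤ), 1 - (i : ℤ)))
    (i n : ℕ) : (susp (endOp O.SS)).obj (n + 1) ((i : ℤ), 1 - (i : ℤ)) :=
  sigmaBar (susp O).tot (n + 1) _ ((susp O).primedMaps _ (μ i) n)

/-- `Φ : S𝔰O → S𝔰 End_{S𝔰O}`, `Φ(Sx) = S σ̄(Φ'(x))` with `Φ'(x) = ∑_{n ≥ 0} bₙ(x; -)`. -/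
def Operad.Phi (O : Operad.{u, v} R) (d : Bideg) : O.SS.obj d →ₗ[R] (endOp O.SS).SS.obj d :=
  LinearMap.pi fun n =>
    sigmaBar (susp O).tot n (d.1, d.2 - 1) ∘ₗ (susp O).braceMap n (d.1, d.2 - 1)

/-! ### Derived `A_∞`-algebras and their morphisms -/

/-- The exponent of the sign in the derived `A_∞`-relation. -/
def relSign (r q t p j : ℕ) : ℤ := r * q + t + p * j

/-- A derived `A_∞`-algebra structure on `X`; `m i n` is the structure map `m_{i,n+1}`. The relation
indexed by `u` and `v = w + 1` is the sum over `u = i + p`, `v = j + q - 1` and `j = r + 1 + t` of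
`(-1) ^ (r q + t + p j) m_{ij}(1^{⊗r} ⊗ m_{pq} ⊗ 1^{⊗t})`; here `q = b + 1`. -/
structure IsDerivedAInfAlgebra (X : BiMod.{u, v} R) (m : ∀ _ n : ℕ, X.Multi (n + 1)) : Prop where
  bidegree : ∀ i n : ℕ, m i n ∈ X.hom (n + 1) ((i : ℤ), 2 - ((i : ℤ) + ((n : ℤ) + 1)))
  relation : ∀ u w : ℕ,
    ∑ p : Fin (u + 1), ∑ b : Fin (w + 1), ∑ r : Fin (w - b + 1),
      sgn R (relSign r (b + 1) (w - b - r) p (w - b + 1)) •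
        X.insert (k := w + 1) (by omega) ((p : ℤ), 2 - ((p : ℤ) + ((b : ℤ) + 1))) r
          (m (u - p) (w - b)) (m p b) = 0

/-- A map `f : X → Y` of bigraded modules is a morphism of derived `A_∞`-algebras if `X` and `Y` are
derived `A_∞`-algebras and `f ∘ m_{ij}^X = m_{ij}^Y ∘ f^{⊗j}` for all `i ≥ 0`, `j ≥ 1`. -/
structure IsDerivedAInfMorphism {X : BiMod.{u, v} R} {Y : BiMod.{u, w} R}
    (mX : ∀ _ n : ℕ, X.Multi (n + 1)) (mY : ∀ _ n : ℕ, Y.Multi (n + 1))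
    (f : ∀ d, X.obj d →ₗ[R] Y.obj d) : Prop where
  source : IsDerivedAInfAlgebra X mX
  target : IsDerivedAInfAlgebra Y mY
  map_apply : ∀ (i n : ℕ) (x : Fin (n + 1) → X.sum),
    DirectSum.lmap f (mX i n x) = mY i n fun v => DirectSum.lmap f (x v)

/-! ### Operads given by generators and relations -/

/-- Formal operadic expressions in the generators `G`. -/
inductive Term (R : Type u) (G : ℕ → Bideg → Type) : ℕ → Bideg → Type u
  | gen {n : ℕ} {d : Bideg} : G n d → Term R G n d
  | one {d : Bideg} : d = 0 → Term R G 1 d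
  | comp {n m k : ℕ} {p q r : Bideg} : k + 1 = n + m → r = p + q → Fin n →
      Term R G n p → Term R G m q → Term R G k r
  | zero {n : ℕ} {d : Bideg} : Term R G n d
  | add {n : ℕ} {d : Bideg} : Term R G n d → Term R G n d → Term R G n d
  | smul {n : ℕ} {d : Bideg} : R → Term R G n d → Term R G n d

/-- A formal sum of expressions. -/
def Term.sum {G : ℕ → Bideg → Type} {n : ℕ} {d : Bideg} (l : List (Term R G n d)) : Term R G n d :=
  l.foldr Term.add Term.zero

/-- The congruence generated by the axioms of a bigraded operad and by the relations `x = 0` for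
the expressions `x` in `S`. -/
inductive Term.Rel {G : ℕ → Bideg → Type} (S : ∀ (n : ℕ) (d : Bideg), Term R G n d → Prop) :
    ∀ {n : ℕ} {d : Bideg}, Term R G n d → Term R G n d → Prop
  | of {n : ℕ} {d : Bideg} {x : Term R G n d} : S n d x → Rel S x zero
  | refl {n : ℕ} {d : Bideg} (x : Term R G n d) : Rel S x x
  | symm {n : ℕ} {d : Bideg} {x y : Term R G n d} : Rel S x y → Rel S y x
  | trans {n : ℕ} {d : Bideg} {x y z : Term R G n d} : Rel S x y → Rel S y z → Rel S x z
  | add_congr {n : ℕ} {d : Bideg} {x x' y y' : Term R G n d} :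
      Rel S x x' → Rel S y y' → Rel S (add x y) (add x' y')
  | smul_congr {n : ℕ} {d : Bideg} (c : R) {x x' : Term R G n d} :
      Rel S x x' → Rel S (smul c x) (smul c x')
  | comp_congr {n m k : ℕ} {p q r : Bideg} (hk : k + 1 = n + m) (hr : r = p + q) (i : Fin n)
      {x x' : Term R G n p} {y y' : Term R G m q} :
      Rel S x x' → Rel S y y' → Rel S (comp hk hr i x y) (comp hk hr i x' y')
  | add_comm {n : ℕ} {d : Bideg} (x y : Term R G n d) : Rel S (add x y) (add y x)
  | add_assoc {n : ℕ} {d : Bideg} (x y z : Term R G n d) :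
      Rel S (add (add x y) z) (add x (add y z))
  | zero_add {n : ℕ} {d : Bideg} (x : Term R G n d) : Rel S (add zero x) x
  | neg_add {n : ℕ} {d : Bideg} (x : Term R G n d) : Rel S (add (smul (-1) x) x) zero
  | smul_add {n : ℕ} {d : Bideg} (c : R) (x y : Term R G n d) :
      Rel S (smul c (add x y)) (add (smul c x) (smul c y))
  | add_smul {n : ℕ} {d : Bideg} (c c' : R) (x : Term R G n d) :
      Rel S (smul (c + c') x) (add (smul c x) (smul c' x))
  | mul_smul {n : ℕ} {d : Bideg} (c c' : R) (x : Term R G n d) :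
      Rel S (smul (c * c') x) (smul c (smul c' x))
  | one_smul {n : ℕ} {d : Bideg} (x : Term R G n d) : Rel S (smul 1 x) x
  | comp_add_left {n m k : ℕ} {p q r : Bideg} (hk : k + 1 = n + m) (hr : r = p + q) (i : Fin n)
      (x x' : Term R G n p) (y : Term R G m q) :
      Rel S (comp hk hr i (add x x') y) (add (comp hk hr i x y) (comp hk hr i x' y))
  | comp_smul_left {n m k : ℕ} {p q r : Bideg} (hk : k + 1 = n + m) (hr : r = p + q) (i : Fin n)
      (c : R) (x : Term R G n p) (y : Term R G m q) :
      Rel S (comp hk hr i (smul c x) y) (smul c (comp hk hr i x y))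
  | comp_add_right {n m k : ℕ} {p q r : Bideg} (hk : k + 1 = n + m) (hr : r = p + q) (i : Fin n)
      (x : Term R G n p) (y y' : Term R G m q) :
      Rel S (comp hk hr i x (add y y')) (add (comp hk hr i x y) (comp hk hr i x y'))
  | comp_smul_right {n m k : ℕ} {p q r : Bideg} (hk : k + 1 = n + m) (hr : r = p + q) (i : Fin n)
      (c : R) (x : Term R G n p) (y : Term R G m q) :
      Rel S (comp hk hr i x (smul c y)) (smul c (comp hk hr i x y))
  | one_comp {m : ℕ} {d q : Bideg} (hd : d = 0) (hk : m + 1 = 1 + m) (hr : q = d + q)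
      (x : Term R G m q) : Rel S (comp hk hr 0 (one hd) x) x
  | comp_one {n : ℕ} {d p : Bideg} (hd : d = 0) (hk : n + 1 = n + 1) (hr : p = p + d) (i : Fin n)
      (x : Term R G n p) : Rel S (comp hk hr i x (one hd)) x
  | assoc {n m l k k₁ k₂ : ℕ} {p q s r r₁ r₂ : Bideg}
      (h₁ : k₁ + 1 = n + m) (g₁ : r₁ = p + q) (h : k + 1 = k₁ + l) (g : r = r₁ + s)
      (h₂ : k₂ + 1 = m + l) (g₂ : r₂ = q + s) (h' : k + 1 = n + k₂) (g' : r = p + r₂)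
      (i : Fin n) (j : Fin m) (a : Fin k₁) (_ : (a : ℕ) = i + j)
      (x : Term R G n p) (y : Term R G m q) (z : Term R G l s) :
      Rel S (comp h g a (comp h₁ g₁ i x y) z) (comp h' g' i x (comp h₂ g₂ j y z))
  | parallel {n m l k k₁ k₂ : ℕ} {p q s r r₁ r₂ : Bideg}
      (h₁ : k₁ + 1 = n + m) (g₁ : r₁ = p + q) (h : k + 1 = k₁ + l) (g : r = r₁ + s)
      (h₂ : k₂ + 1 = n + l) (g₂ : r₂ = p + s) (h' : k + 1 = k₂ + m) (g' : r = r₂ + q)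
      (i j : Fin n) (_ : i < j) (a : Fin k₁) (_ : (a : ℕ) + 1 = j + m) (b : Fin k₂)
      (_ : (b : ℕ) = i) (x : Term R G n p) (y : Term R G m q) (z : Term R G l s) :
      Rel S (comp h g a (comp h₁ g₁ i x y) z)
        (smul (sgn R (pair q s)) (comp h' g' b (comp h₂ g₂ j x z) y))

section Presented

variable {G : ℕ → Bideg → Type} (S : ∀ (n : ℕ) (d : Bideg), Term R G n d → Prop)

/-- The setoid on formal expressions defined by the relations. -/
def Term.setoid (n : ℕ) (d : Bideg) : Setoid (Term R G n d) where
  r := Term.Rel S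
  iseqv := ⟨Term.Rel.refl, Term.Rel.symm, Term.Rel.trans⟩

/-- Expressions modulo the relations. -/
def Presented (n : ℕ) (d : Bideg) : Type u := Quotient (Term.setoid S n d)

instance (n : ℕ) (d : Bideg) : Add (Presented S n d) where
  add := Quotient.map₂ Term.add fun _ _ h _ _ h' => Term.Rel.add_congr h h'

instance (n : ℕ) (d : Bideg) : Zero (Presented S n d) where
  zero := Quotient.mk _ Term.zero

instance (n : ℕ) (d : Bideg) : Neg (Presented S n d) where
  neg := Quotient.map (Term.smul (-1)) fun _ _ h => Term.Rel.smul_congr _ h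

instance (n : ℕ) (d : Bideg) : AddCommGroup (Presented S n d) where
  nsmul := nsmulRec
  zsmul := zsmulRec
  add_assoc := by
    rintro ⟨x⟩ ⟨y⟩ ⟨z⟩
    exact Quotient.sound (Term.Rel.add_assoc x y z)
  zero_add := by
    rintro ⟨x⟩
    exact Quotient.sound (Term.Rel.zero_add x)
  add_zero := by
    rintro ⟨x⟩
    exact Quotient.sound ((Term.Rel.add_comm _ _).trans (Term.Rel.zero_add x))
  neg_add_cancel := by
    rintro ⟨x⟩
    exact Quotient.sound (Term.Rel.neg_add x)
  add_comm := by
    rintro ⟨x⟩ ⟨y⟩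
    exact Quotient.sound (Term.Rel.add_comm x y)

instance (n : ℕ) (d : Bideg) : Module R (Presented S n d) :=
  letI : SMul R (Presented S n d) :=
    ⟨fun c => Quotient.map (Term.smul c) fun _ _ h => Term.Rel.smul_congr _ h⟩
  Module.ofMinimalAxioms
    (by
      rintro c ⟨x⟩ ⟨y⟩
      exact Quotient.sound (Term.Rel.smul_add c x y))
    (by
      rintro c c' ⟨x⟩
      exact Quotient.sound (Term.Rel.add_smul c c' x))
    (by
      rintro c c' ⟨x⟩
      exact Quotient.sound (Term.Rel.mul_smul c c' x))
    (by
      rintro ⟨x⟩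
      exact Quotient.sound (Term.Rel.one_smul x))

/-- The operad generated by `G` subject to the relations `x = 0` for `x` in `S`. -/
def presentedOperad : Operad.{u, u} R where
  obj := Presented S
  one hd := Quotient.mk _ (Term.one hd)
  comp hk hr i := LinearMap.mk₂ R
    (Quotient.map₂ (Term.comp hk hr i) fun _ _ h _ _ h' => Term.Rel.comp_congr hk hr i h h')
    (by
      rintro ⟨x⟩ ⟨x'⟩ ⟨y⟩
      exact Quotient.sound (Term.Rel.comp_add_left hk hr i x x' y))
    (by
      rintro c ⟨x⟩ ⟨y⟩
      exact Quotient.sound (Term.Rel.comp_smul_left hk hr i c x y))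
    (by
      rintro ⟨x⟩ ⟨y⟩ ⟨y'⟩
      exact Quotient.sound (Term.Rel.comp_add_right hk hr i x y y'))
    (by
      rintro c ⟨x⟩ ⟨y⟩
      exact Quotient.sound (Term.Rel.comp_smul_right hk hr i c x y))
  one_comp := by
    rintro m d q hd hk hr ⟨x⟩
    exact Quotient.sound (Term.Rel.one_comp hd hk hr x)
  comp_one := by
    rintro n d p hd hk hr i ⟨x⟩
    exact Quotient.sound (Term.Rel.comp_one hd hk hr i x)
  assoc := by
    rintro n m l k k₁ k₂ p q s r r₁ r₂ h₁ g₁ h g h₂ g₂ h' g' i j a ha ⟨x⟩ ⟨y⟩ ⟨z⟩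
    exact Quotient.sound (Term.Rel.assoc h₁ g₁ h g h₂ g₂ h' g' i j a ha x y z)
  parallel := by
    rintro n m l k k₁ k₂ p q s r r₁ r₂ h₁ g₁ h g h₂ g₂ h' g' i j hij a ha b hb ⟨x⟩ ⟨y⟩ ⟨z⟩
    exact Quotient.sound (Term.Rel.parallel h₁ g₁ h g h₂ g₂ h' g' i j hij a ha b hb x y z)

end Presented

/-! ### The operad of derived `A_∞`-algebras and derived `A_∞`-multiplications -/

/-- The generators: `DAGen.m i n` is `m_{i,n+1}`, of arity `n + 1` and bidegree
`(i, 2 - (i + (n + 1)))`. -/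
inductive DAGen : ℕ → Bideg → Type
  | m (i n : ℕ) {d : Bideg} (hd : d = ((i : ℤ), 2 - ((i : ℤ) + ((n : ℤ) + 1)))) : DAGen (n + 1) d

/-- The left hand side of the derived `A_∞`-relation indexed by `u` and `v = w + 1`, that is, the sum
over `u = i + p`, `v = j + q - 1` and `j = r + 1 + t` of
`(-1) ^ (r q + t + p j) m_{ij} ∘_{r+1} m_{pq}`; here `q = b + 1`. -/
def dAInfRelator (R : Type u) [CommRing R] (u w : ℕ) :
    Term R DAGen (w + 1) ((u : ℤ), 3 - ((u : ℤ) + ((w : ℤ) + 1))) :=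
  Term.sum <|
    (List.finRange (u + 1)).flatMap fun p : Fin (u + 1) =>
    (List.finRange (w + 1)).flatMap fun b : Fin (w + 1) =>
    (List.finRange (w - b + 1)).map fun r : Fin (w - b + 1) =>
      Term.smul (sgn R (relSign r (b + 1) (w - b - r) p (w - b + 1)))
        (Term.comp (by have := b.isLt; omega)
          (p := (((u - p : ℕ) : ℤ), 2 - (((u - p : ℕ) : ℤ) + (((w - b : ℕ) : ℤ) + 1))))
          (q := ((p : ℤ), 2 - ((p : ℤ) + ((b : ℤ) + 1))))
          (by have := p.isLt; have := b.isLt; ext <;> simp <;> omega)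
          r (Term.gen (DAGen.m (u - p) (w - b) rfl)) (Term.gen (DAGen.m p b rfl)))

/-- The set of relators of `dA_∞`. -/
inductive IsDAInfRelator (R : Type u) [CommRing R] :
    ∀ (n : ℕ) (d : Bideg), Term R DAGen n d → Prop
  | mk (u w : ℕ) : IsDAInfRelator R _ _ (dAInfRelator R u w)

/-- The operad `dA_∞` of derived `A_∞`-algebras, in bigraded `R`-modules. -/
def dAInf (R : Type u) [CommRing R] : Operad.{u, u} R := presentedOperad (IsDAInfRelator R)

/-- The generator `m_{i,n+1}` of `dA_∞`. -/
def dAInf.gen (R : Type u) [CommRing R] (i n : ℕ) {d : Bideg}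
    (hd : d = ((i : ℤ), 2 - ((i : ℤ) + ((n : ℤ) + 1)))) : (dAInf R).obj (n + 1) d :=
  Quotient.mk (Term.setoid (IsDAInfRelator R) (n + 1) d) (Term.gen (DAGen.m i n hd))

/-- Morphisms of bigraded operads. -/
structure OperadHom (P : Operad.{u, v} R) (Q : Operad.{u, w} R) where
  map : ∀ {n : ℕ} {d : Bideg}, P.obj n d →ₗ[R] Q.obj n d
  map_one : ∀ {d : Bideg} (hd : d = 0), map (P.one hd) = Q.one hd
  map_comp : ∀ {n m k : ℕ} {p q r : Bideg} (hk : k + 1 = n + m) (hr : r = p + q) (i : Fin n)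
    (x : P.obj n p) (y : P.obj m q), map (P.comp hk hr i x y) = Q.comp hk hr i (map x) (map y)

/-- A derived `A_∞`-multiplication on `O`. -/
abbrev DerivedAInfMultiplication (O : Operad.{u, v} R) := OperadHom (dAInf R) O

namespace DerivedAInfMultiplication

variable {O : Operad.{u, v} R} (m : DerivedAInfMultiplication O)

/-- `m_{i•} = ∑_j m_{ij}` as an element of `𝔰O`, of (natural) bidegree `(i, 1 - i)`. -/
def elem (i : ℕ) : (susp O).tot.obj ((i : ℤ), 1 - (i : ℤ)) :=
  (susp O).collect _ fun n => m.map (dAInf.gen R i n (by ext <;> simp; ring))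

/-- The maps `M_{i,n+1}` on `S𝔰O`. -/
def M (i n : ℕ) : O.SS.Multi (n + 1) := (O.maps m.elem i n).1

/-- `M_{i•} = ∑_j M_{ij}` as an element of `𝔰 End_{S𝔰O}`. -/
def totalM (i : ℕ) : (susp (endOp O.SS)).tot.obj ((i : ℤ), 1 - (i : ℤ)) :=
  (susp (endOp O.SS)).collect _ fun n => O.maps m.elem i n

/-- The maps `M̄_{i,n+1}` on `S𝔰 End_{S𝔰O}`. -/
def Mbar (i n : ℕ) : (endOp O.SS).SS.Multi (n + 1) := ((endOp O.SS).maps m.totalM i n).1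

end DerivedAInfMultiplication

end DerivedAInf

end

open DerivedAInf

/-!
Write `A` for the bigraded module underlying an operad `P`; here `P` is `𝔰O`, and later
`𝔰 End_{S𝔰O}`. All claims follow from one identity, the brace relation: inserting elements `zs` in
the result of inserting `ys` in `x` amounts to inserting in `x` some of the `zs` together with the
`ys`, in which the other `zs` have been inserted (`insList_insList`, `braceList_brace`). The sum
on the right is called `weave`. Braces in `End_A`, evaluated on arguments, are given by the same
sum (`brace_endOp`). Hence `β(x) = ∑ₙ bₙ(x; -)`, called `braces`, is compatible with the braces of
`P` and of `End_A` (`braces_brace`).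

*The algebra structures.* In `𝔰P`, the derived `A_∞`-relations for elements `m_{ij}` are the
equation `∑_{i + p = u} (-1) ^ p b₁(μ_i; μ_p) = 0`, called `IsMC`, for `μ_i = ∑_j m_{ij}`
(`isMC_susp_collect_iff`). So it suffices that this equation is inherited by the elements
`∑_j M'_{ij}` of `End_A`, and then by their images under `σ̄`, which is compatible with insertions
(`sigmaBar_commutesWithComp`). Now `∑_j M'_{ij} = β(μ_i) - ρ(μ_i)`, where `ρ(μ)`, called `right`,
consists of the constant `μ` and of the map `z ↦ (-1) ^ ⟨z, μ⟩ b₁(z; μ)`. The elements `β(μ_i)`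
satisfy the equation because `β` is compatible with braces, the elements `ρ(μ_i)` satisfy it by
the brace relation (`sum_preLie_right`), and the mixed terms cancel because `b₁(ρ(μ); β(y))` and
`b₁(β(y); ρ(μ))` agree up to the Koszul sign (`preLie_right_braces`). This is `IsMC.primedMaps`.
The target is the same construction applied to `End_{S𝔰O}` and to the elements `M_{i•}`.

*The morphism.* Up to `σ̄` and the shift, `Φ` is `β`. For `j ≥ 2` the brace `b_j(ρ(μ); -)`
vanishes, as `ρ(μ)` lives in arities `0` and `1`, so that
`β(b_j(μ; z₁, …, z_j)) = b_j(β(μ) - ρ(μ); β(z₁), …, β(z_j))`. For `j = 1` the contributions of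
`ρ(μ)` to the two terms of the graded commutator cancel by `preLie_right_braces`. This is
`lmap_bracesMap_primedMaps`.

Elements of `A` are products over all arities. The brace relation is proved for elements of finite
support, where the direct sum of all components of the operad can be used, and extended to `A` by
truncating at large arities (`weave_limit`).
-/

noncomputable section

namespace DerivedAInf

variable {R : Type u} [CommRing R]

/-! ### Inserting operations between arguments -/

section Weave

variable {X X' Y Y' : Type*} [AddCommMonoid Y] [AddCommMonoid Y']

/-- The sum of `φ l r` over all decompositions `l ++ r` of a list. -/
def splitSum (φ : List X → List X → Y) : List X → Y
  | [] => φ [] []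
  | z :: zs => φ [] (z :: zs) + splitSum (fun l r => φ (z :: l) r) zs

lemma splitSum_add (φ ψ : List X → List X → Y) (zs : List X) :
    splitSum (fun l r => φ l r + ψ l r) zs = splitSum φ zs + splitSum ψ zs := by
  induction zs generalizing φ ψ with
  | nil => rfl
  | cons z zs ih => simp only [splitSum, ih]; abel

lemma splitSum_zero (zs : List X) : splitSum (fun _ _ => (0 : Y)) zs = 0 := by
  induction zs with
  | nil => rfl
  | cons z zs ih => simp only [splitSum, ih, add_zero]

lemma splitSum_smul {S : Type*} [DistribSMul S Y] (c : S) (φ : List X → List X → Y)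
    (zs : List X) : splitSum (fun l r => c • φ l r) zs = c • splitSum φ zs := by
  induction zs generalizing φ with
  | nil => rfl
  | cons z zs ih => simp only [splitSum, ih, smul_add]

/-- Parametricity of `splitSum`. -/
lemma splitSum_rel {A : X → X' → Prop} {B : Y → Y' → Prop}
    (hadd : ∀ {y₁ y₂ y₁' y₂'}, B y₁ y₁' → B y₂ y₂' → B (y₁ + y₂) (y₁' + y₂'))
    {φ : List X → List X → Y} {φ' : List X' → List X' → Y'}
    (h : ∀ l l' r r', List.Forall₂ A l l' → List.Forall₂ A r r' → B (φ l r) (φ' l' r'))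
    {zs : List X} {zs' : List X'} (hz : List.Forall₂ A zs zs') :
    B (splitSum φ zs) (splitSum φ' zs') := by
  induction hz generalizing φ φ' with
  | nil => exact h _ _ _ _ .nil .nil
  | cons ha hz ih =>
    exact hadd (h _ _ _ _ .nil (.cons ha hz))
      (ih fun l l' r r' hl hr => h _ _ _ _ (.cons ha hl) hr)

/-- A sum over decompositions in which the left part must have length `a`. -/
lemma splitSum_eq_of_length {φ : List X → List X → Y} {a : ℕ}
    (hφ : ∀ l r, l.length ≠ a → φ l r = 0) (zs : List X) :
    splitSum φ zs = if a ≤ zs.length then φ (zs.take a) (zs.drop a) else 0 := by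
  induction zs generalizing φ a with
  | nil =>
    cases a with
    | zero => simp [splitSum]
    | succ a => simpa [splitSum] using hφ [] [] (by simp)
  | cons z zs ih =>
    rw [splitSum]
    cases a with
    | zero =>
      rw [show splitSum (fun l r => φ (z :: l) r) zs = 0 from ?_]
      · simp
      · rw [← splitSum_zero zs]
        congr 1; funext l r
        exact hφ _ _ (by simp)
    | succ a =>
      rw [hφ [] _ (by simp), zero_add, ih (a := a) fun l r hl => hφ _ _ (by simpa using hl)]
      simp

/-- The recursion step of `weave`: `g` consumes a block of consecutive arguments, everything to the
right of this block being treated by `W`. -/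
def weaveCons (g : List X → X) (κ₁ κ₂ : X → X) (W : (List X → Y) → List X → Y) :
    List X → (List X → Y) → Y
  | [], h => W (fun l => h (g [] :: l)) []
  | z :: zs, h => splitSum (fun l r => W (fun l' => h (g (l.map κ₁) :: l')) r) (z :: zs) +
      weaveCons g κ₁ κ₂ W zs fun l => h (κ₂ z :: l)

/-- The total degree of a list of operations with prescribed bidegrees. -/
def totalDeg {Z : Type*} (gs : List (Bideg × Z)) : Bideg := (gs.map Prod.fst).sum

/-- `weave κ [g₁, …, g_j] h [z₁, …, z_n]` is the sum of all `h(z₁, …, g₁(z, …), …, z, …, g_j(z,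
…), …, z_n)` in which the operations `g₁, …, g_j` are applied, in this order, to disjoint blocks
of consecutive arguments. The operation `κ q` is the Koszul sign of something of bidegree `q`
moving past an argument: an argument `z` meets the operations `g` standing to its right. The
operations accept lists of all lengths, so that all arities are summed over. -/
def weave (κ : Bideg → X → X) :
    List (Bideg × (List X → X)) → (List X → Y) → List X → Y
  | [], h, zs => h zs
  | g :: gs, h, zs => weaveCons g.2 (κ (totalDeg gs)) (κ (g.1 + totalDeg gs)) (weave κ gs) zs h

@[simp] lemma totalDeg_nil {Z : Type*} : totalDeg ([] : List (Bideg × Z)) = 0 := rfl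

@[simp] lemma totalDeg_cons {Z : Type*} (g : Bideg × Z) (gs : List (Bideg × Z)) :
    totalDeg (g :: gs) = g.1 + totalDeg gs := by simp [totalDeg]

lemma weave_nil (κ : Bideg → X → X) (h : List X → Y) (zs : List X) : weave κ [] h zs = h zs := rfl

lemma weave_cons_nil (κ : Bideg → X → X) (g : Bideg × (List X → X)) (gs) (h : List X → Y) :
    weave κ (g :: gs) h [] = weave κ gs (fun l => h (g.2 [] :: l)) [] := rfl

lemma weave_cons_cons (κ : Bideg → X → X) (g : Bideg × (List X → X)) (gs) (h : List X → Y)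
    (z : X) (zs : List X) :
    weave κ (g :: gs) h (z :: zs) =
      splitSum (fun l r => weave κ gs (fun l' => h (g.2 (l.map (κ (totalDeg gs))) :: l')) r)
        (z :: zs) + weave κ (g :: gs) (fun l => h (κ (g.1 + totalDeg gs) z :: l)) zs := rfl

lemma weave_add (κ : Bideg → X → X) (gs) (h h' : List X → Y) (zs : List X) :
    weave κ gs (fun l => h l + h' l) zs = weave κ gs h zs + weave κ gs h' zs := by
  induction gs generalizing h h' zs with
  | nil => rfl
  | cons g gs ih =>
    induction zs generalizing h h' with
    | nil => simp only [weave_cons_nil, ih]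
    | cons z zs ihz => simp only [weave_cons_cons, ih, ihz, splitSum_add]; abel

lemma weave_smul {S : Type*} [DistribSMul S Y] (c : S) (κ : Bideg → X → X) (gs)
    (h : List X → Y) (zs : List X) :
    weave κ gs (fun l => c • h l) zs = c • weave κ gs h zs := by
  induction gs generalizing h zs with
  | nil => rfl
  | cons g gs ih =>
    induction zs generalizing h with
    | nil => simp only [weave_cons_nil, ih]
    | cons z zs ihz => simp only [weave_cons_cons, ih, ihz, splitSum_smul, smul_add]

lemma weave_zero (κ : Bideg → X → X) (gs) (zs : List X) :
    weave κ gs (fun _ => (0 : Y)) zs = 0 := by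
  simpa using weave_smul (0 : ℕ) κ gs (fun _ => (0 : Y)) zs

/-- Without arguments left, every operation is evaluated on the empty block. -/
lemma weave_args_nil (κ : Bideg → X → X) (gs) (h : List X → Y) :
    weave κ gs h [] = h (gs.map fun g => g.2 []) := by
  induction gs generalizing h with
  | nil => rfl
  | cons g gs ih => rw [weave_cons_nil, ih]; rfl

/-- Parametricity of `weave`: if the operations and the signs respect a relation `A` between
arguments, and `h`, `h'` turn it into an additive relation `B`, then the two sums are related by
`B`. -/
theorem weave_rel {κ : Bideg → X → X} {κ' : Bideg → X' → X'} {A : X → X' → Prop}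
    {B : Y → Y' → Prop}
    (hadd : ∀ {y₁ y₂ y₁' y₂'}, B y₁ y₁' → B y₂ y₂' → B (y₁ + y₂) (y₁' + y₂'))
    (hκ : ∀ q {x x'}, A x x' → A (κ q x) (κ' q x'))
    {gs : List (Bideg × (List X → X))} {gs' : List (Bideg × (List X' → X'))}
    (hg : List.Forall₂ (fun g g' => g.1 = g'.1 ∧
      ∀ l l', List.Forall₂ A l l' → A (g.2 l) (g'.2 l')) gs gs')
    {h : List X → Y} {h' : List X' → Y'}
    (hh : ∀ l l', List.Forall₂ A l l' → B (h l) (h' l'))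
    {zs : List X} {zs' : List X'} (hz : List.Forall₂ A zs zs') :
    B (weave κ gs h zs) (weave κ' gs' h' zs') := by
  have hmap : ∀ q {l : List X} {l' : List X'}, List.Forall₂ A l l' →
      List.Forall₂ A (l.map (κ q)) (l'.map (κ' q)) := fun q l l' hl => by
    rw [List.forall₂_map_left_iff, List.forall₂_map_right_iff]
    exact hl.imp fun _ _ => hκ q
  induction hg generalizing h h' zs zs' with
  | nil => exact hh _ _ hz
  | @cons g g' gs gs' hgg hgs ih =>
    have hdeg : totalDeg gs = totalDeg gs' := by
      clear ih
      induction hgs with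
      | nil => rfl
      | cons hab _ ih => simp [hab.1, ih]
    induction hz generalizing h h' with
    | nil => exact ih (fun l l' hl => hh _ _ (.cons (hgg.2 _ _ .nil) hl)) .nil
    | cons ha hz ihz =>
      rw [weave_cons_cons, weave_cons_cons, ← hdeg, ← hgg.1]
      exact hadd (splitSum_rel (fun h₁ h₂ => hadd h₁ h₂) (fun l l' r r' hl hr =>
          ih (fun m m' hm => hh _ _ (.cons (hgg.2 _ _ (hmap _ hl)) hm)) hr) (.cons ha hz))
        (ihz fun m m' hm => hh _ _ (.cons (hκ _ ha) hm))

end Weave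

/-! ### Order-preserving insertions in an operad -/

namespace Operad

variable (P : Operad.{u, v} R)

/-- The direct sum of all components of an operad. Working in it, instead of in the components,
avoids all equations between arities and between bidegrees. -/
abbrev All : Type v := ⨁ a : ℕ × Bideg, P.obj a.1 a.2

/-- The inclusion of a component. -/
def incl (n : ℕ) (d : Bideg) : P.obj n d →ₗ[R] P.All :=
  DirectSum.lof R (ℕ × Bideg) (fun a => P.obj a.1 a.2) (n, d)

/-- The linear map out of `P.All` with prescribed restrictions to the components. -/
def lift {M : Type*} [AddCommGroup M] [Module R M] (φ : ∀ n d, P.obj n d →ₗ[R] M) : P.All →ₗ[R] M :=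
  DirectSum.toModule R _ _ fun a => φ a.1 a.2

@[simp] lemma lift_incl {M : Type*} [AddCommGroup M] [Module R M]
    (φ : ∀ n d, P.obj n d →ₗ[R] M) (n : ℕ) (d : Bideg) (x : P.obj n d) :
    P.lift φ (P.incl n d x) = φ n d x :=
  DirectSum.toModule_lof R (φ := fun a : ℕ × Bideg => φ a.1 a.2) (n, d) x

variable {P} in
lemma all_induction {p : P.All → Prop} (x : P.All) (zero : p 0)
    (incl : ∀ n d x, p (P.incl n d x)) (add : ∀ x y, p x → p y → p (x + y)) : p x :=
  DirectSum.induction_on x zero (fun a x => incl a.1 a.2 x) add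

variable {P} in
lemma all_hom_ext {M : Type*} [AddCommGroup M] [Module R M] {f g : P.All →ₗ[R] M}
    (h : ∀ n d x, f (P.incl n d x) = g (P.incl n d x)) : f = g :=
  DirectSum.linearMap_ext R fun a => LinearMap.ext fun x => h a.1 a.2 x

/-- Insertion in slot `i`, extended by zero to the components that do not have this slot. -/
def ins (i : ℕ) : P.All →ₗ[R] P.All →ₗ[R] P.All :=
  P.lift fun n p => LinearMap.flip <| P.lift fun m q => LinearMap.flip <|
    if h : i < n then
      (P.comp (k := n + m - 1) (by omega) rfl ⟨i, h⟩).compr₂ (P.incl (n + m - 1) (p + q))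
    else 0

lemma ins_incl {n m k : ℕ} {p q r : Bideg} (hk : k + 1 = n + m) (hr : r = p + q) (i : Fin n)
    (x : P.obj n p) (y : P.obj m q) :
    P.ins i (P.incl n p x) (P.incl m q y) = P.incl k r (P.comp hk hr i x y) := by
  subst hr
  obtain rfl : k = n + m - 1 := by omega
  simp [ins]

lemma ins_incl_of_le {n : ℕ} {p : Bideg} {i : ℕ} (hi : n ≤ i) (x : P.obj n p) (y : P.All) :
    P.ins i (P.incl n p x) y = 0 := by
  induction y using all_induction with
  | zero => simp
  | incl m q y => simp [ins, hi.not_gt]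
  | add y z hy hz => rw [map_add, hy, hz, add_zero]

/-- An insertion in an element of arity `n` is the inclusion of an element of a known component. -/
lemma exists_ins_incl {n m k : ℕ} {p q : Bideg} (hk : k + 1 = n + m) (i : ℕ)
    (x : P.obj n p) (y : P.obj m q) :
    ∃ z, P.ins i (P.incl n p x) (P.incl m q y) = P.incl k (p + q) z := by
  by_cases hi : i < n
  · exact ⟨_, P.ins_incl hk rfl ⟨i, hi⟩ x y⟩
  · exact ⟨0, by rw [P.ins_incl_of_le (not_lt.1 hi), map_zero]⟩

/-- The Koszul sign of something of bidegree `q` moving past an element. -/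
def kos (q : Bideg) : P.All →ₗ[R] P.All :=
  P.lift fun n d => sgn R (pair q d) • P.incl n d

@[simp] lemma kos_incl (q : Bideg) (n : ℕ) (d : Bideg) (x : P.obj n d) :
    P.kos q (P.incl n d x) = sgn R (pair q d) • P.incl n d x := by simp [kos]

lemma kos_add (q s : Bideg) (x : P.All) : P.kos (q + s) x = P.kos q (P.kos s x) := by
  induction x using all_induction with
  | zero => simp
  | incl n d x =>
    simp only [kos_incl, map_smul, smul_smul, ← sgn_add]
    congr 2
    simp [pair]; ring
  | add x y hx hy => simp only [map_add, hx, hy]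

lemma kos_zero (x : P.All) : P.kos 0 x = x := by
  induction x using all_induction with
  | zero => simp
  | incl n d x => simp [pair, sgn_zero]
  | add x y hx hy => simp only [map_add, hx, hy]

/-- The elements of bidegree `d`, of arbitrary arity. -/
def homog (d : Bideg) : Submodule R P.All := ⨆ n, LinearMap.range (P.incl n d)

lemma incl_mem_homog (n : ℕ) (d : Bideg) (x : P.obj n d) : P.incl n d x ∈ P.homog d :=
  Submodule.mem_iSup_of_mem n ⟨x, rfl⟩

variable {P} in
lemma homog_induction {d : Bideg} {p : ∀ x, x ∈ P.homog d → Prop} (zero : p 0 (zero_mem _))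
    (incl : ∀ n x, p (P.incl n d x) (P.incl_mem_homog n d x))
    (add : ∀ x y hx hy, p x hx → p y hy → p (x + y) (add_mem hx hy)) {x : P.All}
    (hx : x ∈ P.homog d) : p x hx :=
  Submodule.iSup_induction' _ (fun n _ h => by obtain ⟨y, rfl⟩ := h; exact incl n y) zero
    (fun x y hx hy => add x y hx hy) hx

lemma ins_assoc {m : ℕ} {q : Bideg} (i j : ℕ) (hj : j < m) (x : P.All) (y : P.obj m q)
    (z : P.All) :
    P.ins (i + j) (P.ins i x (P.incl m q y)) z = P.ins i x (P.ins j (P.incl m q y) z) := by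
  induction x using all_induction with
  | zero => simp
  | add x x' hx hx' => simp only [map_add, LinearMap.add_apply, hx, hx']
  | incl n p x =>
  induction z using all_induction with
  | zero => simp
  | add z z' hz hz' => simp only [map_add, hz, hz']
  | incl l s z =>
  by_cases hi : i < n
  · rw [P.ins_incl (k := n + m - 1) (by omega) rfl ⟨i, hi⟩,
      P.ins_incl (k := m + l - 1) (by omega) rfl ⟨j, hj⟩,
      P.ins_incl (k := n + (m + l - 1) - 1) (by omega) rfl ⟨i, hi⟩,
      P.ins_incl (k := n + (m + l - 1) - 1) (by omega) (add_assoc _ _ _).symm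
        ⟨i + j, by omega⟩,
      P.assoc _ _ _ _ _ _ _ _ ⟨i, hi⟩ ⟨j, hj⟩ _ rfl]
  · rw [P.ins_incl_of_le (not_lt.1 hi), P.ins_incl_of_le (not_lt.1 hi), map_zero,
      LinearMap.zero_apply]

/-- Insertions in different slots commute up to the Koszul sign; stated with the later slot written
as `i`, and with the element inserted in the earlier slot `c` moving to the left. -/
lemma ins_parallel {q : Bideg} {b : ℕ} {s : Bideg} (c i : ℕ) (hc : c < i) (x : P.All)
    {y : P.All} (hy : y ∈ P.homog q) (z : P.obj b s) :
    P.ins c (P.ins i x y) (P.incl b s z) =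
      P.ins (i + b - 1) (P.ins c x (P.kos q (P.incl b s z))) y := by
  induction hy using homog_induction with
  | zero => simp
  | add y y' _ _ hy hy' => simp only [map_add, LinearMap.add_apply, hy, hy']
  | incl m y =>
  induction x using all_induction with
  | zero => simp
  | add x x' hx hx' => simp only [map_add, LinearMap.add_apply, hx, hx']
  | incl n p x =>
  by_cases hi : i < n
  · rw [kos_incl, map_smul, map_smul, LinearMap.smul_apply,
      P.ins_incl (k := n + m - 1) (by omega) rfl ⟨i, hi⟩,
      P.ins_incl (k := n + m + b - 2) (by omega) rfl ⟨c, by omega⟩,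
      P.ins_incl (k := n + b - 1) (by omega) rfl ⟨c, by omega⟩,
      P.ins_incl (k := n + m + b - 2) (by omega) (add_right_comm _ _ _) ⟨i + b - 1, by omega⟩,
      P.parallel (k₂ := n + m - 1) _ _ _ _ (by omega) rfl (by omega) rfl
        ⟨c, by omega⟩ ⟨i, hi⟩ hc ⟨i + b - 1, by omega⟩ (by simp; omega) ⟨c, by omega⟩ rfl x z y,
      map_smul, smul_smul, ← sgn_add, sgn_even, one_smul]
    exact ⟨pair q s, by simp only [pair]; ring⟩
  · rw [P.ins_incl_of_le (not_lt.1 hi), map_zero, LinearMap.zero_apply]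
    by_cases hcn : c < n
    · rw [kos_incl, map_smul, P.ins_incl (k := n + b - 1) (by omega) rfl ⟨c, hcn⟩, map_smul,
        LinearMap.smul_apply, P.ins_incl_of_le (by omega), smul_zero]
    · rw [P.ins_incl_of_le (not_lt.1 hcn), map_zero, LinearMap.zero_apply]

/-- `step F i y x` inserts `y` in slot `i` of `x` and applies `F s` to the result, `s` being the
first slot to the right of the inputs of `y`. -/
def step (F : ℕ → P.All →ₗ[R] P.All) (i : ℕ) : P.All →ₗ[R] P.All →ₗ[R] P.All :=
  P.lift fun a e => ((P.ins i).compr₂ (F (i + a))).flip ∘ₗ P.incl a e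

@[simp] lemma step_incl (F : ℕ → P.All →ₗ[R] P.All) (i : ℕ) (a : ℕ) (e : Bideg) (y : P.obj a e)
    (x : P.All) : P.step F i (P.incl a e y) x = F (i + a) (P.ins i x (P.incl a e y)) := by
  simp [step]

/-- `insList ys k x` is the sum of all order-preserving insertions of the list `ys` in slots `≥ k`
of `x`. It is linear in `x` and in each entry of `ys`. -/
def insList : List P.All → ℕ → P.All →ₗ[R] P.All
  | [], _ => LinearMap.id
  | y :: ys, k => P.lift fun n d =>
      (∑ i ∈ Finset.Ico k n, P.step (insList ys) i y) ∘ₗ P.incl n d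

@[simp] lemma insList_nil (k : ℕ) (x : P.All) : P.insList [] k x = x := rfl

lemma insList_cons_incl (y : P.All) (ys : List P.All) (k n : ℕ) (d : Bideg) (x : P.obj n d) :
    P.insList (y :: ys) k (P.incl n d x) =
      ∑ i ∈ Finset.Ico k n, P.step (P.insList ys) i y (P.incl n d x) := by
  simp [insList]

lemma insList_cons_of_le (y : P.All) (ys : List P.All) {k n : ℕ} (h : n ≤ k) (d : Bideg)
    (x : P.obj n d) : P.insList (y :: ys) k (P.incl n d x) = 0 := by
  rw [insList_cons_incl, Finset.Ico_eq_empty (by omega), Finset.sum_empty]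

/-- The elements of arity at least `k`. -/
def arityGE (k : ℕ) : Submodule R P.All :=
  Submodule.span R {z | ∃ n d, ∃ x : P.obj n d, k ≤ n ∧ z = P.incl n d x}

lemma incl_mem_arityGE {k n : ℕ} (h : k ≤ n) (d : Bideg) (x : P.obj n d) :
    P.incl n d x ∈ P.arityGE k := Submodule.subset_span ⟨n, d, x, h, rfl⟩

variable {P} in
lemma arityGE_induction {k : ℕ} {p : ∀ x, x ∈ P.arityGE k → Prop} (zero : p 0 (zero_mem _))
    (incl : ∀ n d x (h : k ≤ n), p (P.incl n d x) (P.incl_mem_arityGE h d x))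
    (add : ∀ x y hx hy, p x hx → p y hy → p (x + y) (add_mem hx hy)) {x : P.All}
    (hx : x ∈ P.arityGE k) : p x hx := by
  induction hx using Submodule.closure_induction with
  | zero => exact zero
  | add x y _ _ hx hy => exact add _ _ _ _ hx hy
  | smul_mem c x hx =>
    obtain ⟨n, d, x, h, rfl⟩ := hx
    simp only [← map_smul]
    exact incl _ _ _ h

lemma arityGE_anti {k l : ℕ} (h : k ≤ l) : P.arityGE l ≤ P.arityGE k :=
  Submodule.span_mono fun _ ⟨n, d, x, hl, e⟩ => ⟨n, d, x, h.trans hl, e⟩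

lemma insList_mem_arityGE (ys : List P.All) {k : ℕ} {x : P.All} (hx : x ∈ P.arityGE k) :
    P.insList ys k x ∈ P.arityGE k := by
  induction ys generalizing k x with
  | nil => exact hx
  | cons y ys ih =>
    induction hx using arityGE_induction with
    | zero => simp
    | add x x' _ _ hx hx' => rw [map_add]; exact add_mem hx hx'
    | incl n d x hn =>
      rw [insList_cons_incl]
      refine Submodule.sum_mem _ fun i hi => ?_
      rw [Finset.mem_Ico] at hi
      induction y using all_induction with
      | zero => simp
      | add y y' hy hy' => rw [map_add, LinearMap.add_apply]; exact add_mem hy hy'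
      | incl a e y =>
        rw [step_incl, P.ins_incl (k := n + a - 1) (by omega) rfl ⟨i, hi.2⟩]
        exact P.arityGE_anti (by omega) (ih (P.incl_mem_arityGE (by omega) _ _))

/-- The first element of the list is inserted either to the right of slot `k` or in slot `k`. -/
lemma insList_cons_succ (y : P.All) (ys : List P.All) {k : ℕ} {x : P.All}
    (hx : x ∈ P.arityGE (k + 1)) :
    P.insList (y :: ys) k x = P.insList (y :: ys) (k + 1) x + P.step (P.insList ys) k y x := by
  induction hx using arityGE_induction with
  | zero => simp
  | add x x' _ _ hx hx' => simp only [map_add, hx, hx']; abel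
  | incl n d x hn =>
    rw [insList_cons_incl, insList_cons_incl, Finset.sum_eq_sum_Ico_succ_bot (by omega), add_comm]

/-- A list of homogeneous elements, recorded with their bidegrees. -/
def HomogList (ys : List (Bideg × P.All)) : Prop := ∀ y ∈ ys, y.2 ∈ P.homog y.1

/-- An element `z` inserted in a slot to the left of the list `ys` can be inserted first. -/
lemma ins_insList {ys : List (Bideg × P.All)} (hys : P.HomogList ys) {b : ℕ} {s : Bideg} (c k : ℕ)
    (hc : c < k) (x : P.All) (z : P.obj b s) :
    P.ins c (P.insList (ys.map Prod.snd) k x) (P.incl b s z) =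
      P.insList (ys.map Prod.snd) (k + b - 1)
        (P.ins c x (P.kos (totalDeg ys) (P.incl b s z))) := by
  induction ys generalizing k x b s z with
  | nil => simp only [List.map_nil, insList_nil, totalDeg_nil, kos_zero]
  | cons y ys ih =>
    obtain ⟨q, y⟩ := y
    have hy : y ∈ P.homog q := hys (q, y) (by simp)
    have hys' : P.HomogList ys := fun w hw => hys w (by simp [hw])
    simp only [List.map_cons, totalDeg_cons]
    induction x using all_induction with
    | zero => simp
    | add x x' hx hx' => simp only [map_add, LinearMap.add_apply, hx, hx']
    | incl n p x =>
    have key : ∀ i, c < i → P.ins c (P.step (P.insList (ys.map Prod.snd)) i y (P.incl n p x))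
        (P.incl b s z) = P.step (P.insList (ys.map Prod.snd)) (i + b - 1) y
          (P.ins c (P.incl n p x) (P.kos (q + totalDeg ys) (P.incl b s z))) := by
      intro i hi
      clear hys
      induction hy using homog_induction with
      | zero => simp
      | add y y' _ _ hy hy' => simp only [map_add, LinearMap.add_apply, hy, hy']
      | incl a y =>
        rw [step_incl, step_incl, ih hys' _ (by omega), kos_add, kos_incl, map_smul, map_smul,
          map_smul, P.ins_parallel c i hi _ (P.incl_mem_homog a q y)]
        simp only [map_smul, LinearMap.smul_apply]
        rw [show i + a + b - 1 = i + b - 1 + a by omega]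
    -- The slots of `x` to the right of `c` are shifted by `b - 1` once `z` has been inserted.
    by_cases hcn : c < n
    · obtain ⟨w, hw⟩ : ∃ w, P.ins c (P.incl n p x) (P.kos (q + totalDeg ys) (P.incl b s z)) =
          P.incl (n + b - 1) (p + s) w := by
        rw [kos_incl, ← map_smul]
        exact P.exists_ins_incl (by omega) _ _ _
      rw [hw, insList_cons_incl, insList_cons_incl, map_sum, LinearMap.sum_apply, ← hw]
      rw [Finset.sum_congr rfl fun i hi => key i (by rw [Finset.mem_Ico] at hi; omega)]
      refine Finset.sum_bij' (fun i _ => i + b - 1) (fun i _ => i + 1 - b) ?_ ?_ ?_ ?_ ?_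
      · simp only [Finset.mem_Ico]; omega
      · simp only [Finset.mem_Ico]; omega
      · simp only [Finset.mem_Ico]; omega
      · simp only [Finset.mem_Ico]; omega
      · intros; rfl
    · rw [P.ins_incl_of_le (not_lt.1 hcn), map_zero, P.insList_cons_of_le _ _ (by omega), map_zero,
        LinearMap.zero_apply]

end Operad

/-! ### The brace relation for elements of finite support -/

/-- With at least one operation to insert, `h` is evaluated on nonempty lists only. -/
lemma weave_cons_congr {X Y : Type*} [AddCommMonoid Y] (κ : Bideg → X → X)
    (g : Bideg × (List X → X)) (gs) {h h' : List X → Y} (hh : ∀ c l, h (c :: l) = h' (c :: l))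
    (zs : List X) : weave κ (g :: gs) h zs = weave κ (g :: gs) h' zs := by
  induction zs generalizing h h' with
  | nil => simp only [weave_cons_nil, hh]
  | cons z zs ih =>
    simp only [weave_cons_cons, hh]

namespace Operad

variable (P : Operad.{u, v} R)

/-- The operations `y ↦ b(y; -)` attached to a list of elements. -/
def braceOps (ys : List (Bideg × P.All)) : List (Bideg × (List P.All → P.All)) :=
  ys.map fun y => (y.1, fun l => P.insList l 0 y.2)

lemma totalDeg_braceOps (ys : List (Bideg × P.All)) :
    totalDeg (P.braceOps ys) = totalDeg ys := by
  simp [braceOps, totalDeg, Function.comp_def]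

/-- Insertions into `x ∘_k y` starting inside the inputs of `y`: an initial segment of the inserted
elements ends up inside `y`, the others to the right of `y`. -/
lemma insList_block {ys : List (Bideg × P.All)} (hys : P.HomogList ys) {n k : ℕ} (hk : k < n)
    {d : Bideg} (x : P.obj n d) {a : ℕ} {q : Bideg} (y : P.obj a q) (i : ℕ) (hi : i ≤ a)
    (zs : List P.All) :
    P.insList zs (k + i)
        (P.insList (ys.map Prod.snd) (k + a) (P.ins k (P.incl n d x) (P.incl a q y))) =
      splitSum (fun l r => P.step (fun s => P.insList r s ∘ₗ P.insList (ys.map Prod.snd) s) k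
        (P.insList (l.map (P.kos (totalDeg ys))) i (P.incl a q y)) (P.incl n d x)) zs := by
  -- Induction on the number of inputs of `y` that are still available.
  obtain ⟨t, ht⟩ : ∃ t, i + t = a := ⟨a - i, by omega⟩
  induction t generalizing a q y i zs with
  | zero =>
    obtain rfl : i = a := ht
    cases zs with
    | nil => simp [splitSum]
    | cons z zs =>
      simp only [splitSum, List.map_cons, P.insList_cons_of_le _ _ le_rfl, map_zero,
        LinearMap.zero_apply, splitSum_zero, add_zero]
      simp
  | succ t ih =>
    cases zs with
    | nil => simp [splitSum]
    | cons z zs =>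
      have hV : P.insList (ys.map Prod.snd) (k + a) (P.ins k (P.incl n d x) (P.incl a q y)) ∈
          P.arityGE (k + i + 1) := by
        obtain ⟨w, hw⟩ := P.exists_ins_incl (k := n + a - 1) (by omega) k x y
        rw [hw]
        exact P.arityGE_anti (by omega)
          (P.insList_mem_arityGE _ (P.incl_mem_arityGE (k := k + a) (by omega) _ _))
      have hy : P.incl a q y ∈ P.arityGE (i + 1) := P.incl_mem_arityGE (by omega) _ _
      rw [P.insList_cons_succ _ _ hV, add_assoc k i 1, ih y (i + 1) (by omega) _ (by omega)]
      simp only [splitSum, List.map_cons, List.map_nil, P.insList_cons_succ _ _ hy, map_add,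
        LinearMap.add_apply, splitSum_add, insList_nil]
      rw [← add_assoc]
      congr 1
      induction z using all_induction with
      | zero => simp [splitSum_zero]
      | add z z' hz hz' => simp only [map_add, LinearMap.add_apply, splitSum_add, hz, hz']
      | incl b s z =>
        obtain ⟨w, hw⟩ : ∃ w, P.ins i (P.incl a q y) (P.kos (totalDeg ys) (P.incl b s z)) =
            P.incl (a + b - 1) (q + s) w := by
          rw [kos_incl, ← map_smul]
          exact P.exists_ins_incl (by omega) _ _ _
        rw [step_incl, P.ins_insList hys _ _ (by omega), P.ins_assoc _ _ (by omega), hw,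
          add_assoc k i b, show k + a + b - 1 = k + (a + b - 1) by omega,
          ih w (i + b) (by omega) _ (by omega),
          kos_incl, ← map_smul]
        congr 1; funext l r
        rw [step_incl, map_smul, ← kos_incl, hw]

/-- The brace relation: inserting `zs` in the result of inserting `ys` in `x` amounts to inserting
in `x` some of the `zs`, together with the `ys`, in which the other `zs` have been inserted. -/
theorem insList_insList {ys : List (Bideg × P.All)} (hys : P.HomogList ys) (k : ℕ) (x : P.All)
    (zs : List P.All) :
    P.insList zs k (P.insList (ys.map Prod.snd) k x) =
      weave (fun q => P.kos q) (P.braceOps ys) (fun l => P.insList l k x) zs := by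
  induction x using all_induction with
  | zero => simp [weave_zero]
  | add x x' hx hx' => simp only [map_add, weave_add, hx, hx']
  | incl n d x =>
  -- Induction on the number of slots of `x` that are still available.
  obtain ⟨t, ht⟩ : ∃ t, n ≤ k + t := ⟨n, by omega⟩
  induction t generalizing k n d ys zs with
  | zero =>
    cases ys with
    | nil => rfl
    | cons y ys =>
      rw [List.map_cons, P.insList_cons_of_le _ _ (by omega), map_zero, braceOps, List.map_cons,
        weave_cons_congr (h' := fun _ => 0), weave_zero]
      intro c l
      rw [P.insList_cons_of_le _ _ (by omega)]
  | succ t ih =>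
    cases ys with
    | nil => rfl
    | cons y ys =>
    by_cases hk : k < n
    swap
    · exact ih hys k zs n d x (by omega)
    have hys' : P.HomogList ys := fun w hw => hys w (by simp [hw])
    have hx : P.incl n d x ∈ P.arityGE (k + 1) := P.incl_mem_arityGE hk _ _
    have key : ∀ {ys : List (Bideg × P.All)}, P.HomogList ys → ∀ (c : P.All) (zs : List P.All),
        weave (fun q => P.kos q) (P.braceOps ys)
            (fun l => P.step (P.insList l) k c (P.incl n d x)) zs =
          P.step (fun s => P.insList zs s ∘ₗ P.insList (ys.map Prod.snd) s) k c (P.incl n d x) := by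
      intro ys hys c zs
      induction c using all_induction with
      | zero => simp [weave_zero]
      | add c c' hc hc' => simp only [map_add, LinearMap.add_apply, weave_add, hc, hc']
      | incl b s c =>
        obtain ⟨w, hw⟩ := P.exists_ins_incl (k := n + b - 1) (by omega) k x c
        simp only [step_incl, LinearMap.comp_apply, hw]
        exact (ih hys (k + b) zs _ _ w (by omega)).symm
    have hblock : ∀ y zs, P.insList zs k (P.step (P.insList (ys.map Prod.snd)) k y (P.incl n d x)) =
        splitSum (fun l r => P.step (fun s => P.insList r s ∘ₗ P.insList (ys.map Prod.snd) s) k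
          (P.insList (l.map (P.kos (totalDeg ys))) 0 y) (P.incl n d x)) zs := by
      intro y zs
      induction y using all_induction with
      | zero => simp [splitSum_zero]
      | add y y' hy hy' => simp only [map_add, LinearMap.add_apply, splitSum_add, hy, hy']
      | incl a q y =>
        rw [step_incl]
        exact P.insList_block hys' hk x y 0 (by omega) zs
    -- Both sides are split according to whether slot `k` of `x` receives an element; `h'` collects
    -- the terms in which it does.
    obtain ⟨h', hh'⟩ : ∃ h' : List P.All → P.All,
        ∀ c l, h' (c :: l) = P.step (P.insList l) k c (P.incl n d x) :=
      ⟨fun l => match l with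
        | [] => 0
        | c :: l => P.step (P.insList l) k c (P.incl n d x), fun _ _ => rfl⟩
    have hh : weave (fun q => P.kos q) (P.braceOps (y :: ys))
          (fun l => P.insList l k (P.incl n d x)) zs =
        weave (fun q => P.kos q) (P.braceOps (y :: ys))
            (fun l => P.insList l (k + 1) (P.incl n d x)) zs +
          weave (fun q => P.kos q) (P.braceOps (y :: ys)) h' zs := by
      rw [← weave_add]
      exact weave_cons_congr _ _ _ (fun c l => by rw [P.insList_cons_succ _ _ hx, hh']) _
    rw [hh, List.map_cons, P.insList_cons_succ _ _ hx, map_add, hblock]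
    cases zs with
    | nil =>
      congr 1
      · exact ih hys (k + 1) [] n d x (by omega)
      · change _ = weave _ ((y.1, fun l => P.insList l 0 y.2) :: P.braceOps ys) h' _
        simp only [weave_cons_nil, hh', key hys']
        rfl
    | cons z zs =>
      have hW : P.insList (y.2 :: ys.map Prod.snd) (k + 1) (P.incl n d x) ∈ P.arityGE (k + 1) :=
        P.insList_mem_arityGE _ hx
      rw [P.insList_cons_succ _ _ hW, ← List.map_cons (f := Prod.snd),
        ih hys (k + 1) _ n d x (by omega), add_assoc]
      congr 1
      change _ = weave _ ((y.1, fun l => P.insList l 0 y.2) :: P.braceOps ys) h' _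
      rw [weave_cons_cons, totalDeg_braceOps]
      simp only [hh', key hys']
      change _ = _ + weave _ (P.braceOps (y :: ys)) _ _
      rw [key hys]
      rw [add_comm]
      congr 1
      clear hh
      induction z using all_induction with
      | zero => simp
      | add z z' hz hz' => simp only [map_add, LinearMap.add_apply, hz, hz']
      | incl b s z =>
        rw [step_incl, P.ins_insList hys _ _ (by omega), ← totalDeg_cons, kos_incl]
        simp only [map_smul, LinearMap.smul_apply, step_incl, LinearMap.comp_apply]
        rw [show k + 1 + b - 1 = k + b by omega]

end Operad

/-! ### Components of braces -/

namespace Operad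

variable (P : Operad.{u, v} R)

/-- The component of arity `n` and bidegree `d` of an element of `P.All`. -/
def coeff (n : ℕ) (d : Bideg) : P.All →ₗ[R] P.obj n d :=
  DirectSum.component R (ℕ × Bideg) (fun a => P.obj a.1 a.2) (n, d)

@[simp] lemma coeff_incl (n : ℕ) (d : Bideg) (x : P.obj n d) : P.coeff n d (P.incl n d x) = x :=
  DirectSum.component.lof_self R (M := fun a : ℕ × Bideg => P.obj a.1 a.2) (n, d) x

lemma coeff_incl_of_ne {n m : ℕ} {d e : Bideg} (h : ¬(n = m ∧ d = e)) (x : P.obj m e) :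
    P.coeff n d (P.incl m e x) = 0 := by
  refine (DirectSum.component.of R (M := fun a : ℕ × Bideg => P.obj a.1 a.2) (n, d) (m, e) x).trans
    (dif_neg fun h' => h ?_)
  rw [Prod.mk.injEq] at h'
  exact ⟨h'.1.symm, h'.2.symm⟩

/-- A homogeneous element is the sum of its components in the arities below any large bound. -/
lemma homog_eq_sum {d : Bideg} {x : P.All} (hx : x ∈ P.homog d) :
    ∃ B, ∀ C, B ≤ C → x = ∑ n ∈ Finset.range C, P.incl n d (P.coeff n d x) := by
  induction hx using homog_induction with
  | zero => exact ⟨0, by simp⟩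
  | incl n x =>
    refine ⟨n + 1, fun C hC => ?_⟩
    rw [Finset.sum_eq_single_of_mem n (Finset.mem_range.2 hC), coeff_incl]
    intro m _ hm
    rw [P.coeff_incl_of_ne (by simp [hm]), map_zero]
  | add x y _ _ hx hy =>
    obtain ⟨B, hB⟩ := hx
    obtain ⟨B', hB'⟩ := hy
    refine ⟨max B B', fun C hC => ?_⟩
    simp only [map_add, Finset.sum_add_distrib]
    rw [← hB C (by omega), ← hB' C (by omega)]

lemma insList_mem_homog {ys : List (Bideg × P.All)} (hys : P.HomogList ys) (k : ℕ) {d : Bideg}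
    {x : P.All} (hx : x ∈ P.homog d) :
    P.insList (ys.map Prod.snd) k x ∈ P.homog (d + totalDeg ys) := by
  induction ys generalizing k d x with
  | nil => simpa using hx
  | cons y ys ih =>
    obtain ⟨q, y⟩ := y
    have hy : y ∈ P.homog q := hys (q, y) (by simp)
    have hys' : P.HomogList ys := fun w hw => hys w (by simp [hw])
    clear hys
    induction hx using homog_induction with
    | zero => simp
    | add x x' _ _ hx hx' => rw [map_add]; exact add_mem hx hx'
    | incl n x =>
      rw [List.map_cons, insList_cons_incl]
      refine Submodule.sum_mem _ fun i _ => ?_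
      induction hy using homog_induction with
      | zero => simp
      | add y y' _ _ hy hy' => rw [map_add, LinearMap.add_apply]; exact add_mem hy hy'
      | incl a y =>
        rw [step_incl, totalDeg_cons, ← add_assoc]
        refine ih hys' _ ?_
        by_cases hi : i < n
        · rw [P.ins_incl (k := n + a - 1) (by omega) rfl ⟨i, hi⟩]
          exact P.incl_mem_homog _ _ _
        · rw [P.ins_incl_of_le (not_lt.1 hi)]
          exact zero_mem _

/-- The components of an iterated insertion in all but one arity vanish. -/
lemma coeff_insList_of_ne {j : ℕ} {a : Fin j → ℕ} {d : Fin j → Bideg} (y : ∀ v, P.obj (a v) (d v))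
    {N : ℕ} {d₀ : Bideg} (x : P.obj N d₀) (k L : ℕ) (D : Bideg) (h : L + j ≠ N + ∑ v, a v) :
    P.coeff L D (P.insList (List.ofFn fun v => P.incl (a v) (d v) (y v)) k (P.incl N d₀ x)) =
      0 := by
  induction j generalizing N d₀ k with
  | zero => exact P.coeff_incl_of_ne (fun h' => h (by simpa using h'.1)) x
  | succ j ih =>
    rw [List.ofFn_succ, insList_cons_incl, map_sum]
    refine Finset.sum_eq_zero fun i hi => ?_
    rw [Finset.mem_Ico] at hi
    rw [step_incl, P.ins_incl (k := N + a 0 - 1) (by omega) rfl ⟨i, hi.2⟩]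
    refine ih (fun v => y v.succ) _ _ ?_
    rw [Fin.sum_univ_succ] at h
    omega

/-- `insList` on homogeneous elements is given by `Operad.insertions`. -/
lemma incl_insertions {j : ℕ} {a : Fin j → ℕ} {d : Fin j → Bideg} {N : ℕ} {d₀ : Bideg} {k L : ℕ}
    {D : Bideg} (hL : L + j = N + ∑ v, a v) (hD : D = d₀ + ∑ v, d v) (x : P.obj N d₀)
    (y : ∀ v, P.obj (a v) (d v)) :
    P.incl L D (P.insertions j a d N d₀ k L D hL hD x y) =
      P.insList (List.ofFn fun v => P.incl (a v) (d v) (y v)) k (P.incl N d₀ x) := by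
  induction j generalizing N d₀ k with
  | zero =>
    obtain rfl : L = N := by simpa using hL
    obtain rfl : D = d₀ := by simpa using hD
    rfl
  | succ j ih =>
    rw [List.ofFn_succ, insList_cons_incl]
    have hs : Finset.Ico k N = (Finset.range N).filter fun i => k ≤ i := by
      ext i; simp [and_comm]
    rw [hs, Finset.sum_filter, ← Fin.sum_univ_eq_sum_range
      (fun i => if k ≤ i then P.step (P.insList (List.ofFn fun v : Fin j =>
        P.incl (a v.succ) (d v.succ) (y v.succ))) i (P.incl (a 0) (d 0) (y 0)) (P.incl N d₀ x)
        else 0) N]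
    rw [insertions, LinearMap.comp_apply, LinearMap.sum_apply, map_sum]
    rw [show ∀ f : Fin N → MultilinearMap R _ (P.obj L D), (∑ i, f i) y = ∑ i, f i y from
      fun f => by simp, map_sum]
    refine Finset.sum_congr rfl fun i _ => ?_
    split_ifs with hi
    · rw [step_incl, P.ins_incl (k := N + a 0 - 1) (by have := i.isLt; omega) rfl i, ← ih
        (by rw [Fin.sum_univ_succ] at hL; have := i.isLt; omega)
        (by rw [Fin.sum_univ_succ] at hD; rw [hD, add_assoc])]
      rfl
    · simp

lemma insList_ofFn_update {j : ℕ} (vs : Fin j → P.All) (s : Fin j) (k : ℕ) (c c' : R)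
    (y y' : P.All) :
    P.insList (List.ofFn (Function.update vs s (c • y + c' • y'))) k =
      c • P.insList (List.ofFn (Function.update vs s y)) k +
        c' • P.insList (List.ofFn (Function.update vs s y')) k := by
  induction j generalizing k with
  | zero => exact s.elim0
  | succ j ih =>
    refine all_hom_ext fun n d x => ?_
    simp only [List.ofFn_succ, insList_cons_incl, LinearMap.add_apply, LinearMap.smul_apply,
      Finset.smul_sum, ← Finset.sum_add_distrib]
    refine Finset.sum_congr rfl fun i _ => ?_
    refine Fin.cases ?_ (fun s => ?_) s
    · have h0 : ∀ (w : P.All) (v : Fin j), Function.update vs 0 w v.succ = vs v.succ :=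
        fun w v => Function.update_of_ne (Fin.succ_ne_zero v) _ _
      simp only [Function.update_self, h0, map_add, map_smul, LinearMap.add_apply,
        LinearMap.smul_apply]
    · have h0 : ∀ w : P.All, Function.update vs s.succ w 0 = vs 0 :=
        fun w => Function.update_of_ne (Fin.succ_ne_zero s).symm _ _
      have h1 : ∀ w : P.All, (fun v : Fin j => Function.update vs s.succ w v.succ) =
          Function.update (fun v => vs v.succ) s w := fun w => by
        funext v
        simp [Function.update_apply]
      simp only [h0, h1]
      generalize vs 0 = w
      induction w using all_induction with
      | zero => simp
      | add w w' hw hw' =>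
        simp only [map_add, LinearMap.add_apply, hw, hw', smul_add]
        abel
      | incl a e w => simp only [step_incl, ih, LinearMap.add_apply, LinearMap.smul_apply]

/-- `insList`, as a multilinear function of all its arguments; the argument with index `0` is the
one into which the others are inserted. -/
def insListMulti (j k : ℕ) : MultilinearMap R (fun _ : Fin (j + 1) => P.All) P.All :=
  have key : ∀ (x : Fin (j + 1) → P.All) (s : Fin (j + 1)) (c c' : R) (y y' : P.All),
      P.insList (List.ofFn fun v : Fin j => Function.update x s (c • y + c' • y') v.succ) k
          (Function.update x s (c • y + c' • y') 0) =
        c • P.insList (List.ofFn fun v : Fin j => Function.update x s y v.succ) k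
            (Function.update x s y 0) +
          c' • P.insList (List.ofFn fun v : Fin j => Function.update x s y' v.succ) k
            (Function.update x s y' 0) := by
    intro x s c c' y y'
    refine Fin.cases ?_ (fun s => ?_) s
    · have h0 : ∀ (w : P.All) (v : Fin j), Function.update x 0 w v.succ = x v.succ :=
        fun w v => Function.update_of_ne (Fin.succ_ne_zero v) _ _
      simp only [Function.update_self, h0, map_add, map_smul]
    · have h0 : ∀ w : P.All, Function.update x s.succ w 0 = x 0 :=
        fun w => Function.update_of_ne (Fin.succ_ne_zero s).symm _ _
      have h1 : ∀ w : P.All, (fun v : Fin j => Function.update x s.succ w v.succ) =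
          Function.update (fun v => x v.succ) s w := fun w => by
        funext v
        simp [Function.update_apply]
      simp only [h0, h1, insList_ofFn_update, LinearMap.add_apply, LinearMap.smul_apply]
  { toFun := fun x => P.insList (List.ofFn fun v : Fin j => x v.succ) k (x 0)
    map_update_add' := by
      intro inst x s y y'
      obtain rfl : inst = instDecidableEqFin _ := Subsingleton.elim _ _
      simpa using key x s 1 1 y y'
    map_update_smul' := by
      intro inst x s c y
      obtain rfl : inst = instDecidableEqFin _ := Subsingleton.elim _ _
      simpa using key x s c 0 y 0 }

/-- The components of a brace, in terms of `insList`. -/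
lemma incl_brace {j : ℕ} {d₀ : Bideg} {d : Fin j → Bideg} {D : Bideg} (hD : D = d₀ + ∑ v, d v)
    (x : P.tot.obj d₀) (y : ∀ v, P.tot.obj (d v)) (L : ℕ) :
    P.incl L D (P.brace j d₀ d D hD x y L) =
      ∑ c ∈ Finset.Nat.antidiagonalTuple (j + 1) (L + j),
        P.insList (List.ofFn fun v => P.incl (c v.succ) (d v) (y v (c v.succ))) 0
          (P.incl (c 0) d₀ (x (c 0))) := by
  rw [← Finset.sum_attach]
  simp only [brace, LinearMap.coe_mk, AddHom.coe_mk, MultilinearMap.pi_apply]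
  rw [show ∀ (s : Finset {c // c ∈ Finset.Nat.antidiagonalTuple (j + 1) (L + j)})
    (f : {c // c ∈ Finset.Nat.antidiagonalTuple (j + 1) (L + j)} →
      MultilinearMap R (fun v => P.tot.obj (d v)) (P.obj L D)),
      (∑ i ∈ s, f i) y = ∑ i ∈ s, f i y from fun s f => by simp, map_sum]
  refine Finset.sum_congr rfl fun c _ => ?_
  rw [← incl_insertions]
  rfl

/-- On homogeneous elements of finite support, the brace is computed by `insList`. -/
lemma coeff_insList {j : ℕ} {d₀ : Bideg} {d : Fin j → Bideg} {D : Bideg} (hD : D = d₀ + ∑ v, d v)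
    {x : P.All} (hx : x ∈ P.homog d₀) {y : Fin j → P.All} (hy : ∀ v, y v ∈ P.homog (d v)) (L : ℕ) :
    P.coeff L D (P.insList (List.ofFn y) 0 x) =
      P.brace j d₀ d D hD (fun n => P.coeff n d₀ x) (fun v n => P.coeff n (d v) (y v)) L := by
  rw [← P.coeff_incl L D (P.brace _ _ _ _ _ _ _ _), incl_brace]
  let z : Fin (j + 1) → P.All := Fin.cons x y
  let e : Fin (j + 1) → Bideg := Fin.cons d₀ d
  have hz : ∀ v, z v ∈ P.homog (e v) := Fin.cases hx hy
  choose B hB using fun v => P.homog_eq_sum (hz v)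
  let C := (L + j + 1) ⊔ Finset.univ.sup B
  have hC : ∀ v, B v ≤ C := fun v =>
    (Finset.le_sup (f := B) (Finset.mem_univ v)).trans le_sup_right
  have h1 : P.insList (List.ofFn y) 0 x = P.insListMulti j 0 z := rfl
  rw [h1, show z = fun v => ∑ n ∈ Finset.range C, P.incl n (e v) (P.coeff n (e v) (z v)) from
    funext fun v => hB v C (hC v), MultilinearMap.map_sum_finset, map_sum, map_sum]
  symm
  refine Finset.sum_subset_zero_on_sdiff ?_ ?_ ?_
  · intro c hc
    rw [Finset.Nat.mem_antidiagonalTuple] at hc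
    rw [Fintype.mem_piFinset]
    intro v
    have := Finset.single_le_sum (f := c) (fun _ _ => Nat.zero_le _) (Finset.mem_univ v)
    rw [Finset.mem_range]
    have : L + j + 1 ≤ C := le_sup_left
    omega
  · intro c hc
    rw [Finset.mem_sdiff, Finset.Nat.mem_antidiagonalTuple] at hc
    refine P.coeff_insList_of_ne _ _ _ _ _ fun h => hc.2 ?_
    rw [Fin.sum_univ_succ, h]
  · intro c _
    rfl

/-- A component of a brace depends on finitely many components of the arguments only. -/
lemma brace_congr {j : ℕ} {d₀ : Bideg} {d : Fin j → Bideg} {D : Bideg} (hD : D = d₀ + ∑ v, d v)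
    (L : ℕ) {x x' : P.tot.obj d₀} (hx : ∀ n ≤ L + j, x n = x' n) {y y' : ∀ v, P.tot.obj (d v)}
    (hy : ∀ v, ∀ n ≤ L + j, y v n = y' v n) :
    P.brace j d₀ d D hD x y L = P.brace j d₀ d D hD x' y' L := by
  rw [← P.coeff_incl L D (P.brace j d₀ d D hD x y L), incl_brace,
    ← P.coeff_incl L D (P.brace j d₀ d D hD x' y' L), incl_brace]
  congr 1
  refine Finset.sum_congr rfl fun c hc => ?_
  rw [Finset.Nat.mem_antidiagonalTuple] at hc
  have hle : ∀ v, c v ≤ L + j := fun v =>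
    hc ▸ Finset.single_le_sum (f := c) (fun _ _ => Nat.zero_le _) (Finset.mem_univ v)
  rw [hx _ (hle 0)]
  congr 2
  congr 1
  funext v
  rw [hy v _ (hle _)]

end Operad

/-! ### Evaluation in an endomorphism operad -/

section Limit

variable {X X' Y Y' : Type*} [AddCommMonoid Y] [AddCommMonoid Y']

/-- `weave` on sequences is computed termwise. -/
lemma weave_seq (κ : Bideg → X → X) (gs : List (Bideg × (ℕ → List X → X))) (h : ℕ → List X → Y)
    (zs : List (ℕ → X)) (C : ℕ) :
    weave (fun q u C => κ q (u C)) (gs.map fun g => (g.1, fun l C => g.2 C (l.map fun u => u C)))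
      (fun l C => h C (l.map fun u => u C)) zs C =
    weave κ (gs.map fun g => (g.1, g.2 C)) (h C) (zs.map fun u => u C) := by
  have hmap : ∀ {l : List (ℕ → X)} {l' : List X},
      List.Forall₂ (fun u x => u C = x) l l' → l.map (fun u => u C) = l' := fun h => by
    induction h with
    | nil => rfl
    | cons ha _ ih => simp [ha, ih]
  refine weave_rel (A := fun (u : ℕ → X) x => u C = x) (B := fun (u : ℕ → Y) y => u C = y)
    ?_ ?_ ?_ ?_ ?_
  · rintro _ _ _ _ rfl rfl
    rfl
  · rintro q _ _ rfl
    rfl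
  · rw [List.forall₂_map_left_iff, List.forall₂_map_right_iff]
    refine List.forall₂_same.2 fun g _ => ⟨rfl, fun l l' hl => ?_⟩
    rw [← hmap hl]
  · intro l l' hl
    rw [← hmap hl]
  · rw [List.forall₂_map_right_iff]
    exact List.forall₂_same.2 fun u _ => rfl

/-- If `A` and `B` are notions of convergence of sequences, then `weave` is compatible with
convergence: this is `weave_rel` for a relation between elements and sequences. -/
theorem weave_limit {κ : Bideg → X → X} {κ' : Bideg → X' → X'} {A : X → (ℕ → X') → Prop}
    {B : Y → (ℕ → Y') → Prop}
    (hadd : ∀ {y₁ y₂ u₁ u₂}, B y₁ u₁ → B y₂ u₂ → B (y₁ + y₂) (u₁ + u₂))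
    (hκ : ∀ q {x u}, A x u → A (κ q x) (fun C => κ' q (u C)))
    {gs : List (Bideg × (List X → X))} {gs' : List (Bideg × (ℕ → List X' → X'))}
    (hg : List.Forall₂ (fun g g' => g.1 = g'.1 ∧ ∀ l l', List.Forall₂ A l l' →
      A (g.2 l) (fun C => g'.2 C (l'.map fun u => u C))) gs gs')
    {h : List X → Y} {h' : ℕ → List X' → Y'}
    (hh : ∀ l l', List.Forall₂ A l l' → B (h l) (fun C => h' C (l'.map fun u => u C)))
    {zs : List X} {zs' : List (ℕ → X')} (hz : List.Forall₂ A zs zs') :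
    B (weave κ gs h zs)
      (fun C => weave κ' (gs'.map fun g => (g.1, g.2 C)) (h' C) (zs'.map fun u => u C)) := by
  simp only [← weave_seq]
  refine weave_rel hadd hκ ?_ hh hz
  rw [List.forall₂_map_right_iff]
  exact hg

end Limit

/-- The value of a family of multilinear maps, one for each arity, on a list of arguments. -/
def evalList (X : BiMod.{u, v} R) (f : ∀ n, X.Multi n) (l : List X.sum) : X.sum := f l.length l.get

lemma evalList_eq (X : BiMod.{u, v} R) (f : ∀ n, X.Multi n) {l : List X.sum} {n : ℕ}
    (h : n = l.length) : evalList X f l = f n fun i => l.get (i.cast h) := by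
  subst h; rfl

@[simp] lemma evalList_ofFn (X : BiMod.{u, v} R) (f : ∀ n, X.Multi n) {n : ℕ} (x : Fin n → X.sum) :
    evalList X f (List.ofFn x) = f n x := by
  rw [evalList_eq X f (List.length_ofFn (f := x)).symm]
  congr 1; funext i; simp

/-- Evaluation on a list, of elements of the direct sum of all components of `End_X`; an element of
arity `n` vanishes on lists whose length is not `n`. -/
def evalAll (X : BiMod.{u, v} R) (l : List X.sum) : (endOp X).All →ₗ[R] X.sum :=
  (endOp X).lift fun n _ =>
    { toFun := fun f => if h : n = l.length then f.1 fun i => l.get (i.cast h) else 0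
      map_add' := by intro f g; split_ifs <;> simp
      map_smul' := by intro c f; split_ifs <;> simp }

section evalAll

variable (X : BiMod.{u, v} R)

lemma evalAll_incl {n : ℕ} {d : Bideg} (f : (endOp X).obj n d) {l : List X.sum}
    (h : n = l.length) :
    evalAll X l ((endOp X).incl n d f) = f.1 fun i => l.get (i.cast h) :=
  (Operad.lift_incl _ _ _ _ _).trans (dif_pos h)

lemma evalAll_incl_of_ne {n : ℕ} {d : Bideg} (f : (endOp X).obj n d) {l : List X.sum}
    (h : n ≠ l.length) : evalAll X l ((endOp X).incl n d f) = 0 :=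
  (Operad.lift_incl _ _ _ _ _).trans (dif_neg h)

lemma evalAll_of_arityGE {k : ℕ} {x : (endOp X).All} (hx : x ∈ (endOp X).arityGE k)
    {l : List X.sum} (hl : l.length < k) : evalAll X l x = 0 := by
  induction hx using Operad.arityGE_induction with
  | zero => simp
  | add x y _ _ hx hy => rw [map_add, hx, hy, add_zero]
  | incl n d f h => exact evalAll_incl_of_ne X f (by omega)

/-- Evaluation of a single insertion: the inserted operation consumes the block `mid`, and passes
the arguments `w` to its left. -/
lemma evalAll_ins (w mid r : List X.sum) {n m : ℕ} {p q : Bideg} (f : (endOp X).obj n p)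
    (g : (endOp X).obj m q) (hm : mid.length = m) :
    evalAll X (w ++ (mid ++ r))
        ((endOp X).ins w.length ((endOp X).incl n p f) ((endOp X).incl m q g)) =
      evalAll X (w.map (X.koszul q) ++ evalAll X mid ((endOp X).incl m q g) :: r)
        ((endOp X).incl n p f) := by
  by_cases hn : n = w.length + 1 + r.length
  · rw [Operad.ins_incl _ (k := w.length + (m + r.length)) (by omega) rfl ⟨w.length, by omega⟩,
      evalAll_incl X _ (by simp; omega), evalAll_incl X f (by simp; omega)]
    change f.1 (X.args _ q _ g.1 _) = _
    congr 1
    funext v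
    rcases lt_trichotomy (v : ℕ) w.length with hv | hv | hv
    · rw [X.args_lt _ _ _ _ _ _ hv]
      simp [List.getElem_append_left, hv]
    · rw [X.args_eq _ _ _ _ _ _ hv]
      have hmid : evalAll X mid ((endOp X).incl m q g) =
          (w.map (X.koszul q) ++ evalAll X mid ((endOp X).incl m q g) :: r).get
            (v.cast (by simp; omega)) := by
        simp [List.getElem_append_right, hv]
      rw [← hmid, evalAll_incl X g hm.symm]
      congr 1
      funext i
      simp [List.getElem_append_right, List.getElem_append_left, hm]
    · rw [X.args_gt _ _ _ _ _ _ hv]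
      obtain ⟨s, hs⟩ : ∃ s, (v : ℕ) = w.length + 1 + s := ⟨v - (w.length + 1), by omega⟩
      have h1 : w.length + 1 + s + m - 1 - w.length - mid.length = s := by omega
      have h2 : w.length + 1 + s - w.length = s + 1 := by omega
      simp only [List.get_eq_getElem, Fin.val_cast, hs]
      rw [List.getElem_append_right (by omega), List.getElem_append_right (by omega),
        List.getElem_append_right (by simp; omega)]
      simp [h1, h2]
  · rw [evalAll_incl_of_ne X f (by simp; omega)]
    by_cases hk : w.length < n
    · rw [Operad.ins_incl _ (k := n + m - 1) (by omega) rfl ⟨w.length, hk⟩,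
        evalAll_incl_of_ne X _ (by simp; omega)]
    · rw [Operad.ins_incl_of_le _ (not_lt.1 hk), map_zero]

lemma get_append_cons_eq_update (w r : List X.sum) (a : X.sum) {n : ℕ}
    (h : ∀ a : X.sum, n = (w ++ a :: r).length) (hw : w.length < n) :
    (fun i : Fin n => (w ++ a :: r).get (i.cast (h a))) =
      Function.update (fun i : Fin n => (w ++ 0 :: r).get (i.cast (h 0))) ⟨w.length, hw⟩ a := by
  funext i
  simp only [Function.update_apply, Fin.ext_iff, List.get_eq_getElem, Fin.val_cast]
  rcases lt_trichotomy (i : ℕ) w.length with hi | hi | hi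
  · rw [if_neg hi.ne, List.getElem_append_left hi, List.getElem_append_left hi]
  · rw [if_pos hi]
    simp [hi]
  · rw [if_neg hi.ne', List.getElem_append_right hi.le, List.getElem_append_right hi.le]
    obtain ⟨s, hs⟩ : ∃ s, (i : ℕ) - w.length = s + 1 := ⟨i - w.length - 1, by omega⟩
    simp only [hs, List.getElem_cons_succ]

/-- Evaluation is linear in each argument. -/
lemma evalAll_append_cons (w r : List X.sum) (x : (endOp X).All) (c c' : R) (a a' : X.sum) :
    evalAll X (w ++ (c • a + c' • a') :: r) x =
      c • evalAll X (w ++ a :: r) x + c' • evalAll X (w ++ a' :: r) x := by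
  induction x using Operad.all_induction with
  | zero => simp
  | add x y hx hy => simp only [map_add, hx, hy, smul_add]; abel
  | incl n d f =>
    by_cases h : n = w.length + 1 + r.length
    · have h' : ∀ a : X.sum, n = (w ++ a :: r).length := by simp; omega
      rw [evalAll_incl X f (h' _), evalAll_incl X f (h' _), evalAll_incl X f (h' _)]
      have hw : w.length < n := by omega
      rw [get_append_cons_eq_update X w r _ h' hw, get_append_cons_eq_update X w r a h' hw,
        get_append_cons_eq_update X w r a' h' hw, MultilinearMap.map_update_add,
        MultilinearMap.map_update_smul, MultilinearMap.map_update_smul]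
    · have h' : ∀ a : X.sum, n ≠ (w ++ a :: r).length := by simp; omega
      rw [evalAll_incl_of_ne X f (h' _), evalAll_incl_of_ne X f (h' _),
        evalAll_incl_of_ne X f (h' _)]
      simp

/-- The operations on lists defined by a list of elements of `End_X`. -/
def evalOps (vs : List (Bideg × (endOp X).All)) : List (Bideg × (List X.sum → X.sum)) :=
  vs.map fun v => (v.1, fun l => evalAll X l v.2)

lemma totalDeg_evalOps (vs : List (Bideg × (endOp X).All)) :
    totalDeg (evalOps X vs) = totalDeg vs := by
  simp [evalOps, totalDeg, Function.comp_def]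

/-- Insertions in the endomorphism operad, evaluated on arguments: the arguments `w` to the left of
the slots available for insertions only contribute signs. -/
theorem evalAll_insList {vs : List (Bideg × (endOp X).All)} (hvs : (endOp X).HomogList vs)
    (w zs : List X.sum) {n : ℕ} (hn : w.length ≤ n) {d : Bideg} (f : (endOp X).obj n d) :
    evalAll X (w ++ zs) ((endOp X).insList (vs.map Prod.snd) w.length ((endOp X).incl n d f)) =
      weave (fun q => X.koszul q) (evalOps X vs)
        (fun l => evalAll X (w.map (X.koszul (totalDeg vs)) ++ l) ((endOp X).incl n d f)) zs := by
  -- Induction on the number of slots of `f` that are still available.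
  obtain ⟨t, ht⟩ : ∃ t, n = w.length + t := ⟨n - w.length, by omega⟩
  have hκ : ∀ w : List X.sum, w.map (X.koszul 0) = w := fun w => by
    rw [funext X.koszul_zero]
    exact List.map_id' w
  induction t generalizing n d w vs zs with
  | zero =>
    cases vs with
    | nil => simp [evalOps, weave_nil, Operad.insList_nil, hκ]
    | cons v vs =>
      rw [List.map_cons, Operad.insList_cons_of_le _ _ _ (by omega), map_zero, evalOps,
        List.map_cons, weave_cons_congr (h' := fun _ => 0), weave_zero]
      intro c l
      rw [evalAll_incl_of_ne X f (by simp; omega)]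
  | succ t ih =>
    cases vs with
    | nil => simp [evalOps, weave_nil, Operad.insList_nil, hκ]
    | cons v vs =>
    obtain ⟨q, v⟩ := v
    have hv : v ∈ (endOp X).homog q := hvs (q, v) (by simp)
    have hvs' : (endOp X).HomogList vs := fun w hw => hvs w (by simp [hw])
    have hx : (endOp X).incl n d f ∈ (endOp X).arityGE (w.length + 1) :=
      (endOp X).incl_mem_arityGE (by omega) _ _
    -- The terms in which the first operation is inserted right after the arguments `w`: it consumes
    -- the block `mid`, and passes the arguments `w`.
    have hstep : evalAll X (w ++ zs) ((endOp X).step ((endOp X).insList (vs.map Prod.snd))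
          w.length v ((endOp X).incl n d f)) =
        splitSum (fun mid r => weave (fun q => X.koszul q) (evalOps X vs)
          (fun l => evalAll X (w.map (X.koszul (q + totalDeg vs)) ++
            evalAll X (mid.map (X.koszul (totalDeg vs))) v :: l) ((endOp X).incl n d f)) r) zs := by
      clear hvs
      have hadd : ∀ (c c' : X.sum) (l : List X.sum),
          evalAll X (w.map (X.koszul (q + totalDeg vs)) ++ (c + c') :: l)
            ((endOp X).incl n d f) =
          evalAll X (w.map (X.koszul (q + totalDeg vs)) ++ c :: l) ((endOp X).incl n d f) +
          evalAll X (w.map (X.koszul (q + totalDeg vs)) ++ c' :: l) ((endOp X).incl n d f) :=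
        fun c c' l => by
          simpa using evalAll_append_cons X (w.map (X.koszul (q + totalDeg vs))) l
            ((endOp X).incl n d f) 1 1 c c'
      have hzero : ∀ l : List X.sum,
          evalAll X (w.map (X.koszul (q + totalDeg vs)) ++ 0 :: l) ((endOp X).incl n d f) = 0 :=
        fun l => by
          simpa using evalAll_append_cons X (w.map (X.koszul (q + totalDeg vs))) l
            ((endOp X).incl n d f) 0 0 0 0
      induction hv using Operad.homog_induction with
      | zero => simp [hzero, weave_zero, splitSum_zero]
      | add v v' _ _ hv hv' =>
        simp only [map_add, LinearMap.add_apply, hv, hv', hadd, weave_add, splitSum_add]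
      | incl a v =>
        rw [splitSum_eq_of_length (a := a)]
        swap
        · intro mid r hmid
          rw [evalAll_incl_of_ne X v (by simpa using Ne.symm hmid)]
          simp only [hzero, weave_zero]
        rw [Operad.step_incl]
        obtain ⟨g, hg⟩ := (endOp X).exists_ins_incl (k := n + a - 1) (by omega) w.length f v
        split_ifs with ha
        · have hlen : (w ++ zs.take a).length = w.length + a := by simp [ha]
          have := ih hvs' (w ++ zs.take a) (zs.drop a) (by omega) g (by omega)
          rw [hlen, ← hg, List.append_assoc, List.take_append_drop] at this
          rw [this]
          congr 1
          funext l
          rw [List.map_append, List.append_assoc]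
          have hw : (w.map (X.koszul (totalDeg vs))).length = w.length := by simp
          conv_lhs => rw [← hw]
          rw [evalAll_ins X _ _ _ _ _ (by simp [ha]), List.map_map,
            show X.koszul q ∘ X.koszul (totalDeg vs) = X.koszul (q + totalDeg vs) from
              funext fun z => (X.koszul_add _ _ _).symm]
        · refine evalAll_of_arityGE X (k := w.length + a) ?_ (by simp; omega)
          refine Operad.insList_mem_arityGE _ _ ?_
          rw [hg]
          exact (endOp X).incl_mem_arityGE (by omega) _ _
    rw [List.map_cons, Operad.insList_cons_succ _ _ _ hx, map_add, hstep]
    simp only [evalOps, List.map_cons]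
    cases zs with
    | nil =>
      rw [evalAll_of_arityGE X (k := w.length + 1) (Operad.insList_mem_arityGE _ _ hx) (by simp),
        zero_add, weave_cons_nil, splitSum, totalDeg_cons]
      rfl
    | cons z zs =>
      have := ih hvs (w ++ [z]) zs (by simp; omega) f (by simp; omega)
      simp only [List.append_assoc, List.singleton_append, List.length_append,
        List.length_singleton, List.map_append, List.map_cons, List.map_nil, evalOps,
        totalDeg_cons] at this
      rw [weave_cons_cons, add_comm, this, ← evalOps, totalDeg_evalOps, totalDeg_cons]

end evalAll

/-! ### Passage to the product of all arities -/

open Filter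

namespace Operad

section Approx

variable (P : Operad.{u, v} R)

/-- A sequence of elements of finite support approximating an element `x` of `∏ₙ P(n)`: every
component of `x` is eventually attained. -/
def Approx {d : Bideg} (x : P.tot.obj d) (u : ℕ → P.All) : Prop :=
  (∀ C, u C ∈ P.homog d) ∧ ∀ n, ∀ᶠ C in atTop, P.coeff n d (u C) = x n

/-- The part of arity less than `C`. -/
def trunc {d : Bideg} (x : P.tot.obj d) (C : ℕ) : P.All :=
  ∑ n ∈ Finset.range C, P.incl n d (x n)

lemma trunc_mem {d : Bideg} (x : P.tot.obj d) (C : ℕ) : P.trunc x C ∈ P.homog d :=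
  Submodule.sum_mem _ fun n _ => P.incl_mem_homog n d _

lemma approx_trunc {d : Bideg} (x : P.tot.obj d) : P.Approx x (P.trunc x) := by
  refine ⟨P.trunc_mem x, fun n => ?_⟩
  filter_upwards [eventually_gt_atTop n] with C hC
  rw [trunc, map_sum, Finset.sum_eq_single_of_mem n (Finset.mem_range.2 hC), coeff_incl]
  intro m _ hm
  exact P.coeff_incl_of_ne (fun h => hm h.1.symm) _

variable {P}

lemma homogList_ofFn {j : ℕ} {d : Fin j → Bideg} {y : Fin j → P.All}
    (hy : ∀ v, y v ∈ P.homog (d v)) : P.HomogList (List.ofFn fun v => (d v, y v)) := by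
  intro w hw
  rw [List.mem_ofFn] at hw
  obtain ⟨v, rfl⟩ := hw
  exact hy v

lemma map_snd_ofFn {j : ℕ} (d : Fin j → Bideg) (y : Fin j → P.All) :
    (List.ofFn fun v => (d v, y v)).map Prod.snd = List.ofFn y := by
  rw [List.map_ofFn]; rfl

lemma totalDeg_ofFn {Z : Type*} {j : ℕ} (d : Fin j → Bideg) (y : Fin j → Z) :
    totalDeg (List.ofFn fun v => (d v, y v)) = ∑ v, d v := by
  rw [totalDeg, List.map_ofFn, List.sum_ofFn]; rfl

lemma Approx.brace {j : ℕ} {d₀ : Bideg} {d : Fin j → Bideg} {D : Bideg} (hD : D = d₀ + ∑ v, d v)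
    {x : P.tot.obj d₀} {u : ℕ → P.All} (hx : P.Approx x u) {y : ∀ v, P.tot.obj (d v)}
    {w : Fin j → ℕ → P.All} (hy : ∀ v, P.Approx (y v) (w v)) :
    P.Approx (P.brace j d₀ d D hD x y) fun C => P.insList (List.ofFn fun v => w v C) 0 (u C) := by
  refine ⟨fun C => ?_, fun L => ?_⟩
  · have := P.insList_mem_homog (homogList_ofFn fun v => (hy v).1 C) 0 (hx.1 C)
    rwa [map_snd_ofFn, totalDeg_ofFn, ← hD] at this
  · have h1 : ∀ᶠ C in atTop, ∀ n ∈ Finset.range (L + j + 1), P.coeff n d₀ (u C) = x n :=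
      (eventually_all_finset _).2 fun n _ => hx.2 n
    have h2 : ∀ᶠ C in atTop, ∀ v, ∀ n ∈ Finset.range (L + j + 1),
        P.coeff n (d v) (w v C) = y v n :=
      eventually_all.2 fun v => (eventually_all_finset _).2 fun n _ => (hy v).2 n
    filter_upwards [h1, h2] with C h1 h2
    rw [P.coeff_insList hD (hx.1 C) fun v => (hy v).1 C]
    exact P.brace_congr hD L (fun n hn => h1 n (Finset.mem_range.2 (by omega)))
      fun v n hn => h2 v n (Finset.mem_range.2 (by omega))

end Approx

end Operad

section EndBrace

variable (X : BiMod.{u, v} R)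

lemma evalAll_insList_zero {vs : List (Bideg × (endOp X).All)} (hvs : (endOp X).HomogList vs)
    (zs : List X.sum) (x : (endOp X).All) :
    evalAll X zs ((endOp X).insList (vs.map Prod.snd) 0 x) =
      weave (fun q => X.koszul q) (evalOps X vs) (fun l => evalAll X l x) zs := by
  induction x using Operad.all_induction with
  | zero => simp [weave_zero]
  | add x y hx hy => simp only [map_add, hx, hy, weave_add]
  | incl n d f => exact evalAll_insList X hvs [] zs (Nat.zero_le n) f

lemma evalAll_of_homog {d : Bideg} {x : (endOp X).All} (hx : x ∈ (endOp X).homog d)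
    (l : List X.sum) :
    evalAll X l x = ((endOp X).coeff l.length d x).1 l.get := by
  induction hx using Operad.homog_induction with
  | zero => simp
  | add x y _ _ hx hy => simp only [map_add, hx, hy]; rfl
  | incl n f =>
    by_cases h : n = l.length
    · subst h
      rw [evalAll_incl X f rfl, Operad.coeff_incl]
      rfl
    · rw [evalAll_incl_of_ne X f h, Operad.coeff_incl_of_ne _ (fun h' => h h'.1.symm)]
      rfl

/-- Braces in an endomorphism operad, evaluated on arguments. Both sides are limits of the
corresponding expressions for truncations, for which `evalAll_insList` applies. -/
theorem brace_endOp {j : ℕ} {d₀ : Bideg} {d : Fin j → Bideg} {D : Bideg} (hD : D = d₀ + ∑ v, d v)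
    (f : (endOp X).tot.obj d₀) (g : ∀ v, (endOp X).tot.obj (d v)) {n : ℕ} (z : Fin n → X.sum) :
    ((endOp X).brace j d₀ d D hD f g n).1 z =
      weave (fun q => X.koszul q)
        (List.ofFn fun v => (d v, evalList X fun n => (g v n).1)) (evalList X fun n => (f n).1)
        (List.ofFn z) := by
  have hev : ∀ {e : Bideg} {x : (endOp X).tot.obj e} {u : ℕ → (endOp X).All},
      (endOp X).Approx x u → ∀ l : List X.sum,
      ∀ᶠ C in atTop, evalAll X l (u C) = evalList X (fun n => (x n).1) l := by
    intro e x u hu l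
    filter_upwards [hu.2 l.length] with C hC
    rw [evalAll_of_homog X (hu.1 C), hC]
    rfl
  have h1 := hev (Operad.Approx.brace hD ((endOp X).approx_trunc f)
    fun v => (endOp X).approx_trunc (g v)) (List.ofFn z)
  rw [evalList_ofFn] at h1
  have hmap : ∀ {l : List X.sum} {l' : List (ℕ → X.sum)},
      List.Forall₂ (fun a u => ∀ᶠ C in atTop, u C = a) l l' →
      ∀ᶠ C in atTop, l'.map (fun u => u C) = l := fun h => by
    induction h with
    | nil => simp
    | cons ha _ ih => filter_upwards [ha, ih] with C h1 h2; simp [h1, h2]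
  have h2 := weave_limit (κ := fun q => X.koszul q) (κ' := fun q => X.koszul q)
    (A := fun a u => ∀ᶠ C in atTop, u C = a) (B := fun a u => ∀ᶠ C in atTop, u C = a)
    (gs := List.ofFn fun v => (d v, evalList X fun n => (g v n).1))
    (gs' := List.ofFn fun v => (d v, fun C l => evalAll X l ((endOp X).trunc (g v) C)))
    (h := evalList X fun n => (f n).1) (h' := fun C l => evalAll X l ((endOp X).trunc f C))
    (zs := List.ofFn z) (zs' := (List.ofFn z).map fun a _ => a)
    (fun h h' => by filter_upwards [h, h'] with C h h'; rw [← h, ← h']; rfl)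
    (fun q _ _ h => by filter_upwards [h] with C h; rw [h])
    (by
      rw [List.forall₂_iff_get]
      refine ⟨by simp, fun i h₁ h₂ => ?_⟩
      simp only [List.get_eq_getElem, List.getElem_ofFn, true_and]
      intro l l' hl
      filter_upwards [hmap hl, hev ((endOp X).approx_trunc (g ⟨i, by simpa using h₁⟩)) l]
        with C h1 h2
      rw [h1, h2])
    (by
      intro l l' hl
      filter_upwards [hmap hl, hev ((endOp X).approx_trunc f) l] with C h1 h2
      rw [h1, h2])
    (by
      rw [List.forall₂_map_right_iff]
      exact List.forall₂_same.2 fun _ _ => Eventually.of_forall fun _ => rfl)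
  -- At a sufficiently large stage both sequences have attained their limits.
  obtain ⟨C, h1, h2⟩ := (h1.and h2).exists
  rw [← h1, ← h2, ← Operad.map_snd_ofFn d,
    evalAll_insList_zero X (Operad.homogList_ofFn fun v => (endOp X).trunc_mem (g v) C)]
  simp only [evalOps, List.map_ofFn]
  rfl

end EndBrace

namespace Operad

variable (P : Operad.{u, v} R)

/-- The braces `b_n(x; -)`, for all `n`, as an element of `∏ₙ End(n)`. -/
def braces {d : Bideg} (x : P.tot.obj d) : (endOp P.tot).tot.obj d := fun n => P.braceMap n d x

/-- The braces `b_n(x; -)`, for all `n`, as an operation on lists. -/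
def braceList {d : Bideg} (x : P.tot.obj d) : List P.tot.sum → P.tot.sum :=
  evalList P.tot fun n => (P.braces x n).1

variable {P}

/-- Convergence of sequences of elements of finite support in the module underlying `P`. -/
def ConvergesTo (a : P.tot.sum) (u : ℕ → P.All) : Prop :=
  ∀ n d, ∀ᶠ C in atTop, P.coeff n d (u C) = a d n

lemma coeff_eq_zero_of_homog {d e : Bideg} (h : e ≠ d) {x : P.All} (hx : x ∈ P.homog d) (n : ℕ) :
    P.coeff n e x = 0 := by
  induction hx using homog_induction with
  | zero => simp
  | add x y _ _ hx hy => rw [map_add, hx, hy, add_zero]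
  | incl m x => exact P.coeff_incl_of_ne (fun h' => h h'.2) x

lemma Approx.convergesTo {d : Bideg} {x : P.tot.obj d} {u : ℕ → P.All} (h : P.Approx x u) :
    ConvergesTo (P.tot.of d x) u := by
  intro n e
  by_cases hd : e = d
  · subst hd
    filter_upwards [h.2 n] with C hC
    rw [hC]
    exact (congrFun (DirectSum.component.lof_self R (M := P.tot.obj) e x) n).symm
  · refine Eventually.of_forall fun C => ?_
    rw [coeff_eq_zero_of_homog hd (h.1 C)]
    have : P.tot.of d x e = 0 := by
      refine (DirectSum.component.of R (M := P.tot.obj) e d x).trans (dif_neg (Ne.symm hd))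
    rw [this]
    rfl

/-- A homogeneous element together with an approximating sequence. -/
def IsApprox (a : P.tot.sum) (u : ℕ → P.All) : Prop :=
  ∃ (d : Bideg) (x : P.tot.obj d), a = P.tot.of d x ∧ P.Approx x u

lemma kos_of_homog {q d : Bideg} {x : P.All} (hx : x ∈ P.homog d) :
    P.kos q x = sgn R (pair q d) • x := by
  induction hx using homog_induction with
  | zero => simp
  | add x y _ _ hx hy => rw [map_add, hx, hy, smul_add]
  | incl m x => exact P.kos_incl q m d x

lemma IsApprox.koszul (q : Bideg) {a : P.tot.sum} {u : ℕ → P.All} (h : IsApprox a u) :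
    IsApprox (P.tot.koszul q a) fun C => P.kos q (u C) := by
  obtain ⟨d, x, rfl, h⟩ := h
  refine ⟨d, sgn R (pair q d) • x, by rw [P.tot.koszul_of, map_smul], fun C => ?_, fun n => ?_⟩
  · beta_reduce
    rw [kos_of_homog (h.1 C)]
    exact Submodule.smul_mem _ _ (h.1 C)
  · filter_upwards [h.2 n] with C hC
    rw [kos_of_homog (h.1 C), map_smul, hC]
    rfl

lemma braceList_ofFn {d₀ : Bideg} (x : P.tot.obj d₀) {n : ℕ} {d : Fin n → Bideg}
    (z : ∀ v, P.tot.obj (d v)) :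
    P.braceList x (List.ofFn fun v => P.tot.of (d v) (z v)) =
      P.tot.of (∑ v, d v + d₀) (P.brace n d₀ d _ (add_comm _ _) x z) := by
  rw [braceList, evalList_ofFn]
  exact MultilinearMap.fromDirectSumEquiv_lof _ _ _

lemma Approx.braceList {d₀ : Bideg} {x : P.tot.obj d₀} {u : ℕ → P.All} (hx : P.Approx x u)
    {l : List P.tot.sum} {l' : List (ℕ → P.All)} (hl : List.Forall₂ IsApprox l l') :
    IsApprox (P.braceList x l) fun C => P.insList (l'.map fun w => w C) 0 (u C) := by
  rw [List.forall₂_iff_get] at hl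
  obtain ⟨hlen, hl⟩ := hl
  choose d z hz hw using fun i : Fin l.length => hl i i.isLt (hlen ▸ i.isLt)
  have hl1 : l = List.ofFn fun v => P.tot.of (d v) (z v) := by
    rw [← funext hz]
    exact (List.ofFn_get l).symm
  have hl2 : ∀ C, l'.map (fun w => w C) = List.ofFn fun i : Fin l.length =>
      l'.get ⟨i, hlen ▸ i.isLt⟩ C := fun C => List.ext_getElem (by simp [hlen]) (by simp)
  refine ⟨_, _, (congrArg (P.braceList x) hl1).trans (braceList_ofFn x z), ?_⟩
  simp only [hl2]
  exact hx.brace (add_comm _ _) hw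

lemma ConvergesTo.unique {a b : P.tot.sum} {u : ℕ → P.All} (ha : ConvergesTo a u)
    (hb : ConvergesTo b u) : a = b := by
  refine DFinsupp.ext fun d => funext fun n => ?_
  obtain ⟨C, h1, h2⟩ := ((ha n d).and (hb n d)).exists
  exact h1.symm.trans h2

lemma ConvergesTo.add {a b : P.tot.sum} {u w : ℕ → P.All} (ha : ConvergesTo a u)
    (hb : ConvergesTo b w) : ConvergesTo (a + b) (u + w) := by
  intro n d
  filter_upwards [ha n d, hb n d] with C h1 h2
  rw [Pi.add_apply, map_add, h1, h2]
  rfl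

lemma IsApprox.convergesTo {a : P.tot.sum} {u : ℕ → P.All} (h : IsApprox a u) :
    ConvergesTo a u := by
  obtain ⟨d, x, rfl, h⟩ := h
  exact h.convergesTo

/-- The brace relation in the module underlying an operad. It is the limit, over truncations of all
the elements involved, of the relation `insList_insList` for elements of finite support. -/
theorem braceList_brace {j : ℕ} {d₀ : Bideg} {d : Fin j → Bideg} {D : Bideg}
    (hD : D = d₀ + ∑ v, d v) (x : P.tot.obj d₀) (y : ∀ v, P.tot.obj (d v)) {n : ℕ}
    {e : Fin n → Bideg} (z : ∀ v, P.tot.obj (e v)) :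
    P.braceList (P.brace j d₀ d D hD x y) (List.ofFn fun v => P.tot.of (e v) (z v)) =
      weave (fun q => P.tot.koszul q) (List.ofFn fun v => (d v, P.braceList (y v)))
        (P.braceList x) (List.ofFn fun v => P.tot.of (e v) (z v)) := by
  have hz : List.Forall₂ IsApprox (List.ofFn fun v => P.tot.of (e v) (z v))
      (List.ofFn fun v => P.trunc (z v)) := by
    rw [List.forall₂_iff_get]
    refine ⟨by simp, fun i h₁ h₂ => ?_⟩
    simp only [List.get_eq_getElem, List.getElem_ofFn]
    exact ⟨_, _, rfl, P.approx_trunc _⟩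
  have h1 := (((P.approx_trunc x).brace hD fun v => P.approx_trunc (y v)).braceList hz).convergesTo
  have h2 := weave_limit (κ := fun q => P.tot.koszul q) (κ' := fun q => P.kos q)
    (A := IsApprox) (B := ConvergesTo)
    (gs := List.ofFn fun v => (d v, P.braceList (y v)))
    (gs' := List.ofFn fun v => (d v, fun C l => P.insList l 0 (P.trunc (y v) C)))
    (h := P.braceList x) (h' := fun C l => P.insList l 0 (P.trunc x C))
    ConvergesTo.add (fun q _ _ h => h.koszul q)
    (by
      rw [List.forall₂_iff_get]
      refine ⟨by simp, fun i h₁ h₂ => ?_⟩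
      simp only [List.get_eq_getElem, List.getElem_ofFn, true_and]
      exact fun l l' hl => (P.approx_trunc _).braceList hl)
    (fun l l' hl => ((P.approx_trunc x).braceList hl).convergesTo) hz
  refine h1.unique ?_
  convert h2 using 2 with C
  rw [← map_snd_ofFn d, P.insList_insList (homogList_ofFn fun v => P.trunc_mem (y v) C), braceOps]
  simp only [List.map_ofFn, Function.comp_def]

/-- Two elements of `End(n)` agree if they agree on homogeneous arguments. -/
lemma endOp_ext {X : BiMod.{u, v} R} {n : ℕ} {d : Bideg} {f g : (endOp X).obj n d}
    (h : ∀ (e : Fin n → Bideg) (z : ∀ v, X.obj (e v)),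
      f.1 (fun v => X.of (e v) (z v)) = g.1 fun v => X.of (e v) (z v)) : f = g :=
  Subtype.ext (MultilinearMap.directSum_ext fun e => MultilinearMap.ext fun z => h e z)

/-- The map `x ↦ ∑ₙ b_n(x; -)` is a morphism of brace algebras: the braces of the endomorphism
operad, evaluated on arguments, are the right hand side of the brace relation. -/
theorem braces_brace {j : ℕ} {d₀ : Bideg} {d : Fin j → Bideg} {D : Bideg}
    (hD : D = d₀ + ∑ v, d v) (x : P.tot.obj d₀) (y : ∀ v, P.tot.obj (d v)) :
    P.braces (P.brace j d₀ d D hD x y) =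
      (endOp P.tot).brace j d₀ d D hD (P.braces x) fun v => P.braces (y v) := by
  funext n
  refine endOp_ext fun e z => ?_
  rw [brace_endOp]
  refine Eq.trans ?_ (braceList_brace hD x y z)
  rw [braceList, evalList_ofFn]

end Operad

/-! ### The pre-Lie product and the operations `M'` -/

namespace Operad

variable (P : Operad.{u, v} R)

lemma of_brace {j : ℕ} {d₀ : Bideg} {d : Fin j → Bideg} {D D' : Bideg} (hD : D = d₀ + ∑ v, d v)
    (hD' : D' = d₀ + ∑ v, d v) (x : P.tot.obj d₀) (y : ∀ v, P.tot.obj (d v)) :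
    P.tot.of D (P.brace j d₀ d D hD x y) = P.tot.of D' (P.brace j d₀ d D' hD' x y) := by
  subst hD hD'
  rfl

/-- The pre-Lie product `b₁(x; y)`, as an element of the direct sum of all bidegrees. -/
def preLie {d e : Bideg} : P.tot.obj d →ₗ[R] P.tot.obj e →ₗ[R] P.tot.sum :=
  LinearMap.mk₂ R
    (fun x y => P.tot.of (d + e) (P.brace 1 d (fun _ => e) (d + e) (by simp) x fun _ => y))
    (fun x x' y => by simp)
    (fun c x y => by simp)
    (fun x y y' => by
      have h : ∀ z : P.tot.obj e, (fun _ : Fin 1 => z) = Function.update (fun _ => 0) 0 z :=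
        fun z => funext fun i => by rw [Subsingleton.elim i 0, Function.update_self]
      rw [h (y + y'), h y, h y', MultilinearMap.map_update_add, map_add])
    (fun c x y => by
      have h : ∀ z : P.tot.obj e, (fun _ : Fin 1 => z) = Function.update (fun _ => 0) 0 z :=
        fun z => funext fun i => by rw [Subsingleton.elim i 0, Function.update_self]
      rw [h (c • y), h y, MultilinearMap.map_update_smul, map_smul])

lemma preLie_eq {d e D : Bideg} (hD : D = d + ∑ _v : Fin 1, e) (x : P.tot.obj d) (y : P.tot.obj e) :
    P.preLie x y = P.tot.of D (P.brace 1 d (fun _ => e) D hD x fun _ => y) :=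
  P.of_brace _ _ _ _

variable {P}

lemma braceList_singleton {d e : Bideg} (x : P.tot.obj d) (y : P.tot.obj e) :
    P.braceList x [P.tot.of e y] = P.preLie x y := by
  rw [P.preLie_eq (add_comm (∑ _v : Fin 1, e) d)]
  exact braceList_ofFn x (n := 1) (d := fun _ => e) fun _ => y

lemma braceList_nil {d : Bideg} (x : P.tot.obj d) : P.braceList x [] = P.tot.of d x := by
  have h : ∀ {D : Bideg} (hD : D = d + ∑ v : Fin 0, (Fin.elim0 v : Bideg)) (y),
      P.tot.of D (P.brace 0 d (fun v => Fin.elim0 v) D hD x y) = P.tot.of d x := by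
    intro D hD y
    obtain rfl : D = d := by simpa using hD
    congr 1
    funext L
    rw [← P.coeff_incl L D (P.brace _ _ _ _ _ _ _ _), incl_brace, Finset.Nat.antidiagonalTuple_one]
    simp only [List.ofFn_zero, Finset.sum_singleton]
    exact P.coeff_incl L D (x L)
  exact (braceList_ofFn x (n := 0) (d := fun v => Fin.elim0 v) fun v => Fin.elim0 v).trans (h _ _)

end Operad

section Multilinear

variable (X : BiMod.{u, v} R)

lemma evalList_eq_evalAll {d : Bideg} (f : (endOp X).tot.obj d) {l : List X.sum} {n : ℕ}
    (h : n = l.length) :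
    evalList X (fun n => (f n).1) l = evalAll X l ((endOp X).incl n d (f n)) := by
  rw [evalList_eq X _ h, evalAll_incl X _ h]

/-- Functions on lists that are homogeneous of degree one in each entry. -/
def IsMultiSMul (h : List X.sum → X.sum) : Prop :=
  ∀ (w r : List X.sum) (c : R) (a : X.sum), h (w ++ (c • a) :: r) = c • h (w ++ a :: r)

lemma evalList_isMultiSMul {d : Bideg} (f : (endOp X).tot.obj d) :
    IsMultiSMul X (evalList X fun n => (f n).1) := by
  intro w r c a
  rw [evalList_eq_evalAll X f (n := w.length + (r.length + 1)) (by simp),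
    evalList_eq_evalAll X f (n := w.length + (r.length + 1)) (by simp)]
  simpa using evalAll_append_cons X w r ((endOp X).incl (w.length + (r.length + 1)) d
    (f (w.length + (r.length + 1)))) c 0 a 0

variable {X}

lemma IsMultiSMul.cons {h : List X.sum → X.sum} (hh : IsMultiSMul X h) (b : X.sum) :
    IsMultiSMul X fun l => h (b :: l) :=
  fun w r c a => hh (b :: w) r c a

lemma IsMultiSMul.head {h : List X.sum → X.sum} (hh : IsMultiSMul X h) (c : R) (a : X.sum)
    (r : List X.sum) : h ((c • a) :: r) = c • h (a :: r) := hh [] r c a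

lemma IsMultiSMul.zero {h : List X.sum → X.sum} (hh : IsMultiSMul X h) (r : List X.sum) :
    h (0 :: r) = 0 := by simpa using hh.head 0 0 r

end Multilinear

lemma splitSum_eq_of_right {X Y : Type*} [AddCommMonoid Y] {φ : List X → List X → Y}
    (hφ : ∀ l b r, φ l (b :: r) = 0) (zs : List X) : splitSum φ zs = φ zs [] := by
  induction zs generalizing φ with
  | nil => rfl
  | cons z zs ih => rw [splitSum, hφ, zero_add, ih fun l b r => hφ _ b r]

/-- Inserting one operation in an operation that vanishes on lists of length at least `2`. -/
lemma weave_singleton_of_unary {X Y : Type*} [AddCommMonoid Y] {κ : Bideg → X → X}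
    (hκ : ∀ x, κ 0 x = x) (g : Bideg × (List X → X)) {h : List X → Y}
    (hh : ∀ a b l, h (a :: b :: l) = 0) (zs : List X) : weave κ [g] h zs = h [g.2 zs] := by
  cases zs with
  | nil => rfl
  | cons z zs =>
    rw [weave_cons_cons, splitSum_eq_of_right (fun l b r => hh _ _ _),
      weave_cons_congr (h' := fun _ => 0) _ _ _ (fun c l => hh _ _ _), weave_zero, add_zero,
      weave_nil, totalDeg_nil, funext hκ, List.map_id']

namespace Operad

variable (P : Operad.{u, v} R)

/-- The constant `μ` in arity `0` together with the map `z ↦ (-1) ^ ⟨z, μ⟩ b₁(z; μ)` in arity `1`.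
This is what has to be subtracted from `∑ₙ bₙ(μ; -)` to obtain the maps `M'`. -/
def right (e : Bideg) (μ : P.tot.obj e) : (endOp P.tot).tot.obj e
  | 0 => P.braceMap 0 e μ
  | 1 => P.rightMap e μ
  | _ + 2 => 0

variable {P}

lemma collect_primedMaps (e : Bideg) (μ : P.tot.obj e) :
    (endOp P.tot).collect e (P.primedMaps e μ) = P.braces μ - P.right e μ := by
  funext n
  match n with
  | 0 => exact (sub_self _).symm
  | 1 => rfl
  | n + 2 => exact (sub_zero (P.braceMap (n + 2) e μ)).symm

lemma braceList_isMultiSMul {d : Bideg} (x : P.tot.obj d) : IsMultiSMul P.tot (P.braceList x) :=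
  evalList_isMultiSMul P.tot (P.braces x)

/-- The operation on lists given by `P.right`. -/
def rightList (e : Bideg) (μ : P.tot.obj e) : List P.tot.sum → P.tot.sum :=
  evalList P.tot fun n => (P.right e μ n).1

lemma rightList_nil (e : Bideg) (μ : P.tot.obj e) : rightList e μ [] = P.tot.of e μ :=
  braceList_nil μ

lemma rightList_singleton (e : Bideg) (μ : P.tot.obj e) (a : P.tot.sum) :
    rightList e μ [a] = P.rightLin e μ a := rfl

lemma rightList_cons_cons (e : Bideg) (μ : P.tot.obj e) (a b : P.tot.sum) (l : List P.tot.sum) :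
    rightList e μ (a :: b :: l) = 0 := rfl

lemma rightLin_of_eq_preLie (e : Bideg) (μ : P.tot.obj e) {d : Bideg} (z : P.tot.obj d) :
    P.rightLin e μ (P.tot.of d z) = sgn R (pair d e) • P.preLie z μ := P.rightLin_of e μ d z

lemma sgn_mul_self (R : Type u) [CommRing R] (k : ℤ) : sgn R k * sgn R k = 1 := by
  rw [← sgn_add, sgn_even R ⟨k, rfl⟩]

lemma pair_comm (x y : Bideg) : pair x y = pair y x := by simp only [pair]; ring

lemma pair_add_left (x y z : Bideg) : pair (x + y) z = pair x z + pair y z := by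
  simp [pair]; ring

/-- Inserting `P.right e μ` in `h`, that is, `μ` between two of the arguments `z` or
`± b₁(z; μ)` in place of one of them, amounts up to a sign to inserting all the operations
`b(z; -)` in `h`, with `μ` as the only argument. -/
lemma weave_right (e : Bideg) (μ : P.tot.obj e) (zs : List (Σ d, P.tot.obj d))
    {h : List P.tot.sum → P.tot.sum} (hh : IsMultiSMul P.tot h) :
    weave (fun q => P.tot.koszul q) [(e, rightList e μ)] h (zs.map fun z => P.tot.of z.1 z.2) =
      sgn R (pair (totalDeg (zs.map fun z => (z.1, P.braceList z.2))) e) •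
        weave (fun q => P.tot.koszul q) (zs.map fun z => (z.1, P.braceList z.2)) h
          [P.tot.of e μ] := by
  induction zs generalizing h with
  | nil =>
    simp only [List.map_nil, weave_cons_nil, weave_nil, rightList_nil, totalDeg_nil]
    rw [sgn_even R (by simp [pair]), one_smul]
  | cons z zs ih =>
    obtain ⟨d, z⟩ := z
    have hsplit : splitSum (fun l r => h (rightList e μ (P.tot.of d z :: l) :: r))
        (zs.map fun z => P.tot.of z.1 z.2) =
        h (rightList e μ [P.tot.of d z] :: zs.map fun z => P.tot.of z.1 z.2) := by
      rw [splitSum_eq_of_length (a := 0)]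
      · simp
      · intro l r hl
        obtain ⟨b, l, rfl⟩ := List.exists_cons_of_ne_nil (mt List.length_eq_zero_iff.2 hl)
        rw [rightList_cons_cons, hh.zero]
    have hnil : (zs.map fun z => (z.1, P.braceList z.2)).map (fun g => g.2 []) =
        zs.map fun z => P.tot.of z.1 z.2 := by
      rw [List.map_map]
      exact List.map_congr_left fun z _ => braceList_nil z.2
    have hb : ∀ c : R, P.braceList z [c • P.tot.of e μ] = c • P.preLie z μ := fun c => by
      rw [← braceList_singleton]
      exact (braceList_isMultiSMul z).head c _ []
    have hκ : ∀ l : List P.tot.sum, l.map (P.tot.koszul 0) = l := fun l => by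
      rw [funext P.tot.koszul_zero]
      exact List.map_id' l
    simp only [List.map_cons, weave_cons_cons, splitSum, weave_args_nil, totalDeg_cons,
      totalDeg_nil, weave_nil, List.map_nil, hκ, hsplit]
    simp only [hnil, braceList_nil, P.tot.koszul_of, hb, hh.head, add_zero, rightList_nil,
      rightList_singleton, weave_smul, ih (hh.cons _)]
    rw [rightLin_of_eq_preLie, hh.head, pair_add_left, sgn_add, pair_comm e d]
    have h1 := sgn_mul_self R (pair d e)
    have h2 := sgn_mul_self R (pair (totalDeg (zs.map fun z => (z.1, P.braceList z.2))) e)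
    simp only [smul_add, smul_smul]
    rw [mul_assoc _ _ (sgn R (pair (totalDeg _) e)), h2, mul_mul_mul_comm, h1, h2, mul_one, mul_one,
      one_smul]
    abel

/-- The elements `∑ₙ bₙ(y; -)` and `P.right e μ` commute in the graded sense: evaluated on
arguments, this is the brace relation for `b₁(bₙ(y; -); μ)`. -/
lemma preLie_right_braces {d e : Bideg} (μ : P.tot.obj e) (y : P.tot.obj d) :
    (endOp P.tot).preLie (P.right e μ) (P.braces y) =
      sgn R (pair d e) • (endOp P.tot).preLie (P.braces y) (P.right e μ) := by
  have hD : e + d = d + ∑ _v : Fin 1, e := by rw [add_comm]; simp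
  rw [Operad.preLie_eq _ hD, Operad.preLie_eq _ (show e + d = e + ∑ _v : Fin 1, d by simp),
    ← map_smul]
  congr 1
  funext n
  refine endOp_ext fun f z => ?_
  let zs : List (Σ d, P.tot.obj d) := List.ofFn fun v => ⟨f v, z v⟩
  have h1 : (List.ofFn fun v => P.tot.of (f v) (z v)) = zs.map fun z => P.tot.of z.1 z.2 := by
    simp only [zs, List.map_ofFn]
    rfl
  have h2 : (List.ofFn fun v => (f v, P.braceList (z v))) =
      zs.map fun z => (z.1, P.braceList z.2) := by
    simp only [zs, List.map_ofFn]
    rfl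
  have h3 : totalDeg (zs.map fun z => (z.1, P.braceList z.2)) = ∑ v, f v := by
    rw [← h2, totalDeg_ofFn]
  rw [brace_endOp]
  change weave _ [(d, P.braceList y)] (rightList e μ) _ =
    sgn R (pair d e) • ((endOp P.tot).brace 1 d (fun _ => e) (e + d) hD (P.braces y)
      (fun _ => P.right e μ) n).1 fun v => P.tot.of (f v) (z v)
  rw [brace_endOp]
  change _ = sgn R (pair d e) • weave _ [(e, rightList e μ)] (P.braceList y) _
  rw [weave_singleton_of_unary P.tot.koszul_zero _ (rightList_cons_cons e μ)]
  dsimp only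
  rw [braceList_ofFn, rightList_singleton, rightLin_of_eq_preLie, ← braceList_singleton, h1,
    weave_right e μ zs (braceList_isMultiSMul y), h3, smul_smul, ← sgn_add,
    pair_add_left, add_comm (pair d e)]
  congr 1
  have := braceList_brace (add_comm (∑ v, f v) d) y z (n := 1) (e := fun _ => e) (fun _ => μ)
  rw [h2] at this
  exact this

end Operad

/-! ### The Maurer–Cartan equation -/

open Finset.HasAntidiagonal (antidiagonal mem_antidiagonal)

namespace Operad

variable (P : Operad.{u, v} R)

/-- The map `x ↦ ∑ₙ bₙ(x; -)` in bidegree `d`, as a linear map. -/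
def bracesLin (d : Bideg) : P.tot.obj d →ₗ[R] (endOp P.tot).tot.obj d :=
  LinearMap.pi fun n => P.braceMap n d

variable {P}

lemma lmap_braces_preLie {d e : Bideg} (x : P.tot.obj d) (y : P.tot.obj e) :
    DirectSum.lmap P.bracesLin (P.preLie x y) =
      (endOp P.tot).preLie (P.braces x) (P.braces y) := by
  have h : d + e = d + ∑ _v : Fin 1, e := by simp
  rw [P.preLie_eq h, Operad.preLie_eq _ h, ← braces_brace]
  exact DirectSum.lmap_lof _ _ _

/-- The Maurer–Cartan equation `∑_{i + p = u} (-1) ^ p b₁(μ_i; μ_p) = 0`, for all `u`, for a family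
of elements of bidegrees `(i, 1 - i)`. In `𝔰P`, it is the family of derived `A_∞`-relations. -/
def IsMC (P : Operad.{u, v} R) (μ : ∀ i : ℕ, P.tot.obj ((i : ℤ), 1 - (i : ℤ))) : Prop :=
  ∀ u : ℕ, ∑ x ∈ antidiagonal u, sgn R (x.2 : ℤ) • P.preLie (μ x.1) (μ x.2) = 0

/-- The Koszul sign of exchanging `μ_i` and `μ_p` depends on `i + p` only. -/
lemma pair_MC {x : ℕ × ℕ} {u : ℕ} (hx : x ∈ antidiagonal u) :
    sgn R (pair ((x.1 : ℤ), 1 - (x.1 : ℤ)) ((x.2 : ℤ), 1 - (x.2 : ℤ))) = sgn R (1 + u) := by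
  rw [mem_antidiagonal] at hx
  apply sgn_congr
  rw [← hx]
  exact ⟨x.1 * x.2 - x.1 - x.2, by simp only [pair]; push_cast; ring⟩

lemma sgn_swap {x : ℕ × ℕ} {u : ℕ} (hx : x ∈ antidiagonal u) :
    sgn R (x.1 : ℤ) = sgn R u * sgn R (x.2 : ℤ) := by
  rw [mem_antidiagonal] at hx
  rw [← sgn_add]
  apply sgn_congr
  rw [← hx]
  exact ⟨-x.2, by push_cast; ring⟩

lemma sum_antidiagonal_swap_sgn {M : Type*} [AddCommGroup M] [Module R M] (u : ℕ)
    (f : ℕ → ℕ → M) :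
    ∑ x ∈ antidiagonal u, sgn R (x.2 : ℤ) • f x.2 x.1 =
      sgn R u • ∑ x ∈ antidiagonal u, sgn R (x.2 : ℤ) • f x.1 x.2 := by
  rw [← Finset.Nat.sum_antidiagonal_swap, Finset.smul_sum]
  refine Finset.sum_congr rfl fun x hx => ?_
  rw [smul_smul, ← sgn_swap hx]
  rfl

/-- Evaluation on a list of arguments. -/
def evalTot (X : BiMod.{u, v} R) (l : List X.sum) : (endOp X).tot.sum →ₗ[R] X.sum :=
  DirectSum.toModule R Bideg X.sum fun _ =>
    { toFun := fun f => evalList X (fun n => (f n).1) l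
      map_add' := fun _ _ => rfl
      map_smul' := fun _ _ => rfl }

lemma evalTot_of (X : BiMod.{u, v} R) (l : List X.sum) {d : Bideg} (f : (endOp X).tot.obj d) :
    evalTot X l ((endOp X).tot.of d f) = evalList X (fun n => (f n).1) l :=
  DirectSum.toModule_lof R d f

lemma evalTot_preLie (X : BiMod.{u, v} R) {d e : Bideg} (f : (endOp X).tot.obj d)
    (g : (endOp X).tot.obj e) (l : List X.sum) :
    evalTot X l ((endOp X).preLie f g) =
      weave (fun q => X.koszul q) [(e, evalList X fun n => (g n).1)] (evalList X fun n => (f n).1)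
        l := by
  rw [Operad.preLie_eq _ (show d + e = d + ∑ _v : Fin 1, e by simp), evalTot_of]
  obtain ⟨n, z, rfl⟩ : ∃ n, ∃ z : Fin n → X.sum, l = List.ofFn z :=
    ⟨_, _, (List.ofFn_get l).symm⟩
  rw [evalList_ofFn, brace_endOp]
  rfl

/-- A homogeneous element of the endomorphism operad is determined by its values. -/
lemma eq_zero_of_evalTot (X : BiMod.{u, v} R) {c : Bideg} {a : (endOp X).tot.sum}
    (ha : a ∈ LinearMap.range ((endOp X).tot.of c))
    (h : ∀ (n : ℕ) (e : Fin n → Bideg) (z : ∀ v, X.obj (e v)),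
      evalTot X (List.ofFn fun v => X.of (e v) (z v)) a = 0) : a = 0 := by
  obtain ⟨f, rfl⟩ := ha
  rw [show f = 0 from funext fun n => endOp_ext fun e z => by
    rw [← evalList_ofFn X (fun n => (f n).1), ← evalTot_of, h]; rfl, map_zero]

lemma preLie_mem (P : Operad.{u, v} R) {d e D : Bideg} (hD : D = d + e) (x : P.tot.obj d)
    (y : P.tot.obj e) : P.preLie x y ∈ LinearMap.range (P.tot.of D) := by
  rw [P.preLie_eq (show D = d + ∑ _v : Fin 1, e by simp [hD])]
  exact ⟨_, rfl⟩

variable {μ : ∀ i : ℕ, P.tot.obj ((i : ℤ), 1 - (i : ℤ))}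

lemma IsMC.swap (hμ : IsMC P μ) (u : ℕ) :
    ∑ x ∈ antidiagonal u, sgn R (x.2 : ℤ) • P.preLie (μ x.2) (μ x.1) = 0 := by
  rw [sum_antidiagonal_swap_sgn u fun i p => P.preLie (μ i) (μ p), hμ u, smul_zero]

/-- The brace relation for `b₁(b₁(z; μ); ν)`. -/
lemma rightLin_rightLin {d e e' : Bideg} (z : P.tot.obj d) (μ : P.tot.obj e) (ν : P.tot.obj e') :
    P.rightLin e' ν (P.rightLin e μ (P.tot.of d z)) =
      (sgn R (pair d (e + e')) * sgn R (pair e e')) •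
        (P.braceList z [P.tot.of e μ, P.tot.of e' ν] + P.braceList z [P.preLie μ ν] +
          sgn R (pair e e') • P.braceList z [P.tot.of e' ν, P.tot.of e μ]) := by
  have h := braceList_brace (show d + e = d + ∑ _v : Fin 1, e by simp) z (fun _ => μ) (n := 1)
    (e := fun _ => e') fun _ => ν
  have h1 : weave (fun q => P.tot.koszul q) [(e, P.braceList μ)] (P.braceList z)
      [P.tot.of e' ν] = P.braceList z [P.tot.of e μ, P.tot.of e' ν] +
        P.braceList z [P.preLie μ ν] +
          sgn R (pair e e') • P.braceList z [P.tot.of e' ν, P.tot.of e μ] := by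
    simp only [weave_cons_cons, splitSum, weave_nil, weave_cons_nil, totalDeg_nil, braceList_nil,
      List.map_nil, List.map_cons, P.tot.koszul_zero, add_zero]
    rw [braceList_singleton, P.tot.koszul_of, (braceList_isMultiSMul z).head]
  rw [← h1, rightLin_of_eq_preLie, map_smul, P.preLie_eq (show d + e = d + ∑ _v : Fin 1, e by simp),
    rightLin_of_eq_preLie, ← braceList_singleton, smul_smul, ← sgn_add, ← sgn_add]
  congr 1
  · congr 1
    simp [pair]; ring

/-- The elements `P.right _ (μ i)` satisfy the Maurer–Cartan equation as well. In arity `0` this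
is the equation for `μ`. In arity `1` the brace relation produces the sum for `μ`, inserted in
the argument `z`, and the terms `b₂(z; μ_i, μ_p)`, which cancel in pairs. -/
lemma sum_preLie_right (hμ : IsMC P μ) (u : ℕ) :
    ∑ x ∈ antidiagonal u, sgn R (x.2 : ℤ) •
      (endOp P.tot).preLie (P.right _ (μ x.1)) (P.right _ (μ x.2)) = 0 := by
  refine eq_zero_of_evalTot P.tot (c := ((u : ℤ), 2 - (u : ℤ))) ?_ fun n e z => ?_
  · refine Submodule.sum_mem _ fun x hx => Submodule.smul_mem _ _ (preLie_mem _ ?_ _ _)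
    rw [mem_antidiagonal] at hx
    rw [← hx]
    ext
    · simp
    · simp; ring
  · have hw : ∀ x : ℕ × ℕ, ∀ l, evalTot P.tot l (sgn R (x.2 : ℤ) •
        (endOp P.tot).preLie (P.right _ (μ x.1)) (P.right _ (μ x.2))) =
          sgn R (x.2 : ℤ) • rightList _ (μ x.1) [rightList _ (μ x.2) l] := fun x l => by
      rw [map_smul, evalTot_preLie]
      exact congrArg _ (weave_singleton_of_unary P.tot.koszul_zero _ (rightList_cons_cons _ _) _)
    rw [map_sum, Finset.sum_congr rfl fun x _ => hw x _]
    match n, e, z with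
    | 0, e, z =>
      refine Eq.trans ?_ ((congrArg (sgn R (1 + (u : ℤ)) • ·) (hμ.swap u)).trans (smul_zero _))
      simp only [Finset.smul_sum]
      refine Finset.sum_congr rfl fun x hx => ?_
      rw [List.ofFn_zero, rightList_nil, rightList_singleton, rightLin_of_eq_preLie, pair_comm,
        pair_MC hx, smul_comm]
    | 1, e, z =>
      have hsum : ∀ x ∈ antidiagonal u, sgn R (x.2 : ℤ) •
          rightList _ (μ x.1) [rightList _ (μ x.2) [P.tot.of (e 0) (z 0)]] =
          (sgn R (pair (e 0) ((u : ℤ), 2 - (u : ℤ))) * sgn R (1 + u)) • (sgn R (x.2 : ℤ) •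
            P.braceList (z 0) [P.tot.of _ (μ x.2), P.tot.of _ (μ x.1)] +
            P.braceList (z 0) [sgn R (x.2 : ℤ) • P.preLie (μ x.2) (μ x.1)] +
            sgn R (1 + u) • sgn R (x.2 : ℤ) •
              P.braceList (z 0) [P.tot.of _ (μ x.1), P.tot.of _ (μ x.2)]) := by
        intro x hx
        have hdeg : ((x.2 : ℤ), 1 - (x.2 : ℤ)) + ((x.1 : ℤ), 1 - (x.1 : ℤ)) =
            ((u : ℤ), 2 - (u : ℤ)) := by
          rw [mem_antidiagonal] at hx
          rw [← hx]
          ext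
          · simp; ring
          · simp; ring
        rw [rightList_singleton, rightList_singleton, rightLin_rightLin, pair_comm
          ((x.2 : ℤ), 1 - (x.2 : ℤ)), pair_MC hx, hdeg, smul_comm,
          (braceList_isMultiSMul _).head]
        simp only [smul_add]
        rw [smul_comm (sgn R (x.2 : ℤ)) (sgn R (1 + (u : ℤ)))]
      have hlin : ∑ x ∈ antidiagonal u,
          P.braceList (z 0) [sgn R (x.2 : ℤ) • P.preLie (μ x.2) (μ x.1)] = 0 := by
        have : ∀ a : P.tot.sum, P.braceList (z 0) [a] =
            (P.braces (z 0) 1).1.toLinearMap (fun _ => 0) 0 a := fun a => by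
          rw [MultilinearMap.toLinearMap_apply]
          change (P.braces (z 0) 1).1 _ = _
          refine congrArg (P.braces (z 0) 1).1 (funext fun i : Fin 1 => ?_)
          rw [Subsingleton.elim i 0, Function.update_self]
          rfl
        simp only [this]
        rw [← map_sum, hμ.swap u, map_zero]
      rw [show (List.ofFn fun v => P.tot.of (e v) (z v)) = [P.tot.of (e 0) (z 0)] from rfl,
        Finset.sum_congr rfl hsum, ← Finset.smul_sum, Finset.sum_add_distrib,
        Finset.sum_add_distrib, hlin, add_zero, sum_antidiagonal_swap_sgn u fun i p =>
          P.braceList (z 0) [P.tot.of _ (μ i), P.tot.of _ (μ p)], ← Finset.smul_sum, sgn_add]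
      rw [show sgn R 1 = -1 by simp [sgn]]
      simp
    | n + 2, e, z =>
      refine Finset.sum_eq_zero fun x _ => ?_
      rw [List.ofFn_succ, List.ofFn_succ, rightList_cons_cons, rightList_singleton, map_zero,
        smul_zero]

lemma preLie_sub_sub {d e : Bideg} (x x' : P.tot.obj d) (y y' : P.tot.obj e) :
    P.preLie (x - x') (y - y') =
      P.preLie x y - P.preLie x y' - (P.preLie x' y - P.preLie x' y') := by
  rw [map_sub P.preLie, LinearMap.sub_apply, map_sub (P.preLie x), map_sub (P.preLie x')]

/-- The elements `∑_{j ≥ 1} M'_{ij}` satisfy the same equation as the elements `μ_i`. Each of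
them is the difference of `∑ₙ bₙ(μ_i; -)` and `P.right _ (μ i)`; these satisfy the equation
separately, and the mixed terms cancel because they commute. -/
theorem IsMC.primedMaps (hμ : IsMC P μ) :
    IsMC (endOp P.tot) fun i => (endOp P.tot).collect _ (P.primedMaps _ (μ i)) := by
  intro u
  have h1 : ∑ x ∈ antidiagonal u, sgn R (x.2 : ℤ) •
      (endOp P.tot).preLie (P.braces (μ x.1)) (P.braces (μ x.2)) = 0 := by
    rw [← map_zero (DirectSum.lmap P.bracesLin), ← hμ u, map_sum]
    refine Finset.sum_congr rfl fun x _ => ?_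
    rw [map_smul, lmap_braces_preLie]
  have h2 : ∑ x ∈ antidiagonal u, sgn R (x.2 : ℤ) •
      (endOp P.tot).preLie (P.right _ (μ x.1)) (P.braces (μ x.2)) =
      -∑ x ∈ antidiagonal u, sgn R (x.2 : ℤ) •
      (endOp P.tot).preLie (P.braces (μ x.1)) (P.right _ (μ x.2)) := by
    have : ∀ x ∈ antidiagonal u, sgn R (x.2 : ℤ) •
        (endOp P.tot).preLie (P.right _ (μ x.1)) (P.braces (μ x.2)) =
        sgn R (1 + (u : ℤ)) • sgn R (x.2 : ℤ) •
          (endOp P.tot).preLie (P.braces (μ x.2)) (P.right _ (μ x.1)) := fun x hx => by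
      rw [preLie_right_braces, pair_comm, pair_MC hx, smul_comm]
    rw [Finset.sum_congr rfl this, ← Finset.smul_sum, sum_antidiagonal_swap_sgn u fun i p =>
      (endOp P.tot).preLie (P.braces (μ i)) (P.right _ (μ p)), smul_smul, sgn_add, mul_assoc,
      sgn_mul_self, show sgn R 1 = -1 by simp [sgn]]
    simp
  have h3 : ∀ x : ℕ × ℕ, sgn R (x.2 : ℤ) • (endOp P.tot).preLie
      ((endOp P.tot).collect _ (P.primedMaps _ (μ x.1)))
      ((endOp P.tot).collect _ (P.primedMaps _ (μ x.2))) =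
      sgn R (x.2 : ℤ) • (endOp P.tot).preLie (P.braces (μ x.1)) (P.braces (μ x.2)) -
      sgn R (x.2 : ℤ) • (endOp P.tot).preLie (P.braces (μ x.1)) (P.right _ (μ x.2)) -
      (sgn R (x.2 : ℤ) • (endOp P.tot).preLie (P.right _ (μ x.1)) (P.braces (μ x.2)) -
      sgn R (x.2 : ℤ) • (endOp P.tot).preLie (P.right _ (μ x.1)) (P.right _ (μ x.2))) :=
    fun x => by
      rw [collect_primedMaps, collect_primedMaps, preLie_sub_sub, smul_sub, smul_sub, smul_sub]
  rw [Finset.sum_congr rfl fun x _ => h3 x, Finset.sum_sub_distrib, Finset.sum_sub_distrib,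
    Finset.sum_sub_distrib, h1, h2, sum_preLie_right hμ]
  abel

end Operad

/-! ### Compatibility with arities, suspensions and maps of operads -/

namespace Operad

variable (P : Operad.{u, v} R)

lemma incl_injective {n : ℕ} {d : Bideg} : Function.Injective (P.incl n d) :=
  Function.LeftInverse.injective (g := P.coeff n d) (P.coeff_incl n d)

/-- The component of arity `L`, as an element of the direct sum of all components. -/
def slice (L : ℕ) : P.tot.sum →ₗ[R] P.All :=
  DirectSum.toModule R Bideg P.All fun d => P.incl L d ∘ₗ LinearMap.proj L

@[simp] lemma slice_of (L : ℕ) (d : Bideg) (x : P.tot.obj d) :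
    P.slice L (P.tot.of d x) = P.incl L d (x L) :=
  DirectSum.toModule_lof R d x

lemma coeff_slice (L : ℕ) (d : Bideg) (a : P.tot.sum) : P.coeff L d (P.slice L a) = a d L := by
  induction a using DirectSum.induction_on with
  | zero =>
    rw [map_zero, map_zero]
    rfl
  | of e x =>
    refine (congrArg _ (P.slice_of L e x)).trans ?_
    by_cases h : d = e
    · subst h
      rw [coeff_incl]
      exact congrFun (DirectSum.of_eq_same d x).symm L
    · rw [P.coeff_incl_of_ne fun h' => h h'.2]
      exact congrFun (DirectSum.of_eq_of_ne (β := P.tot.obj) e d x h).symm L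
  | add a b ha hb =>
    rw [map_add, map_add, ha, hb]
    rfl

variable {P} in
lemma ext_slice {a b : P.tot.sum} (h : ∀ L, P.slice L a = P.slice L b) : a = b :=
  DFinsupp.ext fun d => funext fun L => by rw [← coeff_slice, h, coeff_slice]

lemma slice_preLie (L : ℕ) {d e : Bideg} (x : P.tot.obj d) (y : P.tot.obj e) :
    P.slice L (P.preLie x y) = ∑ c ∈ antidiagonal (L + 1), ∑ i ∈ Finset.range c.1,
      P.ins i (P.incl c.1 d (x c.1)) (P.incl c.2 e (y c.2)) := by
  rw [P.preLie_eq (show d + e = d + ∑ _v : Fin 1, e by simp), slice_of, incl_brace,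
    Finset.Nat.antidiagonalTuple_two, Finset.sum_map]
  refine Finset.sum_congr rfl fun c _ => ?_
  change P.insList [P.incl c.2 e (y c.2)] 0 (P.incl c.1 d (x c.1)) = _
  rw [insList_cons_incl]
  simp only [step_incl, insList_nil]
  rw [Finset.range_eq_Ico]

/-- A family of elements of an operad satisfies the derived `A_∞`-relations; `f i n` is `m_{i,n+1}`.
The degrees `d` are arbitrary, since those that occur are only propositionally equal. -/
def SatisfiesRelations {d : ℕ → ℕ → Bideg} (f : ∀ i n : ℕ, P.obj (n + 1) (d i n)) : Prop :=
  ∀ u w : ℕ, ∑ x ∈ antidiagonal u, ∑ c ∈ antidiagonal w, ∑ r ∈ Finset.range (c.1 + 1),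
    sgn R (relSign r (c.2 + 1) (c.1 - r) x.2 (c.1 + 1)) •
      P.ins r (P.incl (c.1 + 1) _ (f x.1 c.1)) (P.incl (c.2 + 1) _ (f x.2 c.2)) = 0

/-- The equation `IsMC`, arity by arity. -/
lemma isMC_collect_iff (f : ∀ i n : ℕ, P.obj (n + 1) ((i : ℤ), 1 - (i : ℤ))) :
    IsMC P (fun i => P.collect _ (f i)) ↔ ∀ u w : ℕ,
      ∑ x ∈ antidiagonal u, ∑ c ∈ antidiagonal w, ∑ r ∈ Finset.range (c.1 + 1),
        sgn R (x.2 : ℤ) •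
          P.ins r (P.incl (c.1 + 1) _ (f x.1 c.1)) (P.incl (c.2 + 1) _ (f x.2 c.2)) = 0 := by
  have h0 : ∀ i : ℕ × ℕ, P.slice 0 (P.preLie (P.collect _ (f i.1)) (P.collect _ (f i.2))) = 0 := by
    intro i
    rw [slice_preLie, Finset.Nat.sum_antidiagonal_succ, Finset.Nat.antidiagonal_zero]
    simp [collect]
  have h1 : ∀ (i : ℕ × ℕ) (w : ℕ),
      P.slice (w + 1) (P.preLie (P.collect _ (f i.1)) (P.collect _ (f i.2))) =
      ∑ c ∈ antidiagonal w, ∑ r ∈ Finset.range (c.1 + 1),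
        P.ins r (P.incl (c.1 + 1) _ (f i.1 c.1)) (P.incl (c.2 + 1) _ (f i.2 c.2)) := by
    intro i w
    rw [slice_preLie, Finset.Nat.sum_antidiagonal_succ, Finset.Nat.sum_antidiagonal_succ']
    simp [collect]
  have h2 : ∀ u w : ℕ, P.slice (w + 1) (∑ x ∈ antidiagonal u, sgn R (x.2 : ℤ) •
      P.preLie (P.collect _ (f x.1)) (P.collect _ (f x.2))) =
      ∑ x ∈ antidiagonal u, ∑ c ∈ antidiagonal w, ∑ r ∈ Finset.range (c.1 + 1),
        sgn R (x.2 : ℤ) •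
          P.ins r (P.incl (c.1 + 1) _ (f x.1 c.1)) (P.incl (c.2 + 1) _ (f x.2 c.2)) := by
    intro u w
    rw [map_sum]
    refine Finset.sum_congr rfl fun x _ => ?_
    rw [map_smul, h1]
    simp only [Finset.smul_sum]
  constructor
  · intro h u w
    rw [← h2, h u, map_zero]
  · intro h u
    refine ext_slice fun L => ?_
    rw [map_zero]
    match L with
    | 0 =>
      rw [map_sum]
      refine Finset.sum_eq_zero fun x _ => ?_
      rw [map_smul, h0, smul_zero]
    | w + 1 => rw [h2, h u w]

/-- The identity of `𝔰P` to `P`, on the direct sums of all components. -/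
def unsusp : (susp P).All →ₗ[R] P.All :=
  (susp P).lift fun n d => P.incl n (d.1, d.2 - ((n : ℤ) - 1))

@[simp] lemma unsusp_incl (n : ℕ) (d : Bideg) (x : (susp P).obj n d) :
    P.unsusp ((susp P).incl n d x) = P.incl n (d.1, d.2 - ((n : ℤ) - 1)) x :=
  (susp P).lift_incl _ n d x

lemma unsusp_injective : Function.Injective P.unsusp := by
  have h : ∀ a : (susp P).All, ∀ n d, P.coeff n (d.1, d.2 - ((n : ℤ) - 1)) (P.unsusp a) =
      (susp P).coeff n d a := fun a n d => by
    induction a using all_induction with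
    | zero => simp
    | incl m e x =>
      rw [unsusp_incl]
      by_cases hne : n = m ∧ d = e
      · obtain ⟨rfl, rfl⟩ := hne
        rw [coeff_incl]
        exact ((susp P).coeff_incl n d x).symm
      · rw [coeff_incl_of_ne _ hne, coeff_incl_of_ne]
        rintro ⟨rfl, h⟩
        refine hne ⟨rfl, ?_⟩
        rw [Prod.mk.injEq] at h
        exact Prod.ext h.1 (by linarith [h.2])
    | add a b ha hb => rw [map_add, map_add, map_add, ha, hb]
  intro a b hab
  refine DFinsupp.ext fun nd => ?_
  exact (h a nd.1 nd.2).symm.trans ((congrArg _ hab).trans (h b nd.1 nd.2))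

lemma unsusp_ins (r : ℕ) {n m : ℕ} {p q : Bideg} (x : (susp P).obj n p) (y : (susp P).obj m q) :
    P.unsusp ((susp P).ins r ((susp P).incl n p x) ((susp P).incl m q y)) =
      sgn R (((n : ℤ) - 1) * (q.2 - ((m : ℤ) - 1)) + ((n : ℤ) - 1 - r) * ((m : ℤ) - 1)) •
        P.ins r (P.incl n (p.1, p.2 - ((n : ℤ) - 1)) x)
          (P.incl m (q.1, q.2 - ((m : ℤ) - 1)) y) := by
  by_cases hr : r < n
  · have hk : n + m - 1 + 1 = n + m := by omega
    rw [ins_incl _ hk rfl ⟨r, hr⟩, unsusp_incl, P.ins_incl hk (susp_deg hk rfl) ⟨r, hr⟩, ← map_smul]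
    rfl
  · rw [ins_incl_of_le _ (not_lt.1 hr), ins_incl_of_le _ (not_lt.1 hr), map_zero, smul_zero]

/-- The derived `A_∞`-relations for a family are the equation `IsMC` in the suspension: the sign of
an insertion in `𝔰P` turns `(-1) ^ p` into `(-1) ^ (r q + t + p j)`. -/
theorem isMC_susp_collect_iff
    (f : ∀ i n : ℕ, (susp P).obj (n + 1) ((i : ℤ), 1 - (i : ℤ))) :
    IsMC (susp P) (fun i => (susp P).collect _ (f i)) ↔
      P.SatisfiesRelations
        (d := fun i n => ((i : ℤ), 1 - (i : ℤ) - (((n + 1 : ℕ) : ℤ) - 1))) f := by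
  rw [isMC_collect_iff]
  refine forall_congr' fun u => forall_congr' fun w => ?_
  rw [← P.unsusp_injective.eq_iff, map_zero, map_sum]
  refine Eq.congr_left (Finset.sum_congr rfl fun x _ => ?_)
  rw [map_sum]
  refine Finset.sum_congr rfl fun c _ => ?_
  rw [map_sum]
  refine Finset.sum_congr rfl fun r hr => ?_
  rw [map_smul, unsusp_ins, smul_smul, ← sgn_add]
  congr 1
  apply sgn_congr
  have h : ((c.1 - r : ℕ) : ℤ) = c.1 - r := by
    rw [Finset.mem_range] at hr
    omega
  simp only [relSign, h]
  push_cast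
  exact ⟨-(c.1 * x.2) - r * c.2, by ring⟩

section Map

variable {P} {Q : Operad.{u, v} R} (φ : ∀ n d, P.obj n d →ₗ[R] Q.obj n d)

/-- The map of underlying bigraded modules given by maps of the components. -/
def totMap (d : Bideg) : P.tot.obj d →ₗ[R] Q.tot.obj d :=
  LinearMap.pi fun n => φ n d ∘ₗ LinearMap.proj n

lemma lmap_totMap_of {d : Bideg} (x : P.tot.obj d) :
    DirectSum.lmap (totMap φ) (P.tot.of d x) = Q.tot.of d (totMap φ d x) :=
  DirectSum.lmap_lof _ _ _

lemma totMap_collect (e : Bideg) (f : ∀ n, P.obj (n + 1) e) :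
    totMap φ e (P.collect e f) = Q.collect e fun n => φ (n + 1) e (f n) := by
  funext n
  cases n with
  | zero => exact map_zero (φ 0 e)
  | succ n => rfl

/-- The map of direct sums of all components given by maps of the components. -/
def allMap : P.All →ₗ[R] Q.All := P.lift fun n d => Q.incl n d ∘ₗ φ n d

@[simp] lemma allMap_incl (n : ℕ) (d : Bideg) (x : P.obj n d) :
    allMap φ (P.incl n d x) = Q.incl n d (φ n d x) := P.lift_incl _ n d x

/-- The maps of the components are compatible with insertions. -/
def CommutesWithComp : Prop :=
  ∀ {n m k : ℕ} {p q r : Bideg} (hk : k + 1 = n + m) (hr : r = p + q) (i : Fin n)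
    (x : P.obj n p) (y : P.obj m q),
      φ k r (P.comp hk hr i x y) = Q.comp hk hr i (φ n p x) (φ m q y)

variable {φ}

lemma allMap_ins (hφ : CommutesWithComp φ) (i : ℕ) {n m : ℕ} {p q : Bideg}
    (x : P.obj n p) (y : P.obj m q) :
    allMap φ (P.ins i (P.incl n p x) (P.incl m q y)) =
      Q.ins i (Q.incl n p (φ n p x)) (Q.incl m q (φ m q y)) := by
  by_cases hi : i < n
  · have hk : n + m - 1 + 1 = n + m := by omega
    rw [P.ins_incl hk rfl ⟨i, hi⟩, allMap_incl, hφ, ← Q.ins_incl]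
  · rw [P.ins_incl_of_le (not_lt.1 hi), Q.ins_incl_of_le (not_lt.1 hi), map_zero]

lemma allMap_insList (hφ : CommutesWithComp φ) (ys : List P.All) (k : ℕ) (x : P.All) :
    allMap φ (P.insList ys k x) = Q.insList (ys.map (allMap φ)) k (allMap φ x) := by
  induction ys generalizing k x with
  | nil => rfl
  | cons y ys ih =>
    induction x using all_induction with
    | zero => simp
    | incl n d x =>
      rw [List.map_cons, allMap_incl, insList_cons_incl, insList_cons_incl, map_sum]
      refine Finset.sum_congr rfl fun i _ => ?_
      induction y using all_induction with
      | zero => simp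
      | incl m e y => rw [allMap_incl, step_incl, step_incl, ih, allMap_ins hφ]
      | add y y' hy hy' => simp only [map_add, LinearMap.add_apply, hy, hy']
    | add x x' hx hx' => rw [map_add, map_add, map_add, map_add, hx, hx']

/-- Maps compatible with insertions are compatible with braces. -/
lemma totMap_brace (hφ : CommutesWithComp φ) {j : ℕ} {d₀ : Bideg} {d : Fin j → Bideg} {D : Bideg}
    (hD : D = d₀ + ∑ v, d v) (x : P.tot.obj d₀) (y : ∀ v, P.tot.obj (d v)) :
    totMap φ D (P.brace j d₀ d D hD x y) =
      Q.brace j d₀ d D hD (totMap φ d₀ x) fun v => totMap φ (d v) (y v) := by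
  funext L
  apply Q.incl_injective
  rw [incl_brace]
  change Q.incl L D (φ L D (P.brace j d₀ d D hD x y L)) = _
  rw [← allMap_incl, incl_brace, map_sum]
  refine Finset.sum_congr rfl fun c _ => ?_
  rw [allMap_insList hφ, allMap_incl, List.map_ofFn]
  congr 2
  exact congrArg List.ofFn (funext fun v => allMap_incl φ _ _ _)

lemma lmap_totMap_preLie (hφ : CommutesWithComp φ) {d e : Bideg} (x : P.tot.obj d)
    (y : P.tot.obj e) :
    DirectSum.lmap (totMap φ) (P.preLie x y) = Q.preLie (totMap φ d x) (totMap φ e y) := by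
  have h : d + e = d + ∑ _v : Fin 1, e := by simp
  rw [P.preLie_eq h, Q.preLie_eq h, lmap_totMap_of, totMap_brace hφ]

/-- Maps compatible with insertions preserve solutions of `IsMC`. -/
lemma IsMC.map (hφ : CommutesWithComp φ)
    {μ : ∀ i : ℕ, P.tot.obj ((i : ℤ), 1 - (i : ℤ))} (hμ : IsMC P μ) :
    IsMC Q fun i => totMap φ _ (μ i) := by
  intro u
  rw [← map_zero (DirectSum.lmap (totMap φ)), ← hμ u, map_sum]
  refine Finset.sum_congr rfl fun x _ => ?_
  rw [map_smul, lmap_totMap_preLie hφ]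

end Map

end Operad

/-! ### The map `σ̄` -/

lemma sgn_mul_nat (R : Type u) [CommRing R] (k : ℤ) (n : ℕ) : sgn R k ^ n = sgn R (n * k) := by
  induction n with
  | zero => simp [sgn_zero]
  | succ n ih => rw [pow_succ, ih, ← sgn_add]; congr 1; push_cast; ring

/-- The `i` factors to the left of slot `i` each contribute `a`, and the slot itself contributes
`b`. -/
lemma prod_slot {M : Type*} [CommMonoid M] {n : ℕ} (i : Fin n) (a b : M) :
    (∏ v : Fin n, if (v : ℕ) < i then a else if (v : ℕ) = i then b else 1) = a ^ (i : ℕ) * b := by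
  obtain ⟨i, hi⟩ := i
  obtain ⟨t, rfl⟩ : ∃ t, n = i + 1 + t := ⟨n - (i + 1), by omega⟩
  rw [Fin.prod_univ_add, Fin.prod_univ_castSucc]
  have e : ∀ v : Fin t, ¬ (i + 1 + (v : ℕ) < i) ∧ ¬ (i + 1 + (v : ℕ) = i) := fun v => by omega
  simp [e]

/-- The Koszul sign of an operation of bidegree `q` and arity `m` passing an argument, before and
after conjugation with the shift: the two differ by a sign that does not depend on the argument. -/
lemma koszul_S_symm (X : BiMod.{u, v} R) (q : Bideg) (a m : ℤ) (x : X.shift.sum) :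
    X.koszul q (X.koszul (0, a + (m - 1)) (X.S.symm x)) =
      sgn R (q.2 - (m - 1)) •
        X.koszul (0, a) (X.S.symm (X.shift.koszul (q.1, q.2 - (m - 1)) x)) := by
  induction x using DirectSum.induction_on with
  | zero => simp
  | of d x =>
    change X.koszul q (X.koszul (0, a + (m - 1)) (X.S.symm (X.shift.of d x))) =
      sgn R (q.2 - (m - 1)) •
        X.koszul (0, a) (X.S.symm (X.shift.koszul (q.1, q.2 - (m - 1)) (X.shift.of d x)))
    rw [BiMod.koszul_of, map_smul, map_smul, X.S_symm_of, X.koszul_of, map_smul, X.koszul_of,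
      X.koszul_of, smul_smul, smul_smul, smul_smul, ← sgn_add, ← sgn_add, ← sgn_add]
    congr 1
    apply sgn_congr
    simp only [pair]
    exact ⟨-q.2 + (m - 1) * d.2, by ring⟩
  | add x y hx hy => simp only [map_add, smul_add, hx, hy]

/-- `σ̄ : End_X → 𝔰 End_{SX}` is compatible with insertions. -/
lemma sigmaBar_commutesWithComp (X : BiMod.{u, v} R) :
    Operad.CommutesWithComp (P := endOp X) (Q := susp (endOp X.shift)) (sigmaBar X) := by
  intro n m k p q r hk hr i f g
  refine Subtype.ext (MultilinearMap.ext fun x => ?_)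
  change X.S (f.1 (X.args hk q i g.1 fun s => X.koszul (0, (k : ℤ) - 1 - s) (X.S.symm (x s)))) =
    sgn R (((n : ℤ) - 1) * (q.2 - ((m : ℤ) - 1)) + ((n : ℤ) - 1 - i) * ((m : ℤ) - 1)) •
      X.S (f.1 fun v => X.koszul (0, (n : ℤ) - 1 - v) (X.S.symm
        (X.shift.args hk (q.1, q.2 - ((m : ℤ) - 1)) i (sigmaBarMap X m g.1) x v)))
  -- Slot by slot, the arguments passed to `f` on the two sides agree up to a sign.
  have hargs : (X.args hk q i g.1 fun s => X.koszul (0, (k : ℤ) - 1 - s) (X.S.symm (x s))) =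
      fun v : Fin n => (if (v : ℕ) < i then sgn R (q.2 - ((m : ℤ) - 1)) else
        if (v : ℕ) = i then sgn R (q.2 * ((n : ℤ) - 1 - i)) else 1) •
        X.koszul (0, (n : ℤ) - 1 - v) (X.S.symm
          (X.shift.args hk (q.1, q.2 - ((m : ℤ) - 1)) i (sigmaBarMap X m g.1) x v)) := by
    funext v
    rcases lt_trichotomy (v : ℕ) i with hv | hv | hv
    · rw [X.args_lt _ _ _ _ _ _ hv, BiMod.args_lt _ _ _ _ _ _ _ hv, if_pos hv,
        ← koszul_S_symm]
      congr 3
      ext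
      · rfl
      · simp only
        omega
    · rw [X.args_eq _ _ _ _ _ _ hv, BiMod.args_eq _ _ _ _ _ _ _ hv, if_neg (by omega), if_pos hv]
      change _ = _ • X.koszul _ (X.S.symm (X.S (g.1 fun w => X.koszul (0, (m : ℤ) - 1 - w)
        (X.S.symm (x ⟨i + w, by omega⟩)))))
      rw [LinearEquiv.symm_apply_apply, hv,
        show q.2 * ((n : ℤ) - 1 - i) = pair q (0, (n : ℤ) - 1 - i) by simp [pair],
        ← X.koszul_hom g.2]
      congr 1
      funext w
      rw [← X.koszul_add]
      congr 2
      ext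
      · simp
      · simp
        omega
    · rw [X.args_gt _ _ _ _ _ _ hv, BiMod.args_gt _ _ _ _ _ _ _ hv, if_neg (by omega),
        if_neg (by omega), one_smul]
      congr 3
      simp only
      omega
  rw [hargs, f.1.map_smul_univ, map_smul, prod_slot, sgn_mul_nat, ← sgn_add]
  congr 1
  apply sgn_congr
  exact ⟨0, by ring⟩

/-! ### Derived `A_∞`-relations and the Maurer–Cartan equation -/

lemma sum_antidiagonal_eq_sum_fin {M : Type*} [AddCommMonoid M] (u : ℕ) (F : ℕ → ℕ → M) :
    ∑ x ∈ antidiagonal u, F x.1 x.2 = ∑ p : Fin (u + 1), F (u - p) p := by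
  rw [← Finset.Nat.sum_antidiagonal_swap]
  refine (Finset.Nat.sum_antidiagonal_eq_sum_range_succ (fun i j => F j i) u).trans ?_
  exact Finset.sum_range fun p => F (u - p) p

namespace Operad

variable (P : Operad.{u, v} R)

/-- The relations indexed as in the definition of derived `A_∞`-algebras. -/
lemma satisfiesRelations_iff {d : ℕ → ℕ → Bideg} (f : ∀ i n : ℕ, P.obj (n + 1) (d i n)) :
    P.SatisfiesRelations f ↔ ∀ u w : ℕ,
      ∑ p : Fin (u + 1), ∑ b : Fin (w + 1), ∑ r : Fin (w - b + 1),
        sgn R (relSign r (b + 1) (w - b - r) p (w - b + 1)) •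
          P.ins r (P.incl (w - b + 1) _ (f (u - p) (w - b))) (P.incl (b + 1) _ (f p b)) = 0 := by
  refine forall_congr' fun u => forall_congr' fun w => ?_
  refine Eq.congr_left ?_
  rw [sum_antidiagonal_eq_sum_fin u fun i p => ∑ c ∈ antidiagonal w, ∑ r ∈ Finset.range (c.1 + 1),
    sgn R (relSign r (c.2 + 1) (c.1 - r) p (c.1 + 1)) •
      P.ins r (P.incl (c.1 + 1) _ (f i c.1)) (P.incl (c.2 + 1) _ (f p c.2))]
  refine Finset.sum_congr rfl fun p _ => ?_
  rw [sum_antidiagonal_eq_sum_fin w fun a b => ∑ r ∈ Finset.range (a + 1),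
    sgn R (relSign r (b + 1) (a - r) p (a + 1)) •
      P.ins r (P.incl (a + 1) _ (f (u - p) a)) (P.incl (b + 1) _ (f p b))]
  exact Finset.sum_congr rfl fun b _ => Finset.sum_range _

end Operad

/-- The class of an expression modulo the relations. -/
def Term.cls {G : ℕ → Bideg → Type} (S : ∀ (n : ℕ) (d : Bideg), Term R G n d → Prop) {n : ℕ}
    {d : Bideg} (t : Term R G n d) : Presented S n d :=
  Quotient.mk (Term.setoid S n d) t

lemma Term.cls_sum {G : ℕ → Bideg → Type} (S : ∀ (n : ℕ) (d : Bideg), Term R G n d → Prop)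
    {n : ℕ} {d : Bideg} (l : List (Term R G n d)) :
    (Term.sum l).cls S = (l.map (Term.cls S)).sum := by
  induction l with
  | nil => rfl
  | cons t l ih =>
    rw [List.map_cons, List.sum_cons, ← ih]
    rfl

lemma Term.cls_sum_flatMap {G : ℕ → Bideg → Type}
    (S : ∀ (n : ℕ) (d : Bideg), Term R G n d → Prop) {n k : ℕ} {d : Bideg}
    (f : Fin k → List (Term R G n d)) :
    (Term.sum ((List.finRange k).flatMap f)).cls S = ∑ a, (Term.sum (f a)).cls S := by
  rw [Fin.sum_univ_def]
  induction List.finRange k with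
  | nil => rfl
  | cons a l ih =>
    rw [List.flatMap_cons, List.map_cons, List.sum_cons, ← ih]
    simp only [Term.cls_sum, List.map_append, List.sum_append]

/-- The derived `A_∞`-relations hold in `dA_∞`. -/
lemma sum_gen_eq_zero (u w : ℕ) :
    ∑ p : Fin (u + 1), ∑ b : Fin (w + 1), ∑ r : Fin (w - b + 1),
      sgn R (relSign r (b + 1) (w - b - r) p (w - b + 1)) •
        (dAInf R).comp (k := w + 1) (r := ((u : ℤ), 3 - ((u : ℤ) + ((w : ℤ) + 1))))
          (p := (((u - p : ℕ) : ℤ), 2 - (((u - p : ℕ) : ℤ) + (((w - b : ℕ) : ℤ) + 1))))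
          (q := ((p : ℤ), 2 - ((p : ℤ) + ((b : ℤ) + 1))))
          (by have := b.isLt; omega)
          (by have := p.isLt; have := b.isLt; ext <;> simp <;> omega)
          r (dAInf.gen R (u - p) (w - b) rfl) (dAInf.gen R p b rfl) = 0 := by
  have h : (dAInfRelator R u w).cls (IsDAInfRelator R) = 0 :=
    Quotient.sound (Term.Rel.of (IsDAInfRelator.mk u w))
  rw [dAInfRelator, Term.cls_sum_flatMap] at h
  refine Eq.trans (Finset.sum_congr rfl fun p _ => ?_) h
  rw [Term.cls_sum_flatMap]
  refine Finset.sum_congr rfl fun b _ => ?_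
  rw [Term.cls_sum, List.map_map, Fin.sum_univ_def]
  rfl

/-- The images of the generators of `dA_∞` satisfy the derived `A_∞`-relations. -/
lemma DerivedAInfMultiplication.isMC_elem {O : Operad.{u, v} R} (m : DerivedAInfMultiplication O) :
    (susp O).IsMC m.elem := by
  refine (O.isMC_susp_collect_iff fun i n =>
    m.map (dAInf.gen R i n (by ext <;> simp; ring))).2 ?_
  rw [Operad.satisfiesRelations_iff]
  intro u w
  have hgen : ∀ (i n : ℕ) {d e : Bideg} (hd : d = ((i : ℤ), 2 - ((i : ℤ) + ((n : ℤ) + 1))))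
      (he : e = ((i : ℤ), 2 - ((i : ℤ) + ((n : ℤ) + 1)))),
      O.incl (n + 1) d (m.map (dAInf.gen R i n hd)) =
        O.incl (n + 1) e (m.map (dAInf.gen R i n he)) := by
    rintro i n d e rfl rfl
    rfl
  have h := congrArg (fun t => O.incl _ _ (m.map t)) (sum_gen_eq_zero (R := R) u w)
  simp only [map_sum, map_smul, m.map_comp, map_zero] at h
  refine Eq.trans ?_ h
  refine Finset.sum_congr rfl fun p _ => Finset.sum_congr rfl fun b _ =>
    Finset.sum_congr rfl fun r _ => ?_
  rw [← O.ins_incl, hgen (u - p) (w - b) _ rfl, hgen p b _ rfl]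

/-- Structure maps satisfying `IsMC` in `𝔰 End_X` form a derived `A_∞`-algebra. -/
lemma isDerivedAInfAlgebra_of_isMC (X : BiMod.{u, v} R)
    (f : ∀ i n : ℕ, (susp (endOp X)).obj (n + 1) ((i : ℤ), 1 - (i : ℤ)))
    (hf : (susp (endOp X)).IsMC fun i => (susp (endOp X)).collect _ (f i)) :
    IsDerivedAInfAlgebra X fun i n => (f i n).1 := by
  have hdeg : ∀ i n : ℕ, (((i : ℤ), 1 - (i : ℤ) - (((n + 1 : ℕ) : ℤ) - 1)) : Bideg) =
      ((i : ℤ), 2 - ((i : ℤ) + ((n : ℤ) + 1))) := fun i n => by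
    ext
    · rfl
    · simp only
      push_cast
      ring
  have hmem : ∀ i n : ℕ, (f i n).1 ∈ X.hom (n + 1) ((i : ℤ), 2 - ((i : ℤ) + ((n : ℤ) + 1))) :=
    fun i n => hdeg i n ▸ (f i n).2
  refine ⟨hmem, fun u w => ?_⟩
  have h := ((endOp X).satisfiesRelations_iff _).1 (((endOp X).isMC_susp_collect_iff f).1 hf) u w
  have hincl : ∀ (i n : ℕ) {d e : Bideg} (_ : d = e) (g : (endOp X).obj (n + 1) d)
      (g' : (endOp X).obj (n + 1) e) (_ : g.1 = g'.1),
      (endOp X).incl (n + 1) d g = (endOp X).incl (n + 1) e g' := by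
    rintro i n d _ rfl g g' hg
    rw [Subtype.ext hg]
  have hsum : (endOp X).incl (w + 1) ((u : ℤ), 3 - ((u : ℤ) + ((w : ℤ) + 1)))
      (∑ p : Fin (u + 1), ∑ b : Fin (w + 1), ∑ r : Fin (w - b + 1),
        sgn R (relSign r (b + 1) (w - b - r) p (w - b + 1)) •
          (endOp X).comp (k := w + 1)
            (p := (((u - p : ℕ) : ℤ), 2 - (((u - p : ℕ) : ℤ) + (((w - b : ℕ) : ℤ) + 1))))
            (q := ((p : ℤ), 2 - ((p : ℤ) + ((b : ℤ) + 1))))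
            (by have := b.isLt; omega)
            (by have := p.isLt; have := b.isLt; ext <;> simp <;> omega)
            r ⟨_, hmem (u - p) (w - b)⟩ ⟨_, hmem p b⟩) = 0 := by
    refine Eq.trans ?_ h
    simp only [map_sum, map_smul]
    refine Finset.sum_congr rfl fun p _ => Finset.sum_congr rfl fun b _ =>
      Finset.sum_congr rfl fun r _ => congrArg _ ?_
    rw [← Operad.ins_incl, hincl (u - p) (w - b) (hdeg _ _).symm _ (f (u - p) (w - b)) rfl,
      hincl p b (hdeg _ _).symm _ (f p b) rfl]
    have := p.isLt
    have := b.isLt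
    ext <;> simp <;> omega
  have h0 := (endOp X).incl_injective (hsum.trans (map_zero _).symm)
  have h1 := congrArg (X.hom _ _).subtype h0
  simp only [map_sum, map_smul, map_zero] at h1
  exact h1

/-! ### Compatibility of `Φ` with the structure maps -/

/-- If `h` vanishes on lists with at least as many elements as there are operations, then so does
every sum of insertions of these operations in `h`. -/
lemma weave_eq_zero {X Y : Type*} [AddCommMonoid Y] (κ : Bideg → X → X)
    (gs : List (Bideg × (List X → X))) {h : List X → Y}
    (hh : ∀ l, gs.length ≤ l.length → h l = 0) (zs : List X) : weave κ gs h zs = 0 := by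
  induction gs generalizing h zs with
  | nil => exact hh zs (Nat.zero_le _)
  | cons g gs ih =>
    have hcons : ∀ (a : X) (l : List X), gs.length ≤ l.length → h (a :: l) = 0 := fun a l hl =>
      hh _ (Nat.succ_le_succ hl)
    clear hh
    induction zs generalizing h with
    | nil => exact ih (hcons _) _
    | cons z zs ihz =>
      rw [weave_cons_cons, ihz (h := fun l => h (_ :: l)) fun a l hl =>
        hcons _ (a :: l) (hl.trans (Nat.le_succ _)), add_zero]
      refine Eq.trans ?_ (splitSum_zero (z :: zs))
      congr 1
      funext l r
      exact ih (hcons _) _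

namespace Operad

section Arity

variable {P : Operad.{u, v} R}

/-- At least two arguments cannot be inserted in an element of arities `0` and `1`. -/
lemma brace_right_eq_zero {j : ℕ} {e : Bideg} {d : Fin (j + 2) → Bideg} {D : Bideg}
    (hD : D = e + ∑ v, d v) (μ : P.tot.obj e) (g : ∀ v, (endOp P.tot).tot.obj (d v)) :
    (endOp P.tot).brace (j + 2) e d D hD (P.right e μ) g = 0 := by
  funext n
  refine Subtype.ext (MultilinearMap.ext fun z => ?_)
  rw [brace_endOp]
  refine weave_eq_zero _ _ (fun l hl => ?_) _
  match l with
  | [] => simp at hl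
  | [_] => simp at hl
  | a :: b :: l => exact rightList_cons_cons e μ a b l

end Arity

section Morphism

lemma braceMap_of (P : Operad.{u, v} R) {e : Bideg} (μ : P.tot.obj e) {n : ℕ} {d : Fin n → Bideg}
    (z : ∀ v, P.tot.obj (d v)) :
    (P.braceMap n e μ).1 (fun v => P.tot.of (d v) (z v)) =
      P.tot.of (∑ v, d v + e) (P.brace n e d _ (add_comm _ _) μ z) :=
  MultilinearMap.fromDirectSumEquiv_lof _ _ _

lemma primedMaps_zero_of (P : Operad.{u, v} R) {e d : Bideg} (μ : P.tot.obj e) (z : P.tot.obj d) :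
    (P.primedMaps e μ 0).1 (fun _ => P.tot.of d z) =
      P.preLie μ z - sgn R (pair d e) • P.preLie z μ := by
  refine congrArg₂ (· - ·) ?_ (rightLin_of_eq_preLie e μ z)
  exact (P.braceMap_of μ (d := fun _ : Fin 1 => d) fun _ => z).trans (P.of_brace _ _ _ _)

/-- On homogeneous elements, compatibility of a linear map with the operations `M'_j` is
compatibility with the graded commutator for the pre-Lie product and with the higher braces. -/
lemma lmap_primedMaps {P Q : Operad.{u, v} R} (ψ : ∀ d, P.tot.obj d →ₗ[R] Q.tot.obj d) {e : Bideg}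
    {μ : P.tot.obj e} {ν : Q.tot.obj e}
    (h₁ : ∀ {d : Bideg} (z : P.tot.obj d),
      DirectSum.lmap ψ (P.preLie μ z - sgn R (pair d e) • P.preLie z μ) =
        Q.preLie ν (ψ d z) - sgn R (pair d e) • Q.preLie (ψ d z) ν)
    (h₂ : ∀ {n : ℕ} {d : Fin (n + 2) → Bideg} {D : Bideg} (hD : D = e + ∑ v, d v)
      (z : ∀ v, P.tot.obj (d v)),
      ψ D (P.brace (n + 2) e d D hD μ z) = Q.brace (n + 2) e d D hD ν fun v => ψ (d v) (z v))
    (n : ℕ) (a : Fin (n + 1) → P.tot.sum) :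
    DirectSum.lmap ψ ((P.primedMaps e μ n).1 a) =
      (Q.primedMaps e ν n).1 fun v => DirectSum.lmap ψ (a v) := by
  have hψ : ∀ d (x : P.tot.obj d), DirectSum.lmap ψ (P.tot.of d x) = Q.tot.of d (ψ d x) :=
    fun d x => DirectSum.lmap_lof _ _ _
  suffices h : (DirectSum.lmap ψ).compMultilinearMap (P.primedMaps e μ n).1 =
      (Q.primedMaps e ν n).1.compLinearMap fun _ => DirectSum.lmap ψ from DFunLike.congr_fun h a
  refine MultilinearMap.directSum_ext fun d => MultilinearMap.ext fun z => ?_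
  change DirectSum.lmap ψ ((P.primedMaps e μ n).1 fun v => P.tot.of (d v) (z v)) =
    (Q.primedMaps e ν n).1 fun v => DirectSum.lmap ψ (P.tot.of (d v) (z v))
  rw [show (fun v => DirectSum.lmap ψ (P.tot.of (d v) (z v))) =
    fun v => Q.tot.of (d v) (ψ (d v) (z v)) from funext fun v => hψ _ _]
  match n, d, z with
  | 0, d, z =>
    have hz : ∀ {A : BiMod.{u, v} R} (f : ∀ v : Fin 1, A.obj (d v)),
        (fun v : Fin 1 => A.of (d v) (f v)) = fun _ => A.of (d 0) (f 0) :=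
      fun f => funext fun v => by rw [Subsingleton.elim v 0]
    rw [hz (A := P.tot) z, hz (A := Q.tot) fun v => ψ (d v) (z v)]
    exact (congrArg _ (P.primedMaps_zero_of μ (z 0))).trans
      ((h₁ (z 0)).trans (Q.primedMaps_zero_of ν (ψ _ (z 0))).symm)
  | n + 1, d, z =>
    exact (congrArg _ (P.braceMap_of μ z)).trans
      ((hψ _ _).trans ((congrArg _ (h₂ _ z)).trans (Q.braceMap_of ν _).symm))

/-- The composite of `x ↦ ∑ₙ bₙ(x; -)` with a map out of the endomorphism operad. -/
def bracesMap {P Q : Operad.{u, v} R} (φ : ∀ n d, (endOp P.tot).obj n d →ₗ[R] Q.obj n d)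
    (d : Bideg) : P.tot.obj d →ₗ[R] Q.tot.obj d :=
  totMap φ d ∘ₗ P.bracesLin d

variable {P Q : Operad.{u, v} R} {φ : ∀ n d, (endOp P.tot).obj n d →ₗ[R] Q.obj n d}

lemma lmap_sub_smul {X Y : BiMod.{u, v} R} (ψ : ∀ d, X.obj d →ₗ[R] Y.obj d) (a b : X.sum) (c : R) :
    DirectSum.lmap ψ (a - c • b) = DirectSum.lmap ψ a - c • DirectSum.lmap ψ b := by
  rw [map_sub, map_smul]

lemma sub_smul_sub_smul {X : BiMod.{u, v} R} (a b x : X.sum) (c : R) :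
    a - c • x - c • (b - x) = a - c • b := by
  rw [smul_sub]
  abel

lemma brace_sub_of_eq_zero (P : Operad.{u, v} R) {j : ℕ} {d₀ : Bideg} {d : Fin j → Bideg}
    {D : Bideg} (hD : D = d₀ + ∑ v, d v) (x : P.tot.obj d₀) {x' : P.tot.obj d₀}
    {y : ∀ v, P.tot.obj (d v)} (h : P.brace j d₀ d D hD x' y = 0) :
    P.brace j d₀ d D hD (x - x') y = P.brace j d₀ d D hD x y := by
  rw [map_sub, sub_apply, h, sub_zero]

/-- The graded commutators with `μ` and with `∑_j M'_j` correspond to each other: the contribution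
of `right` to both terms is the same. -/
lemma commutator_braces {e d : Bideg} (μ : P.tot.obj e) (z : P.tot.obj d) :
    DirectSum.lmap P.bracesLin (P.preLie μ z - sgn R (pair d e) • P.preLie z μ) =
      (endOp P.tot).preLie ((endOp P.tot).collect e (P.primedMaps e μ)) (P.braces z) -
        sgn R (pair d e) •
          (endOp P.tot).preLie (P.braces z) ((endOp P.tot).collect e (P.primedMaps e μ)) := by
  have h₁ := LinearMap.map_sub₂ (endOp P.tot).preLie (P.braces μ) (P.right e μ) (P.braces z)
  have h₂ := map_sub ((endOp P.tot).preLie (P.braces z)) (P.braces μ) (P.right e μ)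
  rw [collect_primedMaps, h₁, h₂, preLie_right_braces]
  refine (lmap_sub_smul P.bracesLin _ _ _).trans
    (Eq.trans ?_ (sub_smul_sub_smul (X := (endOp P.tot).tot) _ _ _ _).symm)
  rw [lmap_braces_preLie, lmap_braces_preLie]

/-- The operations `M'_j` determined by `μ` and those determined by the image `∑_j φ(M'_j)` of
`∑_j M'_j` are intertwined by `x ↦ ∑ₙ φ(bₙ(x; -))`. -/
theorem lmap_bracesMap_primedMaps (hφ : CommutesWithComp φ) {e : Bideg} (μ : P.tot.obj e) (n : ℕ)
    (a : Fin (n + 1) → P.tot.sum) :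
    DirectSum.lmap (bracesMap φ) ((P.primedMaps e μ n).1 a) =
      (Q.primedMaps e (totMap φ e ((endOp P.tot).collect e (P.primedMaps e μ))) n).1
        fun v => DirectSum.lmap (bracesMap φ) (a v) := by
  refine lmap_primedMaps (bracesMap φ) (fun {d} z => ?_) (fun {n d D} hD z => ?_) n a
  · have hcomp : ∀ a, DirectSum.lmap (bracesMap φ) a =
        DirectSum.lmap (totMap φ) (DirectSum.lmap P.bracesLin a) := fun a =>
      LinearMap.congr_fun (DirectSum.lmap_comp P.bracesLin (totMap φ)) a
    rw [hcomp, commutator_braces]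
    refine (lmap_sub_smul (totMap φ) _ _ _).trans ?_
    rw [lmap_totMap_preLie hφ, lmap_totMap_preLie hφ]
    rfl
  · refine Eq.trans (congrArg (totMap φ D) ?_) (totMap_brace hφ hD _ fun v => P.braces (z v))
    rw [collect_primedMaps, brace_sub_of_eq_zero _ _ _ (brace_right_eq_zero hD μ _)]
    exact P.braces_brace hD μ z

end Morphism

end Operad

section Shift

variable {X Y : BiMod.{u, v} R} (ψ : ∀ d, X.obj d →ₗ[R] Y.obj d)

/-- Applying a map in the shifted bidegrees is conjugation with the shift. -/
lemma lmap_S (a : X.sum) :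
    DirectSum.lmap (fun d : Bideg => ψ (d.1, d.2 - 1)) (X.S a) = Y.S (DirectSum.lmap ψ a) := by
  obtain ⟨b, rfl⟩ := X.S.symm.surjective a
  rw [LinearEquiv.apply_symm_apply]
  induction b using DirectSum.induction_on with
  | zero => simp
  | of d x =>
    change DirectSum.lmap _ (X.shift.of d x) =
      Y.S (DirectSum.lmap ψ (X.S.symm (X.shift.of d x)))
    have h1 : DirectSum.lmap (fun d : Bideg => ψ (d.1, d.2 - 1)) (X.shift.of d x) =
        Y.shift.of d (ψ (d.1, d.2 - 1) x) := DirectSum.lmap_lof _ _ _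
    have h2 : DirectSum.lmap ψ (X.of (d.1, d.2 - 1) x) = Y.of (d.1, d.2 - 1) (ψ _ x) :=
      DirectSum.lmap_lof _ _ _
    rw [h1, X.S_symm_of, h2, Y.S_of]
  | add b c hb hc => simp only [map_add, hb, hc]

lemma lmap_koszul (q : Bideg) (a : X.sum) :
    DirectSum.lmap ψ (X.koszul q a) = Y.koszul q (DirectSum.lmap ψ a) := by
  induction a using DirectSum.induction_on with
  | zero => simp
  | of d x =>
    change DirectSum.lmap ψ (X.koszul q (X.of d x)) = Y.koszul q (DirectSum.lmap ψ (X.of d x))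
    have h : DirectSum.lmap ψ (X.of d x) = Y.of d (ψ d x) := DirectSum.lmap_lof _ _ _
    rw [X.koszul_of, map_smul, h, Y.koszul_of]
  | add a b ha hb => simp only [map_add, ha, hb]

/-- A map intertwining two operations intertwines their conjugates by the shift. -/
lemma lmap_sigmaBarMap {n : ℕ} {f : X.Multi n} {g : Y.Multi n}
    (h : ∀ a : Fin n → X.sum, DirectSum.lmap ψ (f a) = g fun v => DirectSum.lmap ψ (a v))
    (x : Fin n → X.shift.sum) :
    DirectSum.lmap (fun d : Bideg => ψ (d.1, d.2 - 1)) (sigmaBarMap X n f x) =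
      sigmaBarMap Y n g fun v => DirectSum.lmap (fun d : Bideg => ψ (d.1, d.2 - 1)) (x v) := by
  change DirectSum.lmap _ (X.S (f fun v => X.koszul (0, (n : ℤ) - 1 - v) (X.S.symm (x v)))) =
    Y.S (g fun v => Y.koszul (0, (n : ℤ) - 1 - v)
      (Y.S.symm (DirectSum.lmap (fun d : Bideg => ψ (d.1, d.2 - 1)) (x v))))
  rw [lmap_S, h]
  congr 2
  funext v
  rw [lmap_koszul]
  congr 1
  rw [LinearEquiv.eq_symm_apply, ← lmap_S, LinearEquiv.apply_symm_apply]

end Shift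

namespace Operad

variable {O : Operad.{u, v} R} {μ : ∀ i : ℕ, (susp O).tot.obj ((i : ℤ), 1 - (i : ℤ))}

/-- The elements `∑_{j ≥ 1} M_{ij}` satisfy the same equation as the elements `μ_i`. -/
lemma IsMC.maps (hμ : IsMC (susp O) μ) :
    IsMC (susp (endOp O.SS)) fun i => (susp (endOp O.SS)).collect _ (O.maps μ i) := by
  have h := hμ.primedMaps.map (sigmaBar_commutesWithComp (susp O).tot)
  rwa [show (fun i => totMap (sigmaBar (susp O).tot) _
    ((endOp (susp O).tot).collect _ ((susp O).primedMaps _ (μ i)))) = _ from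
      funext fun i => totMap_collect _ _ _] at h

end Operad

end DerivedAInf

end

/-- `Φ : S𝔰O → S𝔰 End_{S𝔰O}` is a morphism of derived `A_∞`-algebras. -/
theorem mainTheorem4 {R : Type u} [CommRing R] (O : Operad.{u, v} R)
    (m : DerivedAInfMultiplication O) :
    IsDerivedAInfMorphism (X := O.SS) (Y := (endOp O.SS).SS) m.M m.Mbar O.Phi := by
  have hM : (susp (endOp O.SS)).IsMC m.totalM := m.isMC_elem.maps
  refine ⟨isDerivedAInfAlgebra_of_isMC _ _ hM, isDerivedAInfAlgebra_of_isMC _ _ hM.maps, ?_⟩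
  intro i n x
  have htotal : m.totalM i = Operad.totMap (sigmaBar (susp O).tot) _
      ((endOp (susp O).tot).collect _ ((susp O).primedMaps _ (m.elem i))) :=
    (Operad.totMap_collect _ _ _).symm
  refine lmap_sigmaBarMap (Operad.bracesMap (sigmaBar (susp O).tot)) (fun a => ?_) x
  rw [htotal]
  exact Operad.lmap_bracesMap_primedMaps (sigmaBar_commutesWithComp _) (m.elem i) n a
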